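/- **Setting.** There are $n$ validators, at most $f$ of them Byzantine (the others are honest), and $n\ge 3f+2p+1$ for a parameter $p\ge 0$. User actors belong to honest or Byzantine users. A transaction is either a UA transaction $\langle A,sn,\mathcal O,Code\rangle$ of a user actor $A$, or a UA-RA transaction $\langle A,sn,X,\mathcal O,Code_{pre},Call,Code_{post}\rangle$ of a user actor $A$ to a reactive actor $X$, or an RA-RA transaction $\langle X,Y,\mathcal O,Code_{pre},Call,Code_{post}\rangle$ of a reactive actor $X$ to a reactive actor $Y$; $\mathcal O$ is the finite set of consumed objects. Objects have unique identities: two different transactions never create the same object, and no transaction creates an initial one. Every validator $V$ keeps an entity $V.A$ for each user actor $A$ and an entity $V.X$ for each reactive actor $X$ that it has created; executing a transaction may create objects at user actors and new reactive actors, and, at a reactive actor, change its state and its objects deterministically and issue RA-RA transactions, each of which is dropped if the objects it consumes are not owned. The network is partially synchronous: a message (between honest validators, or from an honest user to an honest validator) sent at time $t$ is delivered by $\max(t+\Delta,GST+\Delta)$; honest validators eventually take each step that stays enabled. User signatures and aggregated vote signatures cannot be forged. An honest user issues transactions with consecutive sequence numbers, and issues one only when $f+1$ validators report that the previous sequence number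 is executed and, for each object it consumes, that the object is owned by the actor, and it never spends an object twice. **Protocol (Mangrove).** Each $V.A$ keeps maps $FPLocked$, $SPLocked$ from sequence numbers to transactions, whose entries are never changed once set. On receiving a signed UA-RA transaction $tx$ with $FPLocked[sn]\in\{\bot,tx\}$, $V.A$ FP-locks it, waits until $sn-1$ is executed and the consumed objects are owned, and sends $tx$ to the recipient $V.X$, which adds it to its pool unless it was executed; an RA-RA transaction issued at $V.X$ is put in the same way into the pool of its recipient at $V$. For each $X$ the entities $V.X$ run consecutive instances $k=0,1,\dots$ of *Parallel Optimistic Agreement* (POA), the leader of the instance being given by a common oracle which names an honest validator infinitely often. In an instance the leader broadcasts its pool as a block $B$ of transactions addressed to $X$; within $3\Delta$ and once all RA-RA transactions of $B$ are in its pool, $V.X$ requests FP-locks for all UA-RA transactions of $B$ (each granted if the signature is valid, no conflicting transaction is FP-locked, and the previous sequence number is executed and the consumed objects are owned within $\Delta$), and then broadcasts a vote for $B$ if all were granted and a negative vote otherwise, together with its pool as a fallback block; if the proposal could not be considered within $3\Delta$, it votes negatively. On $n-p$ votes for $B$, or a valid proof (aggregate signature of such votes), $V.X$ decides $B$ and broadcasts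 the proof. After $3\Delta$ and $n-f$ votes, $V.X$ enters the slow path: if some block has at least $n-p-2f$ votes it tries to SP-lock its UA-RA transactions and, if this succeeds, proposes it to Quorum Consensus; otherwise it proposes the transactions that lie in at least $n-2f$ fallback blocks, without the UA-RA transactions that cannot be SP-locked. For each UA-RA transaction of the block $B_{qc}$ decided there, $V.A$ proposes the transaction SP-locked at its sequence number ($tx$ itself if there was none) to the Transaction Agreement instance of $(A,sn)$, and $V.X$ decides $B_{qc}$ without the UA-RA transactions that were not decided there. A decided block is executed in a fixed deterministic order, skipping transactions executed before; then the next instance starts. UA transactions are decided by *Parallel Optimistic Broadcast* (FP-lock and vote; decision on $n-p$ votes or a proof; on $n-p-2f$ votes, SP-lock and proposal to the same Transaction Agreement instance; decision by it), and decided UA transactions, and the effects of executed UA-RA transactions, are applied at $V.A$ as soon as the previous sequence number is executed and the consumed objects are owned. *Quorum Consensus* and *Transaction Agreement* are consensus primitives. Agreement: honest validators decide the same. Termination: if all honest validators propose, or some honest validator decides, then all honest validators eventually decide. Quorum Validity: for Quorum Consensus, a transaction in every proposal made by honest validators is in the decided block, and each transaction in the decided block is in the proposals of at least $n-3f$ honest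 validators; for Transaction Agreement (which may also decide "no transaction"), if all proposals made by honest validators are equal only that value can be decided, and a decided transaction was proposed by at least $n-3f$ honest validators. A transaction is *emitted* at a moment if either it is a user transaction from $A$ signed and released by its user at that moment, and there is an honest $V$ such that $V.A$ will eventually have executed sequence number $sn-1$ (no condition for the first sequence number) and will eventually own all objects it consumes; or it is an RA-RA transaction issued at that moment by a reactive actor at an honest validator in executing a transaction. **Theorem.** In every execution of this protocol: 1. *(Agreement)* For all honest validators $V_1,V_2$, every reactive actor $X$ and every transaction $tx$: if $V_1.X$ executes $tx$, then $V_2.X$ eventually executes $tx$. 2. *(Validity)* If an honest user issues a UA-RA transaction $tx$ to a reactive actor $X$, then every honest $V.X$ later executes $tx$. If a reactive actor $X$ at some honest validator emits an RA-RA transaction $tx$ to a reactive actor $Y$, then every honest $V.Y$ eventually executes $tx$. (The recipient is a reactive actor, i.e. it is created at some honest validator.) 3. *(Total Order)* For every reactive actor $X$, all honest $V_1,V_2$ and all $tx_1,tx_2$: if $V_1.X$ executes $tx_1$ before $tx_2$, then $V_2.X$ executes $tx_1$ before $tx_2$. 4. *(Integrity)* For every reactive actor $X$, every honest $V$ and every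 $tx$: $V.X$ executes $tx$ at most once, and only if $tx$ was emitted before. -/

import Mathlib

namespace Mangrove

noncomputable section

open scoped Classical

/-! Transactions, messages, local states -/

/-- Transactions. `U` : user actors, `R` : reactive actors, `O` : owned objects, `C` : code.
`ua` is a user transaction without recipient, `uara` a user transaction with a reactive recipient,
`rara` a transaction of a reactive actor `X` with a reactive recipient `Y`. -/
inductive Tx (U R O C : Type*)
  | ua (A : U) (sn : ℕ) (objs : Finset O) (code : C)
  | uara (A : U) (sn : ℕ) (X : R) (objs : Finset O) (pre call post : C)
  | rara (X Y : R) (objs : Finset O) (pre call post : C)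

namespace Tx

variable {U R O C : Type*}

/-- The sender and the sequence number of a user transaction. Two distinct user transactions are
conflicting when they have the same slot. -/
def slot : Tx U R O C → Option (U × ℕ)
  | ua A sn _ _ => some (A, sn)
  | uara A sn _ _ _ _ _ => some (A, sn)
  | rara _ _ _ _ _ _ => none

/-- The consumed objects. -/
def objs : Tx U R O C → Finset O
  | ua _ _ o _ => o
  | uara _ _ _ o _ _ _ => o
  | rara _ _ o _ _ _ => o

/-- The reactive actor that a transaction is addressed to. -/
def recv : Tx U R O C → Option R
  | ua _ _ _ _ => none
  | uara _ _ X _ _ _ _ => some X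
  | rara _ Y _ _ _ _ => some Y

def IsUA : Tx U R O C → Prop
  | ua _ _ _ _ => True
  | _ => False

def IsUARA : Tx U R O C → Prop
  | uara _ _ _ _ _ _ _ => True
  | _ => False

def IsRARA : Tx U R O C → Prop
  | rara _ _ _ _ _ _ => True
  | _ => False

end Tx

/-- Blocks and pools are finite sets of transactions. -/
abbrev Block (U R O C : Type*) := Finset (Tx U R O C)

/-- Messages between validators (always broadcast by honest validators). A vote `none` is the
negative vote. Proofs are aggregate signatures of votes; see `State.verifyPoa`, `State.verifyPob`
for their verification. -/
inductive Msg (U R O C : Type*)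
  | proposal (X : R) (k : ℕ) (B : Block U R O C)
  | vote (X : R) (k : ℕ) (w : Option (Block U R O C)) (fallback : Block U R O C)
  | proof (X : R) (k : ℕ) (B : Block U R O C)
  | pobVote (l : U × ℕ) (w : Option (Tx U R O C))
  | pobProof (tx : Tx U R O C)

/-- Progress of one fast-path lock request: not handled yet; handled at the given time and waiting
for the execution preconditions; answered. -/
inductive LockStatus
  | fresh
  | waiting (since : ℝ)
  | answered (success : Bool)

/-- Progress of the slow path of one agreement instance at one validator. -/
inductive SlowPhase (U R O C : Type*)
  | off
  | candidate (B : Block U R O C)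
  | fallback (B : Block U R O C)
  | proposed

/-- Effects of executing a user transaction without recipient. -/
structure UserEffects (U R O : Type*) where
  created : Finset (U × O)
  actors : Finset R

/-- A transaction issued by a reactive actor, without the sender (which is that actor). -/
structure OutCall (R O C : Type*) where
  recv : R
  objs : Finset O
  pre : C
  call : C
  post : C

def OutCall.toTx {U R O C : Type*} (X : R) (c : OutCall R O C) : Tx U R O C :=
  Tx.rara X c.recv c.objs c.pre c.call c.post

/-- Effects of executing a transaction at a reactive actor: its new state, the objects it comes to
own, the objects created at user actors, the new reactive actors, and the outgoing transactions. -/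
structure CallEffects (U R O C S : Type*) where
  state : S
  gained : Finset O
  created : Finset (U × O)
  actors : Finset R
  out : List (OutCall R O C)

/-- Goes through the outgoing transactions in order; one whose consumed objects are all owned
consumes them and is sent, any other one is dropped. Returns the remaining objects and the sent
transactions. -/
def release {U R O C : Type*} (X : R) :
    Finset O → List (OutCall R O C) → Finset O × List (Tx U R O C)
  | owned, [] => (owned, [])
  | owned, c :: cs =>
    if c.objs ⊆ owned then
      ((release (U := U) X (owned \ c.objs) cs).1,
        c.toTx X :: (release (U := U) X (owned \ c.objs) cs).2)
    else release X owned cs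

/-- The entity `V.X` of a validator `V` for a reactive actor `X`. -/
structure RState (U R O C S : Type*) where
  /-- the entity exists -/
  active : Prop
  /-- the current agreement instance -/
  inst : ℕ
  /-- `True` while the current instance is undecided; `False` while its block is executed -/
  running : Prop
  /-- the time of the last start of the timer -/
  start : ℝ
  pool : Block U R O C
  executed : Block U R O C
  state : S
  /-- the objects owned by the reactive actor -/
  objs : Finset O
  /-- decided transactions that are still to be executed -/
  queue : List (Tx U R O C)
  /-- the leader's proposal per instance -/
  block : ℕ → Option (Block U R O C)
  /-- the instances in which fast-path locks have been requested -/
  lockPhase : Set ℕ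
  lockStatus : ℕ → Tx U R O C → LockStatus
  slow : ℕ → SlowPhase U R O C
  qcProp : ℕ → Option (Block U R O C)
  qcDec : ℕ → Option (Block U R O C)

/-- The state of a validator: its links, the data of its user actor entities, and its reactive actor
entities. Maps indexed by `U × ℕ` are indexed by a user actor and a sequence number. -/
structure VState (V U R O C S : Type*) where
  /-- messages broadcast to all validators -/
  sent : Set (Msg U R O C)
  /-- messages delivered, with their senders -/
  rcvd : Finset (V × Msg U R O C)
  /-- user transactions delivered -/
  rcvdTx : Set (Tx U R O C)
  fpLocked : U × ℕ → Option (Tx U R O C)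
  spLocked : U × ℕ → Option (Tx U R O C)
  /-- ownership of objects by user actors -/
  owned : Set (U × O)
  /-- the sequence numbers executed at the user actor entities -/
  done : Set (U × ℕ)
  /-- UA-RA transactions that wait for their preconditions before they are forwarded -/
  awaiting : Set (Tx U R O C)
  pobDec : U × ℕ → Option (Tx U R O C)
  /-- decided user transactions that wait for execution -/
  pending : Set (Tx U R O C)
  taProp : U × ℕ → Option (Tx U R O C)
  taDec : U × ℕ → Option (Option (Tx U R O C))
  /-- notifications of execution, sent from reactive to user actor entities -/
  notices : Set (Tx U R O C × Finset (U × O))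
  /-- the reactive actors created so far -/
  actors : Set R
  /-- transactions on the inner links towards reactive actor entities -/
  inbox : Set (Tx U R O C)
  ra : R → RState U R O C S

/-- The global state. For honest users, `sns` is the next sequence number and `spent` are the objects
consumed by the transactions issued so far. `signed` are the user transactions signed and
released by their senders. -/
structure State (V U R O C S : Type*) where
  val : V → VState V U R O C S
  signed : Set (Tx U R O C)
  sns : U → ℕ
  spent : Set (U × O)

/-- The parameters of a system. -/
structure Sys (V U R O C S : Type*) where
  /-- bound on the number of Byzantine validators -/
  f : ℕ
  /-- fast-path resilience -/
  p : ℕ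
  honest : Finset V
  honestUsers : Set U
  /-- the leader oracle -/
  leader : ℕ → V
  delta : ℝ
  gst : ℝ
  /-- the deterministic order in which a block is executed -/
  order : Block U R O C → List (Tx U R O C)
  /-- the virtual machine on transactions without recipient -/
  execUser : Tx U R O C → UserEffects U R O
  /-- the virtual machine at a reactive actor, given its state and its objects -/
  execCall : R → S → Finset O → Tx U R O C → CallEffects U R O C S
  genesisOwned : Set (U × O)
  genesisActors : Set R
  initState : R → S
  initObjs : R → Finset O

variable {V U R O C S : Type*} [Fintype V]

/-- Some execution of `tx` creates the object `c.2` at the user actor `c.1`. -/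
def Sys.Creates (P : Sys V U R O C S) (tx : Tx U R O C) (c : U × O) : Prop :=
  c ∈ (P.execUser tx).created ∨ ∃ X s o, c ∈ (P.execCall X s o tx).created

/-- The standing assumptions on the parameters. -/
structure Sys.Valid (P : Sys V U R O C S) : Prop where
  resilience : 3 * P.f + 2 * P.p + 1 ≤ Fintype.card V
  byzantine : (Finset.univ \ P.honest).card ≤ P.f
  delta_pos : 0 < P.delta
  leader_honest : ∀ N, ∃ k, N ≤ k ∧ P.leader k ∈ P.honest
  order_nodup : ∀ B, (P.order B).Nodup
  order_mem : ∀ B tx, tx ∈ P.order B ↔ tx ∈ B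
  /-- objects have unique identities: a consumed object is never created again -/
  created_unique : ∀ tx tx' c, P.Creates tx c → P.Creates tx' c → tx = tx'
  created_new : ∀ tx c, P.Creates tx c → c ∉ P.genesisOwned

/-! Operations on local states -/

/-- The entry of a lock map for the slot of `tx`. -/
def lockOf (L : U × ℕ → Option (Tx U R O C)) (tx : Tx U R O C) : Option (Tx U R O C) :=
  tx.slot.bind L

/-- Locks `tx` unless its slot is already taken. -/
def tryLock (L : U × ℕ → Option (Tx U R O C)) (tx : Tx U R O C) :
    U × ℕ → Option (Tx U R O C) :=
  fun l => if tx.slot = some l ∧ L l = none then some tx else L l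

namespace VState

def setRA (g : VState V U R O C S) (X : R) (r : RState U R O C S) : VState V U R O C S :=
  { g with ra := Function.update g.ra X r }

/-- The execution preconditions of a user transaction at its user actor entity: the preceding
sequence number is executed and the consumed objects are owned. -/
def Ready (g : VState V U R O C S) (tx : Tx U R O C) : Prop :=
  ∀ A sn, tx.slot = some (A, sn) →
    (∀ m, m + 1 = sn → (A, m) ∈ g.done) ∧ ∀ o ∈ tx.objs, (A, o) ∈ g.owned

/-- The validators from which a vote `w` in instance `k` of `X` was received. -/
def votersFor (g : VState V U R O C S) (X : R) (k : ℕ) (w : Option (Block U R O C)) : Finset V :=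
  Finset.univ.filter fun u => ∃ b, (u, Msg.vote X k w b) ∈ g.rcvd

/-- The validators from which any vote in instance `k` of `X` was received. -/
def voters (g : VState V U R O C S) (X : R) (k : ℕ) : Finset V :=
  Finset.univ.filter fun u => ∃ w b, (u, Msg.vote X k w b) ∈ g.rcvd

/-- The validators from which a fallback block containing `tx` was received. -/
def fallbackVoters (g : VState V U R O C S) (X : R) (k : ℕ) (tx : Tx U R O C) : Finset V :=
  Finset.univ.filter fun u => ∃ w b, (u, Msg.vote X k w b) ∈ g.rcvd ∧ tx ∈ b

/-- The transactions in the fallback blocks of at least `m` validators. -/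
def fallbackBlock (g : VState V U R O C S) (X : R) (k m : ℕ) : Block U R O C :=
  (g.rcvd.biUnion fun e => match e.2 with
    | Msg.vote X' k' _ b => if X' = X ∧ k' = k then b else ∅
    | _ => ∅).filter fun tx => m ≤ (g.fallbackVoters X k tx).card

/-- The validators from which a broadcast vote for the user transaction `tx` was received. -/
def pobVoters (g : VState V U R O C S) (tx : Tx U R O C) : Finset V :=
  Finset.univ.filter fun u => ∃ l, tx.slot = some l ∧ (u, Msg.pobVote l (some tx)) ∈ g.rcvd

/-- Records at the user actor entities that `tx` is executed: its objects are consumed, the created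
ones are handed to their owners, and the sequence number is marked. -/
def settle (g : VState V U R O C S) (tx : Tx U R O C) (created : Finset (U × O)) :
    VState V U R O C S :=
  { g with
    owned := (g.owned \ {c | ∃ sn, tx.slot = some (c.1, sn) ∧ c.2 ∈ tx.objs}) ∪ {c | c ∈ created}
    done := g.done ∪ {l | tx.slot = some l} }

/-- Decides `tx` in the broadcast instance of its slot. -/
def pobDecide (g : VState V U R O C S) (signed : Set (Tx U R O C)) (tx : Tx U R O C) :
    VState V U R O C S :=
  { g with
    pobDec := fun l => if tx.slot = some l then some tx else g.pobDec l
    pending := g.pending ∪ {t | t = tx ∧ t ∈ signed} }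

/-- A validator is in the undecided instance `k` of `X`. -/
def InInst (g : VState V U R O C S) (X : R) (k : ℕ) : Prop :=
  (g.ra X).active ∧ (g.ra X).running ∧ (g.ra X).inst = k

/-- A validator has broadcast its vote in instance `k` of `X`. -/
def Voted (g : VState V U R O C S) (X : R) (k : ℕ) : Prop :=
  ∃ w b, Msg.vote X k w b ∈ g.sent

/-- The decision of the block `B` in the current instance of `X`. -/
def poaDecide (g : VState V U R O C S) (P : Sys V U R O C S) (X : R) (B : Block U R O C) :
    VState V U R O C S :=
  g.setRA X { g.ra X with
    running := False
    pool := (g.ra X).pool \ B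
    queue := P.order B }

/-- Starts instance `k` of `X` at validator `v`; the leader broadcasts its pool. -/
def initiate (g : VState V U R O C S) (P : Sys V U R O C S) (v : V) (X : R) (k : ℕ) (now : ℝ) :
    VState V U R O C S :=
  { g.setRA X { g.ra X with active := True, running := True, inst := k, start := now } with
    sent := g.sent ∪ {m | P.leader k = v ∧ m = Msg.proposal X k (g.ra X).pool} }

/-- The user entity of `tx` has answered the request to SP-lock `tx`. -/
def SPAnswered (g : VState V U R O C S) (tx : Tx U R O C) : Prop := lockOf g.spLocked tx ≠ none

/-- The request to SP-lock `tx` succeeded. -/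
def SPSuccess (g : VState V U R O C S) (tx : Tx U R O C) : Prop :=
  lockOf g.spLocked tx = some tx

/-- The outgoing transactions (with the remaining objects) when `X` executes `tx`. -/
def outgoing (g : VState V U R O C S) (P : Sys V U R O C S) (X : R) (tx : Tx U R O C) :
    Finset O × List (Tx U R O C) :=
  release X ((g.ra X).objs ∪ (P.execCall X (g.ra X).state (g.ra X).objs tx).gained)
    (P.execCall X (g.ra X).state (g.ra X).objs tx).out

/-- Takes `tx` from the queue of decided transactions of `X` and executes it, unless it was executed
before. -/
def execute (g : VState V U R O C S) (P : Sys V U R O C S) (X : R) (tx : Tx U R O C) :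
    VState V U R O C S :=
  let r := g.ra X
  if tx ∈ r.executed then g.setRA X { r with queue := r.queue.tail }
  else
    let e := P.execCall X r.state r.objs tx
    { g.setRA X { r with
        queue := r.queue.tail
        executed := insert tx r.executed
        state := e.state
        objs := (g.outgoing P X tx).1 } with
      inbox := g.inbox ∪ {t | t ∈ (g.outgoing P X tx).2}
      actors := g.actors ∪ {Y | Y ∈ e.actors}
      notices := g.notices ∪ {d | tx.IsUARA ∧ d = (tx, e.created)}
      owned := g.owned ∪ {c | tx.IsRARA ∧ c ∈ e.created} }

/-- Delivery of a user transaction to its user actor entity. -/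
def receiveTx (g : VState V U R O C S) (tx : Tx U R O C) : VState V U R O C S :=
  let free := lockOf g.fpLocked tx = none ∨ lockOf g.fpLocked tx = some tx
  { g with
    rcvdTx := g.rcvdTx ∪ {tx}
    fpLocked := tryLock g.fpLocked tx
    awaiting := g.awaiting ∪ {t | t = tx ∧ tx.IsUARA ∧ free}
    sent := g.sent ∪ {m | tx.IsUA ∧ ∃ l, tx.slot = some l ∧
      m = Msg.pobVote l (if free then some tx else none)} }

/-- Delivery of a message from `u`. The first well-formed proposal of the leader is recorded. -/
def receive (g : VState V U R O C S) (P : Sys V U R O C S) (u : V) (m : Msg U R O C) :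
    VState V U R O C S :=
  let g' := { g with rcvd := insert (u, m) g.rcvd }
  match m with
  | Msg.proposal X k B =>
    if P.leader k = u ∧ (g.ra X).block k = none ∧ ∀ tx ∈ B, tx.recv = some X then
      g'.setRA X { g.ra X with block := Function.update (g.ra X).block k (some B) }
    else g'
  | _ => g'

def setLockStatus (g : VState V U R O C S) (X : R) (k : ℕ) (tx : Tx U R O C) (a : LockStatus) :
    VState V U R O C S :=
  g.setRA X { g.ra X with
    lockStatus := Function.update (g.ra X).lockStatus k
      (Function.update ((g.ra X).lockStatus k) tx a) }

def setSlow (g : VState V U R O C S) (X : R) (k : ℕ) (a : SlowPhase U R O C) :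
    VState V U R O C S :=
  g.setRA X { g.ra X with slow := Function.update (g.ra X).slow k a }

/-- Proposes `B` to Quorum Consensus. -/
def qcPropose (g : VState V U R O C S) (X : R) (k : ℕ) (B : Block U R O C) :
    VState V U R O C S :=
  g.setRA X { g.ra X with
    slow := Function.update (g.ra X).slow k SlowPhase.proposed
    qcProp := Function.update (g.ra X).qcProp k (some B) }

/-- SP-locks `tx` if its slot is free and proposes the SP-locked transaction to the Transaction
Agreement instance of the slot. -/
def taPropose (g : VState V U R O C S) (tx : Tx U R O C) : VState V U R O C S :=
  { g with
    spLocked := tryLock g.spLocked tx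
    taProp := fun l => if tx.slot = some l then tryLock g.spLocked tx l else g.taProp l }

def broadcast (g : VState V U R O C S) (m : Msg U R O C) : VState V U R O C S :=
  { g with sent := g.sent ∪ {m} }

end VState

namespace State

def setVal (s : State V U R O C S) (v : V) (g : VState V U R O C S) : State V U R O C S :=
  { s with val := Function.update s.val v g }

/-- An aggregate signature of `n - p` votes for `B` in instance `k` of `X` can exist: the honest
validators among the signers have broadcast such a vote. -/
def verifyPoa (s : State V U R O C S) (P : Sys V U R O C S) (X : R) (k : ℕ) (B : Block U R O C) :
    Prop :=
  ∃ Q : Finset V, Fintype.card V - P.p ≤ Q.card ∧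
    ∀ u ∈ Q, u ∈ P.honest → ∃ b, Msg.vote X k (some B) b ∈ (s.val u).sent

/-- An aggregate signature of `n - p` broadcast votes for `tx` can exist. -/
def verifyPob (s : State V U R O C S) (P : Sys V U R O C S) (tx : Tx U R O C) : Prop :=
  ∃ Q : Finset V, Fintype.card V - P.p ≤ Q.card ∧
    ∀ u ∈ Q, u ∈ P.honest → ∃ l, tx.slot = some l ∧ Msg.pobVote l (some tx) ∈ (s.val u).sent

/-- At least `f + 1` validators report `φ` to a user; Byzantine validators report anything. -/
def Reported (s : State V U R O C S) (P : Sys V U R O C S) (φ : VState V U R O C S → Prop) :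
    Prop :=
  ∃ Q : Finset V, P.f + 1 ≤ Q.card ∧ ∀ v ∈ Q, v ∈ P.honest → φ (s.val v)

end State

/-- The initial state. -/
def Sys.initial (P : Sys V U R O C S) : State V U R O C S where
  val _ :=
    { sent := ∅, rcvd := ∅, rcvdTx := ∅, fpLocked := fun _ => none, spLocked := fun _ => none
      owned := P.genesisOwned, done := ∅, awaiting := ∅, pobDec := fun _ => none, pending := ∅
      taProp := fun _ => none, taDec := fun _ => none, notices := ∅
      actors := P.genesisActors, inbox := ∅
      ra := fun X =>
        { active := False, inst := 0, running := False, start := 0, pool := ∅, executed := ∅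
          state := P.initState X, objs := P.initObjs X, queue := []
          block := fun _ => none, lockPhase := ∅, lockStatus := fun _ _ => LockStatus.fresh
          slow := fun _ => SlowPhase.off, qcProp := fun _ => none, qcDec := fun _ => none } }
  signed := ∅
  sns _ := 0
  spent := ∅

/-! The transition system -/

/-- The atomic steps of a system. -/
inductive Action (V U R O C : Type*)
  /-- nothing happens -/
  | idle
  /-- an honest user signs and broadcasts a transaction -/
  | issue (tx : Tx U R O C)
  /-- a Byzantine user signs and releases a transaction -/
  | byzSign (tx : Tx U R O C)
  /-- `v` gets a user transaction -/
  | recvTx (v : V) (tx : Tx U R O C)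
  /-- `v` gets the message `m` from `u` -/
  | recv (v u : V) (m : Msg U R O C)
  /-- a user actor entity sends a UA-RA transaction to the recipient -/
  | forward (v : V) (tx : Tx U R O C)
  /-- broadcast primitive: decision by `n - p` votes -/
  | pobFast (v : V) (tx : Tx U R O C)
  /-- broadcast primitive: decision by a proof -/
  | pobByProof (v u : V) (tx : Tx U R O C)
  /-- broadcast primitive: proposal to Transaction Agreement -/
  | pobSlow (v : V) (tx : Tx U R O C)
  /-- broadcast primitive: decision by Transaction Agreement -/
  | pobByTA (v : V) (tx : Tx U R O C)
  /-- execution of a UA transaction -/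
  | execUA (v : V) (tx : Tx U R O C)
  /-- a user actor entity applies the effects of an executed UA-RA transaction -/
  | applyNotice (v : V) (tx : Tx U R O C) (created : Finset (U × O))
  /-- a user actor entity handles a request to FP-lock -/
  | fpLock (v : V) (X : R) (k : ℕ) (tx : Tx U R O C)
  /-- a request to FP-lock is approved -/
  | fpAccept (v : V) (X : R) (k : ℕ) (tx : Tx U R O C)
  /-- a request to FP-lock fails after the waiting time -/
  | fpExpire (v : V) (X : R) (k : ℕ) (tx : Tx U R O C)
  /-- a user actor entity handles a request to SP-lock -/
  | spLock (v : V) (X : R) (k : ℕ) (tx : Tx U R O C)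
  /-- a user actor entity proposes to Transaction Agreement for a block of Quorum Consensus -/
  | taPropose (v : V) (X : R) (k : ℕ) (tx : Tx U R O C)
  /-- a reactive actor entity comes into existence and starts its first instance -/
  | create (v : V) (X : R)
  /-- a reactive actor entity gets a transaction by an inner link -/
  | poolAdd (v : V) (X : R) (tx : Tx U R O C)
  /-- requests FP-locks for the leader's proposal -/
  | startLocks (v : V) (X : R) (k : ℕ) (B : Block U R O C)
  /-- votes after all requests to FP-lock are answered -/
  | vote (v : V) (X : R) (k : ℕ) (B : Block U R O C)
  /-- negative vote when the proposal could not be considered in time -/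
  | voteLate (v : V) (X : R) (k : ℕ)
  /-- decision by `n - p` votes -/
  | decideFast (v : V) (X : R) (k : ℕ) (B : Block U R O C)
  /-- decision by a proof -/
  | decideByProof (v u : V) (X : R) (k : ℕ) (B : Block U R O C)
  /-- enters the slow path with a block that has `n - p - 2f` votes -/
  | slowCandidate (v : V) (X : R) (k : ℕ) (B : Block U R O C)
  /-- enters the slow path with the fallback blocks -/
  | slowFallback (v : V) (X : R) (k : ℕ)
  /-- proposes the candidate block to Quorum Consensus -/
  | proposeCandidate (v : V) (X : R) (k : ℕ) (B : Block U R O C)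
  /-- turns to the fallback blocks as the candidate block could not be SP-locked -/
  | candidateFails (v : V) (X : R) (k : ℕ) (B : Block U R O C)
  /-- proposes the SP-locked part of the fallback block to Quorum Consensus -/
  | proposeFallback (v : V) (X : R) (k : ℕ) (B : Block U R O C)
  /-- Quorum Consensus decides at `v` -/
  | qcDecide (v : V) (X : R) (k : ℕ) (B : Block U R O C)
  /-- Transaction Agreement decides at `v` -/
  | taDecide (v : V) (l : U × ℕ) (d : Option (Tx U R O C))
  /-- slow-path decision -/
  | decideSlow (v : V) (X : R) (k : ℕ) (B : Block U R O C)
  /-- processes the next transaction of the decided block -/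
  | exec (v : V) (X : R) (tx : Tx U R O C)
  /-- starts the next instance -/
  | next (v : V) (X : R) (k : ℕ)

/-- The steps that an honest validator takes by itself. The others are steps of the users, of the
network and of the two consensus primitives. -/
def Action.IsLocal : Action V U R O C → Prop
  | .idle | .issue _ | .byzSign _ | .recvTx _ _ | .recv _ _ _ | .qcDecide _ _ _ _
  | .taDecide _ _ _ => False
  | _ => True

/-- The honest validators' guards, at time `now` in state `s`. Byzantine validators act only
through the messages that are delivered from them, through their reports to users and through
their part in the primitives. -/
def Enabled (P : Sys V U R O C S) (now : ℝ) (s : State V U R O C S) : Action V U R O C → Prop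
  | .idle => True
  | .issue tx => ∃ A, A ∈ P.honestUsers ∧ tx.slot = some (A, s.sns A) ∧
      (∀ m, m + 1 = s.sns A → s.Reported P fun g => (A, m) ∈ g.done) ∧
      ∀ o ∈ tx.objs, (A, o) ∉ s.spent ∧ s.Reported P fun g => (A, o) ∈ g.owned
  | .byzSign tx => tx ∉ s.signed ∧ ∃ A sn, A ∉ P.honestUsers ∧ tx.slot = some (A, sn)
  | .recvTx v tx => v ∈ P.honest ∧ tx ∈ s.signed ∧ tx ∉ (s.val v).rcvdTx
  | .recv v u m => v ∈ P.honest ∧ (u ∈ P.honest → m ∈ (s.val u).sent) ∧ (u, m) ∉ (s.val v).rcvd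
  | .forward v tx => v ∈ P.honest ∧ tx ∈ (s.val v).awaiting ∧ (s.val v).Ready tx
  | .pobFast v tx => v ∈ P.honest ∧ tx.IsUA ∧
      Fintype.card V - P.p ≤ ((s.val v).pobVoters tx).card ∧ lockOf (s.val v).pobDec tx = none
  | .pobByProof v u tx => v ∈ P.honest ∧ tx.IsUA ∧ (u, Msg.pobProof tx) ∈ (s.val v).rcvd ∧
      s.verifyPob P tx ∧ lockOf (s.val v).pobDec tx = none
  | .pobSlow v tx => v ∈ P.honest ∧ tx.IsUA ∧
      Fintype.card V - P.p - 2 * P.f ≤ ((s.val v).pobVoters tx).card ∧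
      (lockOf (s.val v).spLocked tx = none ∨ lockOf (s.val v).spLocked tx = some tx) ∧
      lockOf (s.val v).taProp tx = none
  | .pobByTA v tx => v ∈ P.honest ∧ tx.IsUA ∧
      (∃ l, tx.slot = some l ∧ (s.val v).taDec l = some (some tx)) ∧
      lockOf (s.val v).pobDec tx = none
  | .execUA v tx => v ∈ P.honest ∧ tx.IsUA ∧ tx ∈ (s.val v).pending ∧ (s.val v).Ready tx
  | .applyNotice v tx created => v ∈ P.honest ∧ (tx, created) ∈ (s.val v).notices ∧
      (∀ l, tx.slot = some l → l ∉ (s.val v).done) ∧ (s.val v).Ready tx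
  | .fpLock v X k tx => v ∈ P.honest ∧ k ∈ ((s.val v).ra X).lockPhase ∧ tx.IsUARA ∧
      (∃ B, ((s.val v).ra X).block k = some B ∧ tx ∈ B) ∧
      ((s.val v).ra X).lockStatus k tx = LockStatus.fresh
  | .fpAccept v X k tx => v ∈ P.honest ∧
      (∃ t, ((s.val v).ra X).lockStatus k tx = LockStatus.waiting t ∧ now ≤ t + P.delta) ∧
      (s.val v).Ready tx
  | .fpExpire v X k tx => v ∈ P.honest ∧
      ∃ t, ((s.val v).ra X).lockStatus k tx = LockStatus.waiting t ∧ t + P.delta < now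
  | .spLock v X k tx => v ∈ P.honest ∧ tx.IsUARA ∧ ¬ (s.val v).SPAnswered tx ∧
      ∃ B, tx ∈ B ∧ (((s.val v).ra X).slow k = SlowPhase.candidate B ∨
        ((s.val v).ra X).slow k = SlowPhase.fallback B)
  | .taPropose v X k tx => v ∈ P.honest ∧ tx.IsUARA ∧
      (∃ B, ((s.val v).ra X).qcDec k = some B ∧ tx ∈ B) ∧ lockOf (s.val v).taProp tx = none
  | .create v X => v ∈ P.honest ∧ X ∈ (s.val v).actors ∧ ¬ ((s.val v).ra X).active
  | .poolAdd v X tx => v ∈ P.honest ∧ ((s.val v).ra X).active ∧ tx ∈ (s.val v).inbox ∧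
      tx.recv = some X
  | .startLocks v X k B => v ∈ P.honest ∧ (s.val v).InInst X k ∧
      ((s.val v).ra X).block k = some B ∧ k ∉ ((s.val v).ra X).lockPhase ∧
      ¬ (s.val v).Voted X k ∧ now - ((s.val v).ra X).start ≤ 3 * P.delta ∧
      ∀ tx ∈ B, tx.IsRARA → tx ∈ ((s.val v).ra X).pool
  | .vote v X k B => v ∈ P.honest ∧ (s.val v).InInst X k ∧ ¬ (s.val v).Voted X k ∧
      k ∈ ((s.val v).ra X).lockPhase ∧ ((s.val v).ra X).block k = some B ∧
      ∀ tx ∈ B, tx.IsUARA → ∃ b, ((s.val v).ra X).lockStatus k tx = LockStatus.answered b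
  | .voteLate v X k => v ∈ P.honest ∧ (s.val v).InInst X k ∧ ¬ (s.val v).Voted X k ∧
      k ∉ ((s.val v).ra X).lockPhase ∧ 3 * P.delta < now - ((s.val v).ra X).start
  | .decideFast v X k B => v ∈ P.honest ∧ (s.val v).InInst X k ∧
      Fintype.card V - P.p ≤ ((s.val v).votersFor X k (some B)).card
  | .decideByProof v u X k B => v ∈ P.honest ∧ (s.val v).InInst X k ∧
      (u, Msg.proof X k B) ∈ (s.val v).rcvd ∧ s.verifyPoa P X k B
  | .slowCandidate v X k B => v ∈ P.honest ∧ (s.val v).InInst X k ∧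
      3 * P.delta < now - ((s.val v).ra X).start ∧
      ((s.val v).ra X).slow k = SlowPhase.off ∧
      Fintype.card V - P.f ≤ ((s.val v).voters X k).card ∧
      Fintype.card V - P.p - 2 * P.f ≤ ((s.val v).votersFor X k (some B)).card
  | .slowFallback v X k => v ∈ P.honest ∧ (s.val v).InInst X k ∧
      3 * P.delta < now - ((s.val v).ra X).start ∧
      ((s.val v).ra X).slow k = SlowPhase.off ∧
      Fintype.card V - P.f ≤ ((s.val v).voters X k).card ∧
      ∀ B, ((s.val v).votersFor X k (some B)).card < Fintype.card V - P.p - 2 * P.f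
  | .proposeCandidate v X k B => v ∈ P.honest ∧
      ((s.val v).ra X).slow k = SlowPhase.candidate B ∧
      ∀ tx ∈ B, tx.IsUARA → (s.val v).SPSuccess tx
  | .candidateFails v X k B => v ∈ P.honest ∧
      ((s.val v).ra X).slow k = SlowPhase.candidate B ∧
      (∀ tx ∈ B, tx.IsUARA → (s.val v).SPAnswered tx) ∧
      ∃ tx ∈ B, tx.IsUARA ∧ ¬ (s.val v).SPSuccess tx
  | .proposeFallback v X k B => v ∈ P.honest ∧
      ((s.val v).ra X).slow k = SlowPhase.fallback B ∧
      ∀ tx ∈ B, tx.IsUARA → (s.val v).SPAnswered tx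
  | .qcDecide v X k _ => v ∈ P.honest ∧ ((s.val v).ra X).qcDec k = none
  | .taDecide v l _ => v ∈ P.honest ∧ (s.val v).taDec l = none
  | .decideSlow v X k B => v ∈ P.honest ∧ (s.val v).InInst X k ∧
      ((s.val v).ra X).qcDec k = some B ∧
      ∀ tx ∈ B, tx.IsUARA → ∀ l, tx.slot = some l → (s.val v).taDec l ≠ none
  | .exec v X tx => v ∈ P.honest ∧ ((s.val v).ra X).active ∧ ¬ ((s.val v).ra X).running ∧
      ((s.val v).ra X).queue.head? = some tx
  | .next v X k => v ∈ P.honest ∧ ((s.val v).ra X).active ∧ ¬ ((s.val v).ra X).running ∧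
      ((s.val v).ra X).queue = [] ∧ ((s.val v).ra X).inst = k

/-- The state after a step at time `now`. -/
def perform (P : Sys V U R O C S) (now : ℝ) (s : State V U R O C S) :
    Action V U R O C → State V U R O C S
  | .idle => s
  | .issue tx =>
      { s with
        signed := s.signed ∪ {tx}
        sns := fun A => if tx.slot = some (A, s.sns A) then s.sns A + 1 else s.sns A
        spent := s.spent ∪ {c | tx.slot = some (c.1, s.sns c.1) ∧ c.2 ∈ tx.objs} }
  | .byzSign tx => { s with signed := s.signed ∪ {tx} }
  | .recvTx v tx => s.setVal v ((s.val v).receiveTx tx)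
  | .recv v u m => s.setVal v ((s.val v).receive P u m)
  | .forward v tx =>
      s.setVal v { s.val v with
        awaiting := (s.val v).awaiting \ {tx}
        inbox := (s.val v).inbox ∪ {tx} }
  | .pobFast v tx =>
      s.setVal v (((s.val v).pobDecide s.signed tx).broadcast (Msg.pobProof tx))
  | .pobByProof v _ tx =>
      s.setVal v (((s.val v).pobDecide s.signed tx).broadcast (Msg.pobProof tx))
  | .pobSlow v tx => s.setVal v ((s.val v).taPropose tx)
  | .pobByTA v tx => s.setVal v ((s.val v).pobDecide s.signed tx)
  | .execUA v tx =>
      s.setVal v { (s.val v).settle tx (P.execUser tx).created with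
        pending := (s.val v).pending \ {tx}
        actors := (s.val v).actors ∪ {Y | Y ∈ (P.execUser tx).actors} }
  | .applyNotice v tx created => s.setVal v ((s.val v).settle tx created)
  | .fpLock v X k tx =>
      if tx ∈ s.signed then
        let g := { s.val v with fpLocked := tryLock (s.val v).fpLocked tx }
        s.setVal v (g.setLockStatus X k tx
          (if lockOf g.fpLocked tx = some tx then LockStatus.waiting now
            else LockStatus.answered false))
      else s.setVal v ((s.val v).setLockStatus X k tx (LockStatus.answered false))
  | .fpAccept v X k tx => s.setVal v ((s.val v).setLockStatus X k tx (LockStatus.answered true))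
  | .fpExpire v X k tx => s.setVal v ((s.val v).setLockStatus X k tx (LockStatus.answered false))
  | .spLock v _ _ tx =>
      s.setVal v { s.val v with spLocked := tryLock (s.val v).spLocked tx }
  | .taPropose v _ _ tx => s.setVal v ((s.val v).taPropose tx)
  | .create v X => s.setVal v ((s.val v).initiate P v X 0 now)
  | .poolAdd v X tx =>
      let r := (s.val v).ra X
      s.setVal v { (s.val v).setRA X { r with
          pool := if tx ∈ r.executed ∨ tx ∈ r.queue then r.pool else insert tx r.pool } with
        inbox := (s.val v).inbox \ {tx} }
  | .startLocks v X k _ =>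
      s.setVal v ((s.val v).setRA X { (s.val v).ra X with
        lockPhase := ((s.val v).ra X).lockPhase ∪ {k} })
  | .vote v X k B =>
      s.setVal v ((s.val v).broadcast (Msg.vote X k
        (if ∀ tx ∈ B, tx.IsUARA →
            ((s.val v).ra X).lockStatus k tx = LockStatus.answered true then some B else none)
        ((s.val v).ra X).pool))
  | .voteLate v X k =>
      s.setVal v ((s.val v).broadcast (Msg.vote X k none ((s.val v).ra X).pool))
  | .decideFast v X k B =>
      s.setVal v (((s.val v).poaDecide P X B).broadcast (Msg.proof X k B))
  | .decideByProof v _ X k B =>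
      s.setVal v (((s.val v).poaDecide P X B).broadcast (Msg.proof X k B))
  | .slowCandidate v X k B => s.setVal v ((s.val v).setSlow X k (SlowPhase.candidate B))
  | .slowFallback v X k =>
      s.setVal v ((s.val v).setSlow X k (SlowPhase.fallback
        ((s.val v).fallbackBlock X k (Fintype.card V - 2 * P.f))))
  | .proposeCandidate v X k B => s.setVal v ((s.val v).qcPropose X k B)
  | .candidateFails v X k _ =>
      s.setVal v ((s.val v).setSlow X k (SlowPhase.fallback
        ((s.val v).fallbackBlock X k (Fintype.card V - 2 * P.f))))
  | .proposeFallback v X k B =>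
      s.setVal v ((s.val v).qcPropose X k
        (B.filter fun tx => tx.IsRARA ∨ (tx.IsUARA ∧ (s.val v).SPSuccess tx)))
  | .qcDecide v X k B =>
      s.setVal v ((s.val v).setRA X { (s.val v).ra X with
        qcDec := Function.update ((s.val v).ra X).qcDec k (some B) })
  | .taDecide v l d =>
      s.setVal v { s.val v with taDec := Function.update (s.val v).taDec l (some d) }
  | .decideSlow v X _ B =>
      s.setVal v ((s.val v).poaDecide P X (B.filter fun tx =>
        ∀ l, tx.slot = some l → (s.val v).taDec l = some (some tx)))
  | .exec v X tx => s.setVal v ((s.val v).execute P X tx)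
  | .next v X k => s.setVal v ((s.val v).initiate P v X (k + 1) now)

/-! The consensus primitives used by the protocol -/

/-- Quorum Consensus among the validators, for blocks of elements of `T`: `prop i v` and `dec i v` are
the proposal and the decision of `v` before step `i`, if any. A validator that never proposes
does not restrict the decision in the first part of the validity. -/
structure QuorumConsensus {T : Type*} (honest : Finset V) (f : ℕ)
    (prop dec : ℕ → V → Option (Finset T)) : Prop where
  agreement : ∀ v ∈ honest, ∀ w ∈ honest, ∀ i j B B',
    dec i v = some B → dec j w = some B' → B = B'
  termination :
    ((∀ v ∈ honest, ∃ i B, prop i v = some B) ∨ (∃ v ∈ honest, ∃ i B, dec i v = some B)) →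
      ∀ v ∈ honest, ∃ i B, dec i v = some B
  validity_all : ∀ v ∈ honest, ∀ i B tx, dec i v = some B →
    (∀ u ∈ honest, ∀ j B', prop j u = some B' → tx ∈ B') → tx ∈ B
  validity_quorum : ∀ v ∈ honest, ∀ i B tx, dec i v = some B → tx ∈ B →
    Fintype.card V - 3 * f ≤ (honest.filter fun u => ∃ B', prop i u = some B' ∧ tx ∈ B').card

/-- Transaction Agreement (strong Byzantine agreement with Quorum Validity) for values in `T`. The
decision `none` says that no proposed value was agreed on. -/
structure TransactionAgreement {T : Type*} (honest : Finset V) (f : ℕ)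
    (prop : ℕ → V → Option T) (dec : ℕ → V → Option (Option T)) : Prop where
  agreement : ∀ v ∈ honest, ∀ w ∈ honest, ∀ i j d d',
    dec i v = some d → dec j w = some d' → d = d'
  termination :
    ((∀ v ∈ honest, ∃ i x, prop i v = some x) ∨ (∃ v ∈ honest, ∃ i d, dec i v = some d)) →
      ∀ v ∈ honest, ∃ i d, dec i v = some d
  validity_all : ∀ v ∈ honest, ∀ i d x, dec i v = some d →
    (∀ u ∈ honest, ∀ j y, prop j u = some y → y = x) → d = some x
  validity_quorum : ∀ v ∈ honest, ∀ i x, dec i v = some (some x) →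
    Fintype.card V - 3 * f ≤ (honest.filter fun u => prop i u = some x).card

/-! Executions -/

/-- A sequence of states and steps; step `act i` is taken in `state i` at time `time i`. -/
structure Trace (V U R O C S : Type*) where
  state : ℕ → State V U R O C S
  act : ℕ → Action V U R O C
  time : ℕ → ℝ

/-- The trace is an execution of the protocol in the partially synchronous network. -/
structure Trace.IsExecution (T : Trace V U R O C S) (P : Sys V U R O C S) : Prop where
  initial : T.state 0 = P.initial
  enabled : ∀ i, Enabled P (T.time i) (T.state i) (T.act i)
  step : ∀ i, T.state (i + 1) = perform P (T.time i) (T.state i) (T.act i)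
  time_mono : Monotone T.time
  time_unbounded : ∀ t, ∃ i, t ≤ T.time i
  /-- a message sent at time `t` between honest validators is delivered by
  `max (t + delta) (gst + delta)` -/
  delivery : ∀ i, ∀ u ∈ P.honest, ∀ v ∈ P.honest, ∀ m, m ∈ ((T.state (i + 1)).val u).sent →
    ∃ j, T.time j ≤ max (T.time i + P.delta) (P.gst + P.delta) ∧
      (u, m) ∈ ((T.state (j + 1)).val v).rcvd
  /-- likewise for the messages from honest users -/
  delivery_user : ∀ i, ∀ v ∈ P.honest, ∀ tx A sn, tx ∈ (T.state (i + 1)).signed →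
    tx.slot = some (A, sn) → A ∈ P.honestUsers →
    ∃ j, T.time j ≤ max (T.time i + P.delta) (P.gst + P.delta) ∧
      tx ∈ ((T.state (j + 1)).val v).rcvdTx
  /-- honest validators do not omit steps: a step that stays enabled is taken -/
  fair : ∀ a : Action V U R O C, a.IsLocal →
    ∀ i, ∃ j, i ≤ j ∧ (T.act j = a ∨ ¬ Enabled P (T.time j) (T.state j) a)
  quorumConsensus : ∀ X k, QuorumConsensus P.honest P.f
    (fun i v => (((T.state i).val v).ra X).qcProp k)
    (fun i v => (((T.state i).val v).ra X).qcDec k)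
  transactionAgreement : ∀ l, TransactionAgreement P.honest P.f
    (fun i v => ((T.state i).val v).taProp l) (fun i v => ((T.state i).val v).taDec l)

namespace Trace

/-- In step `i`, the entity `V.X` of `v` executes `tx`. -/
def Executes (T : Trace V U R O C S) (v : V) (X : R) (tx : Tx U R O C) (i : ℕ) : Prop :=
  T.act i = Action.exec v X tx ∧ tx ∉ (((T.state i).val v).ra X).executed

/-- In step `i`, the reactive actor `X` at `v` emits the transaction `tx`. -/
def Produces (T : Trace V U R O C S) (P : Sys V U R O C S) (v : V) (X : R) (tx : Tx U R O C)
    (i : ℕ) : Prop :=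
  ∃ tx', T.Executes v X tx' i ∧ tx ∈ (((T.state i).val v).outgoing P X tx').2

/-- In step `i`, the transaction `tx` is signed and released by its user. -/
def Signs (T : Trace V U R O C S) (tx : Tx U R O C) (i : ℕ) : Prop :=
  T.act i = Action.issue tx ∨ T.act i = Action.byzSign tx

/-- The transaction `tx` is emitted in step `i`: either it is a user transaction signed and released
at that moment, and some honest validator will eventually have executed the preceding sequence
number and will eventually own the consumed objects, or it is produced by a reactive actor at an
honest validator. -/
def Emitted (T : Trace V U R O C S) (P : Sys V U R O C S) (tx : Tx U R O C) (i : ℕ) : Prop :=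
  (∃ A sn, tx.slot = some (A, sn) ∧ T.Signs tx i ∧ ∃ v ∈ P.honest,
    (∀ m, m + 1 = sn → ∃ j, i ≤ j ∧ (A, m) ∈ ((T.state j).val v).done) ∧
    ∃ j, i ≤ j ∧ ∀ o ∈ tx.objs, (A, o) ∈ ((T.state j).val v).owned) ∨
  ∃ v ∈ P.honest, ∃ X, T.Produces P v X tx i

/-- `X` is a reactive actor of the system, that is, some honest validator creates it. -/
def IsActor (T : Trace V U R O C S) (P : Sys V U R O C S) (X : R) : Prop :=
  ∃ v ∈ P.honest, ∃ i, X ∈ ((T.state i).val v).actors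

end Trace

end

end Mangrove

namespace Mangrove

open scoped Classical

set_option linter.unusedSectionVars false
set_option linter.unnecessarySeqFocus false
set_option linter.unusedSimpArgs false

/-! ### Single steps: which validator they touch. -/

variable {V U R O C S : Type*} [Fintype V]

/-! Write `n` for the number of validators.

Safety is quorum intersection. Two sets of validators whose sizes add up to `n + f + 1` share an
honest member (`honest_inter`), and `n ≥ 3f + 2p + 1` says exactly that this applies to a set of `n
- p` and a set of `n - p - 2f`. An honest validator votes once per instance and never changes an
FP-lock. Every SP-lock is backed by `n - p - 2f` validators whose honest members FP-locked the
transaction (`spLocked_lockedBy`), so a transaction with `n - p` FP-locks has no SP-locked rival.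
Suppose `n - p` votes for a block `B` exist. Whoever enters the slow path with `n - f` votes then
sees `n - p - 2f` votes for `B` and for no other block, no SP-lock for `B` can fail, every proposal
to Quorum Consensus is `B`, and validity forces both primitives to confirm `B` (`slow_of_verifyPoa`,
`qcDec_of_verifyPoa`, `taDec_of_locked`). Without such votes, agreement of the primitives suffices.
So an instance has at most one decided block (`Decides.unique`), and a slot (user actor and sequence
number) at most one settled transaction (`Settled.unique`).

Consequently every entity for `X` processes a prefix of one common log, the concatenation of the
decided blocks (`processed_log`), and its state is a function of the processed list
(`run_processed`). What one entity executes, another that runs all instances executes at the same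
position and in the same state (`executes_sync`); this gives Agreement and Total Order. An executed
transaction is supported by some honest validator, which had it in its pool or approved a lock when
the preconditions held; this gives emission.

Liveness: an instance that all honest validators enter is decided by all of them
(`eventually_decided`). For this the reactive actor must exist everywhere, which depends on earlier
executions being replicated. The circle is broken by induction on the global step number
(`totality`): actors, notices, applied user transactions and created objects present at one honest
validator before step `i` eventually appear at all. The delicate point is that preconditions carry
over between validators (`Totality.ready`): an object could be missing at the second validator only
because an earlier sequence number consumed it, but that number holds the same transaction at the
first one, which could then not own the object.

Validity: a transaction without SP-locked rivals that stays in all honest pools is in every fallback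
block and in the proposal of the next honest leader, so every route to a decision includes it
(`eventually_executes`). RA-RA transactions reach all pools because execution is deterministic,
transactions of honest users because their sequence numbers and objects are never reused. -/

/-- The validator whose state a step may change. -/
def Action.actor : Action V U R O C → Option V
  | .idle | .issue _ | .byzSign _ => none
  | .recvTx v _ | .recv v _ _ | .forward v _ | .pobFast v _ | .pobByProof v _ _ | .pobSlow v _
  | .pobByTA v _ | .execUA v _ | .applyNotice v _ _ | .fpLock v _ _ _ | .fpAccept v _ _ _
  | .fpExpire v _ _ _ | .spLock v _ _ _ | .taPropose v _ _ _ | .create v _ | .poolAdd v _ _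
  | .startLocks v _ _ _ | .vote v _ _ _ | .voteLate v _ _ | .decideFast v _ _ _
  | .decideByProof v _ _ _ _ | .slowCandidate v _ _ _ | .slowFallback v _ _
  | .proposeCandidate v _ _ _ | .candidateFails v _ _ _ | .proposeFallback v _ _ _
  | .qcDecide v _ _ _ | .taDecide v _ _ | .decideSlow v _ _ _ | .exec v _ _ | .next v _ _ => some v

/-- Reduces the analysis of a step to its own actor; all other local states are literally unchanged.
-/
theorem perform_val_of_ne {P : Sys V U R O C S} {now : ℝ} {s : State V U R O C S}
    {a : Action V U R O C} {w : V} (h : a.actor ≠ some w) :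
    (perform P now s a).val w = s.val w := by
  cases a <;> simp only [Action.actor, ne_eq, Option.some.injEq, perform] at h ⊢ <;>
    (try split) <;> simp [State.setVal, Ne.symm h]

theorem honest_of_actor {P : Sys V U R O C S} {now : ℝ} {s : State V U R O C S}
    {a : Action V U R O C} {w : V} (he : Enabled P now s a) (h : a.actor = some w) :
    w ∈ P.honest := by
  cases a <;> simp only [Action.actor, reduceCtorEq,
      Option.some.injEq] at h <;> subst h <;> exact he.1

@[simp] theorem State.setVal_val_self (s : State V U R O C S) (v : V) (g : VState V U R O C S) :
    (s.setVal v g).val v = g := by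
  simp [State.setVal]

/-! ### Explicit forms of the state updates. -/

namespace VState

@[simp] theorem setRA_ra (g : VState V U R O C S) (X Y : R) (r : RState U R O C S) :
    (g.setRA X r).ra Y = if Y = X then r else g.ra Y := by
  simp [setRA, Function.update_apply]

/-- Normal form in which each field is given separately, with the case distinction on the reactive
actor pushed inside. The companions below do the same for the other operations, so that a single
field can be read off without unfolding nested updates. -/
theorem setRA_eq (g : VState V U R O C S) (X : R) (r : RState U R O C S) :
    g.setRA X r = { g with ra := fun Y => if Y = X then r else g.ra Y } := by
  simp only [setRA]; congr 1; funext Y; simp [Function.update_apply]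

theorem setLockStatus_eq (g : VState V U R O C S) (X : R) (k : ℕ) (tx : Tx U R O C)
    (a : LockStatus) :
    g.setLockStatus X k tx a = { g with ra := fun Y => { g.ra Y with
      lockStatus := fun k' tx' => if Y = X ∧ k' = k ∧ tx' = tx then a
        else (g.ra Y).lockStatus k' tx' } } := by
  simp only [setLockStatus, setRA_eq]; congr 1; funext Y
  split_ifs with h
  · subst h; congr 1; funext k' tx'; simp only [Function.update_apply]; split_ifs <;>
      simp_all [Function.update_apply]
  · simp [h]

theorem setSlow_eq (g : VState V U R O C S) (X : R) (k : ℕ) (a : SlowPhase U R O C) :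
    g.setSlow X k a = { g with ra := fun Y => { g.ra Y with
      slow := fun k' => if Y = X ∧ k' = k then a else (g.ra Y).slow k' } } := by
  simp only [setSlow, setRA_eq]; congr 1; funext Y
  split_ifs with h
  · subst h; congr 1; funext k'; simp [Function.update_apply]
  · simp [h]

theorem qcPropose_eq (g : VState V U R O C S) (X : R) (k : ℕ) (B : Block U R O C) :
    g.qcPropose X k B = { g with ra := fun Y => { g.ra Y with
      slow := fun k' => if Y = X ∧ k' = k then SlowPhase.proposed else (g.ra Y).slow k'
      qcProp := fun k' => if Y = X ∧ k' = k then some B else (g.ra Y).qcProp k' } } := by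
  simp only [qcPropose, setRA_eq]; congr 1; funext Y
  split_ifs with h
  · subst h; congr 1 <;> funext k' <;> simp [Function.update_apply]
  · simp [h]

theorem poaDecide_eq (g : VState V U R O C S) (P : Sys V U R O C S) (X : R)
    (B : Block U R O C) :
    g.poaDecide P X B = { g with ra := fun Y => { g.ra Y with
      running := if Y = X then False else (g.ra Y).running
      pool := if Y = X then (g.ra Y).pool \ B else (g.ra Y).pool
      queue := if Y = X then P.order B else (g.ra Y).queue } } := by
  simp only [poaDecide, setRA_eq]; congr 1; funext Y
  by_cases h : Y = X
  · subst h; simp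
  · simp [h]

theorem initiate_eq (g : VState V U R O C S) (P : Sys V U R O C S) (v : V) (X : R) (k : ℕ)
    (now : ℝ) :
    g.initiate P v X k now = { g with
      ra := fun Y => { g.ra Y with
        active := if Y = X then True else (g.ra Y).active
        running := if Y = X then True else (g.ra Y).running
        inst := if Y = X then k else (g.ra Y).inst
        start := if Y = X then now else (g.ra Y).start }
      sent := g.sent ∪ {m | P.leader k = v ∧ m = Msg.proposal X k (g.ra X).pool} } := by
  simp only [initiate, setRA_eq]; congr 1; funext Y
  by_cases h : Y = X
  · subst h; simp
  · simp [h]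

theorem execute_eq (g : VState V U R O C S) (P : Sys V U R O C S) (X : R) (tx : Tx U R O C) :
    g.execute P X tx = { g with
      ra := fun Y => { g.ra Y with
        queue := if Y = X then (g.ra Y).queue.tail else (g.ra Y).queue
        executed := if Y = X ∧ tx ∉ (g.ra X).executed then insert tx (g.ra Y).executed
          else (g.ra Y).executed
        state := if Y = X ∧ tx ∉ (g.ra X).executed then
          (P.execCall X (g.ra X).state (g.ra X).objs tx).state else (g.ra Y).state
        objs := if Y = X ∧ tx ∉ (g.ra X).executed then (g.outgoing P X tx).1
          else (g.ra Y).objs }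
      inbox := g.inbox ∪ {t | tx ∉ (g.ra X).executed ∧ t ∈ (g.outgoing P X tx).2}
      actors := g.actors ∪ {Y | tx ∉ (g.ra X).executed ∧
        Y ∈ (P.execCall X (g.ra X).state (g.ra X).objs tx).actors}
      notices := g.notices ∪ {d | tx ∉ (g.ra X).executed ∧ tx.IsUARA ∧
        d = (tx, (P.execCall X (g.ra X).state (g.ra X).objs tx).created)}
      owned := g.owned ∪ {c | tx ∉ (g.ra X).executed ∧ tx.IsRARA ∧
        c ∈ (P.execCall X (g.ra X).state (g.ra X).objs tx).created} } := by
  by_cases ht : tx ∈ (g.ra X).executed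
  · simp only [execute, ht, setRA_eq, if_true]
    congr 1 <;> try simp
    funext Y; by_cases h : Y = X
    · subst h; simp
    · simp [h]
  · simp only [execute, ht, setRA_eq, if_false]
    congr 1 <;> try simp
    funext Y; by_cases h : Y = X
    · subst h; simp
    · simp [h]

theorem receive_frame (g : VState V U R O C S) (P : Sys V U R O C S) (u : V)
    (m : Msg U R O C) :
    (g.receive P u m).sent = g.sent ∧ (g.receive P u m).rcvd = insert (u, m) g.rcvd ∧
    (g.receive P u m).rcvdTx = g.rcvdTx ∧ (g.receive P u m).fpLocked = g.fpLocked ∧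
    (g.receive P u m).spLocked = g.spLocked ∧ (g.receive P u m).owned = g.owned ∧
    (g.receive P u m).done = g.done ∧ (g.receive P u m).awaiting = g.awaiting ∧
    (g.receive P u m).pobDec = g.pobDec ∧ (g.receive P u m).pending = g.pending ∧
    (g.receive P u m).taProp = g.taProp ∧ (g.receive P u m).taDec = g.taDec ∧
    (g.receive P u m).notices = g.notices ∧ (g.receive P u m).actors = g.actors ∧
    (g.receive P u m).inbox = g.inbox := by
  cases m <;> simp only [receive] <;> (try split_ifs) <;> simp [setRA_eq]

/-- The proposals recorded after the delivery of `m` from `u`. -/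
noncomputable def receivedBlock (g : VState V U R O C S) (P : Sys V U R O C S) (u : V) (m : Msg U R
    O C) (Y : R) :
    ℕ → Option (Block U R O C) :=
  ((g.receive P u m).ra Y).block

theorem receive_ra (g : VState V U R O C S) (P : Sys V U R O C S) (u : V) (m : Msg U R O C)
    (Y : R) : (g.receive P u m).ra Y = { g.ra Y with block := g.receivedBlock P u m Y } := by
  cases m <;> simp only [receivedBlock, receive]
  split_ifs <;> simp
  split_ifs <;> simp_all

/-- Whatever the message is, its delivery touches only the delivered set and the recorded proposals.
The latter are kept opaque in `receivedBlock`, which is controlled by the next two lemmas. -/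
theorem receive_eq (g : VState V U R O C S) (P : Sys V U R O C S) (u : V) (m : Msg U R O C) :
    g.receive P u m = { g with
      rcvd := insert (u, m) g.rcvd
      ra := fun Y => { g.ra Y with block := g.receivedBlock P u m Y } } := by
  have h := g.receive_frame P u m
  have h' := g.receive_ra P u m
  generalize g.receive P u m = g' at h h'
  cases g'
  simp only at h h'
  simp only [h, true_and, VState.mk.injEq]
  funext Y; exact h' Y

theorem receivedBlock_some {g : VState V U R O C S} {P : Sys V U R O C S} {u : V}
    {m : Msg U R O C} {Y : R} {k : ℕ} {B : Block U R O C} (h : g.receivedBlock P u m Y k = some B) :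
    (g.ra Y).block k = some B ∨ (P.leader k = u ∧ m = Msg.proposal Y k B ∧
      ∀ tx ∈ B, tx.recv = some Y) := by
  cases m <;> simp only [receivedBlock, receive] at h <;> try exact Or.inl h
  split_ifs at h with h1
  · simp only [setRA_ra] at h
    split_ifs at h with h2
    · subst h2
      simp only [Function.update_apply] at h
      split_ifs at h with h3
      · subst h3; cases h; exact Or.inr ⟨h1.1, rfl, h1.2.2⟩
      · exact Or.inl h
    · exact Or.inl h
  · exact Or.inl h

theorem receivedBlock_of_some {g : VState V U R O C S} {P : Sys V U R O C S} {u : V}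
    {m : Msg U R O C} {Y : R} {k : ℕ} {B : Block U R O C} (h : (g.ra Y).block k = some B) :
    g.receivedBlock P u m Y k = some B := by
  cases m <;> simp only [receivedBlock, receive] <;> try exact h
  split_ifs with h1
  · simp only [setRA_ra]
    split_ifs with h2
    · subst h2
      simp only [Function.update_apply]
      split_ifs with h3
      · subst h3; simp [h] at h1
      · exact h
    · exact h
  · exact h

end VState

/-- Merges the two branches of the step into one record with conditional fields, so that the case
analyses below meet a single shape. -/
theorem perform_fpLock (P : Sys V U R O C S) (now : ℝ) (s : State V U R O C S) (v : V) (X : R)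
    (k : ℕ) (tx : Tx U R O C) :
    (perform P now s (.fpLock v X k tx)).val v =
      ({ s.val v with fpLocked := if tx ∈ s.signed then tryLock (s.val v).fpLocked tx
                        else (s.val v).fpLocked }).setLockStatus X k tx
          (if tx ∈ s.signed ∧ lockOf (tryLock (s.val v).fpLocked tx) tx = some tx then
              LockStatus.waiting now
            else LockStatus.answered false) := by
  simp only [perform]; split_ifs <;> simp_all

theorem perform_poolAdd (P : Sys V U R O C S) (now : ℝ) (s : State V U R O C S) (v : V) (X : R)
    (tx : Tx U R O C) :
    (perform P now s (.poolAdd v X tx)).val v = { s.val v with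
      ra := fun Y => { (s.val v).ra Y with
        pool := if Y = X ∧ tx ∉ ((s.val v).ra Y).executed ∧ tx ∉ ((s.val v).ra Y).queue then
          insert tx ((s.val v).ra Y).pool else ((s.val v).ra Y).pool }
      inbox := (s.val v).inbox \ {tx} } := by
  simp only [perform, VState.setRA_eq, State.setVal_val_self]; congr 1; funext Y
  by_cases h : Y = X
  · subst h; simp only [true_and, if_true]; congr 1; split_ifs <;> simp_all
  · simp [h]

theorem perform_startLocks (P : Sys V U R O C S) (now : ℝ) (s : State V U R O C S) (v : V) (X : R)
    (k : ℕ) (B : Block U R O C) :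
    (perform P now s (.startLocks v X k B)).val v = { s.val v with
      ra := fun Y => { (s.val v).ra Y with
        lockPhase := ((s.val v).ra Y).lockPhase ∪ {k' | Y = X ∧ k' = k} } } := by
  simp only [perform, VState.setRA_eq, State.setVal_val_self]; congr 1; funext Y
  by_cases h : Y = X
  · subst h; simp
  · simp [h]

theorem perform_qcDecide (P : Sys V U R O C S) (now : ℝ) (s : State V U R O C S) (v : V) (X : R)
    (k : ℕ) (B : Block U R O C) :
    (perform P now s (.qcDecide v X k B)).val v = { s.val v with
      ra := fun Y => { (s.val v).ra Y with
        qcDec := fun k' => if Y = X ∧ k' = k then some B else ((s.val v).ra Y).qcDec k' } } := by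
  simp only [perform, VState.setRA_eq, State.setVal_val_self]; congr 1; funext Y
  by_cases h : Y = X
  · subst h; simp only [true_and, if_true]; congr 1; funext k'; simp [Function.update_apply]
  · simp [h]

theorem perform_taDecide (P : Sys V U R O C S) (now : ℝ) (s : State V U R O C S) (v : V)
    (l : U × ℕ) (d : Option (Tx U R O C)) :
    (perform P now s (.taDecide v l d)).val v = { s.val v with
      taDec := fun l' => if l' = l then some d else (s.val v).taDec l' } := by
  simp only [perform, State.setVal_val_self]; congr 1; funext l'; simp [Function.update_apply]

/-! ### One-step behaviour of the local states. -/

/-- The effect of a step on the messages of the validator `w`. -/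
structure MessageStep (P : Sys V U R O C S) (now : ℝ) (s : State V U R O C S)
    (a : Action V U R O C) (w : V) : Prop where
  vote_step {X : R} {k : ℕ} {d : Option (Block U R O C)} {b : Block U R O C}
    (h : Msg.vote X k d b ∈ ((perform P now s a).val w).sent) :
    Msg.vote X k d b ∈ (s.val w).sent ∨
    (w ∈ P.honest ∧ ¬ (s.val w).Voted X k ∧ (s.val w).InInst X k ∧ b = ((s.val w).ra X).pool ∧
     ((d = none ∧ a = Action.voteLate w X k) ∨ ∃ B, a = Action.vote w X k B ∧
      ((s.val w).ra X).block k = some B ∧ k ∈ ((s.val w).ra X).lockPhase ∧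
      d = if ∀ tx ∈ B, tx.IsUARA → ((s.val w).ra X).lockStatus k tx = LockStatus.answered true
        then some B else none))
  proposal_step {X : R} {k : ℕ} {B : Block U R O C}
    (h : Msg.proposal X k B ∈ ((perform P now s a).val w).sent) :
    Msg.proposal X k B ∈ (s.val w).sent ∨
    (w ∈ P.honest ∧ P.leader k = w ∧ B = ((s.val w).ra X).pool ∧
      ((k = 0 ∧ ¬ ((s.val w).ra X).active ∧ a = Action.create w X) ∨
        ∃ k', k = k' + 1 ∧ ((s.val w).ra X).active ∧ ((s.val w).ra X).inst = k' ∧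
            a = Action.next w X k'))
  pobVote_step {l : U × ℕ} {tx : Tx U R O C}
    (h : Msg.pobVote l (some tx) ∈ ((perform P now s a).val w).sent) :
    Msg.pobVote l (some tx) ∈ (s.val w).sent ∨
    (w ∈ P.honest ∧ tx.slot = some l ∧ ((perform P now s a).val w).fpLocked l = some tx)
  mem_sent_mono {m : Msg U R O C}
    (h : m ∈ (s.val w).sent) : m ∈ ((perform P now s a).val w).sent
  mem_rcvd_mono {e : V × Msg U R O C}
    (h : e ∈ (s.val w).rcvd) : e ∈ ((perform P now s a).val w).rcvd
  rcvd_step {u : V} {m : Msg U R O C}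
    (h : (u, m) ∈ ((perform P now s a).val w).rcvd) :
    (u, m) ∈ (s.val w).rcvd ∨ (u ∈ P.honest → m ∈ (s.val u).sent)
  rcvdTx_step {tx : Tx U R O C}
    (h : tx ∈ ((perform P now s a).val w).rcvdTx) :
    tx ∈ (s.val w).rcvdTx ∨ a = Action.recvTx w tx

/-- The effect of a step on the user actor entities of the validator `w`, and on the links between
its entities. -/
structure UserActorStep (P : Sys V U R O C S) (now : ℝ) (s : State V U R O C S)
    (a : Action V U R O C) (w : V) : Prop where
  fpLocked_mono {l : U × ℕ} {tx : Tx U R O C}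
    (h : (s.val w).fpLocked l = some tx) : ((perform P now s a).val w).fpLocked l = some tx
  fpLocked_step {l : U × ℕ} {tx : Tx U R O C}
    (h : ((perform P now s a).val w).fpLocked l = some tx) :
    (s.val w).fpLocked l = some tx ∨ (w ∈ P.honest ∧ tx ∈ s.signed ∧ tx.slot = some l)
  spLocked_mono {l : U × ℕ} {tx : Tx U R O C}
    (h : (s.val w).spLocked l = some tx) : ((perform P now s a).val w).spLocked l = some tx
  spLocked_step {l : U × ℕ} {tx : Tx U R O C}
    (h : ((perform P now s a).val w).spLocked l = some tx) :
    (s.val w).spLocked l = some tx ∨ (w ∈ P.honest ∧ tx.slot = some l ∧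
      ((∃ X k B, tx.IsUARA ∧ tx ∈ B ∧ (((s.val w).ra X).slow k = SlowPhase.candidate B ∨
          ((s.val w).ra X).slow k = SlowPhase.fallback B)) ∨
        Fintype.card V - P.p - 2 * P.f ≤ ((s.val w).pobVoters tx).card ∨
        ∃ X k B, tx.IsUARA ∧ ((s.val w).ra X).qcDec k = some B ∧ tx ∈ B))
  awaiting_step {tx : Tx U R O C}
    (h : tx ∈ ((perform P now s a).val w).awaiting) :
    tx ∈ (s.val w).awaiting ∨ (w ∈ P.honest ∧ tx.IsUARA ∧ tx ∈ s.signed ∧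
      ∀ l, tx.slot = some l → ((perform P now s a).val w).fpLocked l = some tx)
  awaiting_persist {tx : Tx U R O C}
    (h : tx ∈ (s.val w).awaiting) :
    tx ∈ ((perform P now s a).val w).awaiting ∨ a = Action.forward w tx
  pobDec_mono {l : U × ℕ} {tx : Tx U R O C}
    (h : (s.val w).pobDec l = some tx) : ((perform P now s a).val w).pobDec l = some tx
  pobDec_step {l : U × ℕ} {tx : Tx U R O C}
    (h : ((perform P now s a).val w).pobDec l = some tx) :
    (s.val w).pobDec l = some tx ∨ (w ∈ P.honest ∧ tx.slot = some l ∧ tx.IsUA ∧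
      (s.val w).pobDec l = none ∧ (tx ∈ s.signed → tx ∈ ((perform P now s a).val w).pending) ∧
      ((Msg.pobProof tx ∈ ((perform P now s a).val w).sent ∧
        (Fintype.card V - P.p ≤ ((s.val w).pobVoters tx).card ∨ s.verifyPob P tx)) ∨
        (s.val w).taDec l = some (some tx)))
  pending_persist {tx : Tx U R O C}
    (h : tx ∈ (s.val w).pending) :
    tx ∈ ((perform P now s a).val w).pending ∨ a = Action.execUA w tx
  taProp_step {l : U × ℕ} {tx : Tx U R O C}
    (h : ((perform P now s a).val w).taProp l = some tx) :
    (s.val w).taProp l = some tx ∨ ((perform P now s a).val w).spLocked l = some tx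
  taDec_mono {l : U × ℕ} {d : Option (Tx U R O C)}
    (h : (s.val w).taDec l = some d) : ((perform P now s a).val w).taDec l = some d
  notices_mono {d : Tx U R O C × Finset (U × O)}
    (h : d ∈ (s.val w).notices) : d ∈ ((perform P now s a).val w).notices
  notices_step {tx : Tx U R O C} {c : Finset (U × O)}
    (h : (tx, c) ∈ ((perform P now s a).val w).notices) :
    (tx, c) ∈ (s.val w).notices ∨ ∃ X, a = Action.exec w X tx ∧ tx ∉ ((s.val w).ra X).executed ∧
      tx.IsUARA ∧ c = (P.execCall X ((s.val w).ra X).state ((s.val w).ra X).objs tx).created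
  actors_mono {X : R}
    (h : X ∈ (s.val w).actors) : X ∈ ((perform P now s a).val w).actors
  actors_step {Y : R}
    (h : Y ∈ ((perform P now s a).val w).actors) :
    Y ∈ (s.val w).actors ∨ (∃ tx, a = Action.execUA w tx ∧ Y ∈ (P.execUser tx).actors) ∨
      ∃ X tx, a = Action.exec w X tx ∧ tx ∉ ((s.val w).ra X).executed ∧
      Y ∈ (P.execCall X ((s.val w).ra X).state ((s.val w).ra X).objs tx).actors
  inbox_step {tx : Tx U R O C}
    (h : tx ∈ ((perform P now s a).val w).inbox) :
    tx ∈ (s.val w).inbox ∨ (w ∈ P.honest ∧ tx ∈ (s.val w).awaiting ∧ (s.val w).Ready tx) ∨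
      ∃ X tx', w ∈ P.honest ∧ a = Action.exec w X tx' ∧ tx' ∉ ((s.val w).ra X).executed ∧
      tx ∈ ((s.val w).outgoing P X tx').2
  inbox_persist {tx : Tx U R O C}
    (h : tx ∈ (s.val w).inbox) :
    tx ∈ ((perform P now s a).val w).inbox ∨ ∃ X, a = Action.poolAdd w X tx ∧ tx.recv = some X
  owned_step {c : U × O}
    (h : c ∈ ((perform P now s a).val w).owned) :
    c ∈ (s.val w).owned ∨ (∃ tx, a = Action.execUA w tx ∧ c ∈ (P.execUser tx).created) ∨
      (∃ tx C, a = Action.applyNotice w tx C ∧ c ∈ C) ∨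
      ∃ X tx, a = Action.exec w X tx ∧ tx ∉ ((s.val w).ra X).executed ∧ tx.IsRARA ∧
      c ∈ (P.execCall X ((s.val w).ra X).state ((s.val w).ra X).objs tx).created
  owned_persist {c : U × O}
    (h : c ∈ (s.val w).owned) :
    c ∈ ((perform P now s a).val w).owned ∨ ∃ tx, (a = Action.execUA w tx ∨ ∃ C,
        a = Action.applyNotice w tx C) ∧
      c.2 ∈ tx.objs ∧ ∃ sn, tx.slot = some (c.1, sn)

/-- The effect of a step on the agreement data of the entity for `X` at the validator `w`. -/
structure ReactiveActorStep (P : Sys V U R O C S) (now : ℝ) (s : State V U R O C S)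
    (a : Action V U R O C) (w : V) (X : R) : Prop where
  pool_step {tx : Tx U R O C}
    (h : tx ∈ (((perform P now s a).val w).ra X).pool) :
    tx ∈ ((s.val w).ra X).pool ∨ (w ∈ P.honest ∧ tx ∈ (s.val w).inbox ∧ tx.recv = some X)
  pool_persist {tx : Tx U R O C}
    (h : tx ∈ ((s.val w).ra X).pool) :
    tx ∈ (((perform P now s a).val w).ra X).pool ∨
        (¬ (((perform P now s a).val w).ra X).running ∧ ∃ B,
            (((perform P now s a).val w).ra X).queue = P.order B ∧ tx ∈ B)
  block_mono {k : ℕ} {B : Block U R O C}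
    (h : ((s.val w).ra X).block k = some B) : (((perform P now s a).val w).ra X).block k = some B
  block_step {k : ℕ} {B : Block U R O C}
    (h : (((perform P now s a).val w).ra X).block k = some B) :
    ((s.val w).ra X).block k = some B ∨ ((P.leader k ∈ P.honest →
      Msg.proposal X k B ∈ (s.val (P.leader k)).sent) ∧ ∀ tx ∈ B, tx.recv = some X)
  lockPhase_mono {k : ℕ}
    (h : k ∈ ((s.val w).ra X).lockPhase) : k ∈ (((perform P now s a).val w).ra X).lockPhase
  lockPhase_step {k : ℕ}
    (h : k ∈ (((perform P now s a).val w).ra X).lockPhase) :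
    k ∈ ((s.val w).ra X).lockPhase ∨ ((s.val w).InInst X k ∧
      now - ((s.val w).ra X).start ≤ 3 * P.delta ∧
      ∃ B, ((s.val w).ra X).block k = some B ∧ ∀ tx ∈ B, tx.IsRARA → tx ∈ ((s.val w).ra X).pool)
  lockStatus_waiting_step {k : ℕ} {tx : Tx U R O C} {t : ℝ}
    (h : (((perform P now s a).val w).ra X).lockStatus k tx = LockStatus.waiting t) :
    ((s.val w).ra X).lockStatus k tx = LockStatus.waiting t ∨
      lockOf ((perform P now s a).val w).fpLocked tx = some tx
  lockStatus_answered_step {k : ℕ} {tx : Tx U R O C}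
    (h : (((perform P now s a).val w).ra X).lockStatus k tx = LockStatus.answered true) :
    ((s.val w).ra X).lockStatus k tx = LockStatus.answered true ∨
      (w ∈ P.honest ∧ (∃ t, ((s.val w).ra X).lockStatus k tx = LockStatus.waiting t) ∧
          (s.val w).Ready tx)
  lockStatus_answered_mono {k : ℕ} {tx : Tx U R O C} {b : Bool}
    (h : ((s.val w).ra X).lockStatus k tx = LockStatus.answered b) :
    (((perform P now s a).val w).ra X).lockStatus k tx = LockStatus.answered b
  lockStatus_waiting_persist {k : ℕ} {tx : Tx U R O C} {t : ℝ}
    (h : ((s.val w).ra X).lockStatus k tx = LockStatus.waiting t) :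
    (((perform P now s a).val w).ra X).lockStatus k tx = LockStatus.waiting t ∨
      ∃ b, (((perform P now s a).val w).ra X).lockStatus k tx = LockStatus.answered b
  slow_candidate_step {k : ℕ} {B : Block U R O C}
    (h : (((perform P now s a).val w).ra X).slow k = SlowPhase.candidate B) :
    ((s.val w).ra X).slow k = SlowPhase.candidate B ∨ (w ∈ P.honest ∧
      Fintype.card V - P.f ≤ ((s.val w).voters X k).card ∧
      Fintype.card V - P.p - 2 * P.f ≤ ((s.val w).votersFor X k (some B)).card)
  slow_fallback_step {k : ℕ} {B : Block U R O C}
    (h : (((perform P now s a).val w).ra X).slow k = SlowPhase.fallback B) :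
    ((s.val w).ra X).slow k = SlowPhase.fallback B ∨ (w ∈ P.honest ∧
      B = (s.val w).fallbackBlock X k (Fintype.card V - 2 * P.f) ∧
      ((Fintype.card V - P.f ≤ ((s.val w).voters X k).card ∧
      ∀ B', ((s.val w).votersFor X k (some B')).card < Fintype.card V - P.p - 2 * P.f) ∨
      ∃ B', ((s.val w).ra X).slow k = SlowPhase.candidate B' ∧
        ∃ tx ∈ B', (s.val w).SPAnswered tx ∧ ¬ (s.val w).SPSuccess tx))
  slow_candidate_persist {k : ℕ} {B : Block U R O C}
    (h : ((s.val w).ra X).slow k = SlowPhase.candidate B) :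
    (((perform P now s a).val w).ra X).slow k = SlowPhase.candidate B ∨ (∃ B',
        (((perform P now s a).val w).ra X).slow k = SlowPhase.fallback B') ∨
      (((perform P now s a).val w).ra X).slow k = SlowPhase.proposed
  slow_fallback_persist {k : ℕ} {B : Block U R O C}
    (h : ((s.val w).ra X).slow k = SlowPhase.fallback B) :
    (((perform P now s a).val w).ra X).slow k = SlowPhase.fallback B ∨
        (((perform P now s a).val w).ra X).slow k = SlowPhase.proposed
  slow_proposed_step {k : ℕ}
    (h : (((perform P now s a).val w).ra X).slow k = SlowPhase.proposed) :
        ((s.val w).ra X).slow k = SlowPhase.proposed ∨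
      (((perform P now s a).val w).ra X).qcProp k ≠ none
  qcProp_mono {k : ℕ}
    (h : ((s.val w).ra X).qcProp k ≠ none) : (((perform P now s a).val w).ra X).qcProp k ≠ none
  qcProp_step {k : ℕ} {B : Block U R O C}
    (h : (((perform P now s a).val w).ra X).qcProp k = some B) :
    ((s.val w).ra X).qcProp k = some B ∨ (((s.val w).ra X).slow k = SlowPhase.candidate B ∧
        ∀ tx ∈ B, tx.IsUARA → (s.val w).SPSuccess tx) ∨
      ∃ B', ((s.val w).ra X).slow k = SlowPhase.fallback B' ∧
        (∀ tx ∈ B', tx.IsUARA → (s.val w).SPAnswered tx) ∧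
        B = B'.filter fun tx => tx.IsRARA ∨ (tx.IsUARA ∧ (s.val w).SPSuccess tx)
  qcDec_mono {k : ℕ} {B : Block U R O C}
    (h : ((s.val w).ra X).qcDec k = some B) : (((perform P now s a).val w).ra X).qcDec k = some B

section StepLemmas

variable {P : Sys V U R O C S} {now : ℝ} {s : State V U R O C S} {a : Action V U R O C}

set_option maxHeartbeats 8000000 in
theorem message_step (he : Enabled P now s a) (w : V) : MessageStep P now s a w := by
  by_cases hw : a.actor = some w
  · have hh := honest_of_actor he hw
    constructor <;> intros <;> rename_i h <;> cases a <;>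
        simp only [Action.actor, reduceCtorEq, Option.some.injEq] at hw <;> subst hw <;>
        simp only [↓perform_fpLock, ↓perform_poolAdd, ↓perform_startLocks, ↓perform_qcDecide,
          ↓perform_taDecide, perform, Enabled, State.setVal_val_self, VState.receive_eq,
          VState.execute_eq, VState.pobDecide, VState.taPropose, VState.settle, VState.broadcast,
          VState.poaDecide_eq, VState.setLockStatus_eq, VState.setSlow_eq, VState.qcPropose_eq,
          VState.initiate_eq, VState.receiveTx, Set.mem_union, Set.mem_ofPred_eq,
          Set.mem_singleton_iff, Set.mem_sdiff, Finset.mem_insert, Finset.mem_sdiff,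
              reduceCtorEq] at h he ⊢ <;>
        first | done | exact h | exact Or.inl h | grind [tryLock, lockOf]
  · constructor <;> simp only [perform_val_of_ne hw] <;> intros <;> rename_i h <;>
      first | exact h | exact Or.inl h

set_option maxHeartbeats 8000000 in
theorem userActor_step (he : Enabled P now s a) (w : V) : UserActorStep P now s a w := by
  by_cases hw : a.actor = some w
  · have hh := honest_of_actor he hw
    constructor <;> intros <;> rename_i h <;> cases a <;>
        simp only [Action.actor, reduceCtorEq, Option.some.injEq] at hw <;> subst hw <;>
        simp only [↓perform_fpLock, ↓perform_poolAdd, ↓perform_startLocks, ↓perform_qcDecide,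
          ↓perform_taDecide, perform, Enabled, State.setVal_val_self, VState.receive_eq,
          VState.execute_eq, VState.pobDecide, VState.taPropose, VState.settle, VState.broadcast,
          VState.poaDecide_eq, VState.setLockStatus_eq, VState.setSlow_eq, VState.qcPropose_eq,
          VState.initiate_eq, VState.receiveTx, Set.mem_union, Set.mem_ofPred_eq,
          Set.mem_singleton_iff, Set.mem_sdiff, Finset.mem_insert, Finset.mem_sdiff,
              reduceCtorEq] at h he ⊢ <;>
        first | done | exact h | exact Or.inl h | grind [tryLock, lockOf]
  · constructor <;> simp only [perform_val_of_ne hw] <;> intros <;> rename_i h <;>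
      first | exact h | exact Or.inl h

set_option maxHeartbeats 8000000 in
theorem reactiveActor_step (he : Enabled P now s a) (w : V) (X : R) :
    ReactiveActorStep P now s a w X := by
  by_cases hw : a.actor = some w
  · have hh := honest_of_actor he hw
    constructor <;> intros <;> rename_i h <;> cases a <;>
        simp only [Action.actor, reduceCtorEq, Option.some.injEq] at hw <;> subst hw <;>
        simp only [↓perform_fpLock, ↓perform_poolAdd, ↓perform_startLocks, ↓perform_qcDecide,
          ↓perform_taDecide, perform, Enabled, State.setVal_val_self, VState.receive_eq,
          VState.execute_eq, VState.pobDecide, VState.taPropose, VState.settle, VState.broadcast,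
          VState.poaDecide_eq, VState.setLockStatus_eq, VState.setSlow_eq, VState.qcPropose_eq,
          VState.initiate_eq, VState.receiveTx, Set.mem_union, Set.mem_ofPred_eq,
          Set.mem_singleton_iff, Set.mem_sdiff, Finset.mem_insert, Finset.mem_sdiff,
              reduceCtorEq] at h he ⊢ <;>
        first | done | exact h | exact Or.inl h | grind [Function.update_apply,
            VState.receivedBlock_some, VState.receivedBlock_of_some]
  · constructor <;> simp only [perform_val_of_ne hw] <;> intros <;> rename_i h <;>
      first | exact h | exact Or.inl h

theorem done_step (he : Enabled P now s a) {w : V} {l : U × ℕ} :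
    l ∈ ((perform P now s a).val w).done ↔ l ∈ (s.val w).done ∨
      ∃ tx, (a = Action.execUA w tx ∨ ∃ C, a = Action.applyNotice w tx C) ∧ tx.slot = some l := by
  by_cases hw : a.actor = some w
  · have hh := honest_of_actor he hw
    cases a <;> simp only [Action.actor, reduceCtorEq, Option.some.injEq] at hw <;> subst hw <;>
      simp only [↓perform_fpLock, ↓perform_poolAdd, ↓perform_startLocks, ↓perform_qcDecide,
        ↓perform_taDecide, perform, Enabled, State.setVal_val_self, VState.receive_eq,
        VState.execute_eq, VState.pobDecide, VState.taPropose, VState.settle, VState.broadcast,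
        VState.poaDecide_eq, VState.setLockStatus_eq, VState.setSlow_eq, VState.qcPropose_eq,
        VState.initiate_eq, VState.receiveTx, Set.mem_union, Set.mem_ofPred_eq,
        Set.mem_singleton_iff, Set.mem_sdiff, Finset.mem_insert, Finset.mem_sdiff,
            reduceCtorEq] at he ⊢ <;>
      first | done | exact h | exact Or.inl h | grind
  · simp only [perform_val_of_ne hw];
    refine ⟨Or.inl, ?_⟩
    rintro (h | ⟨tx, (rfl | ⟨C, rfl⟩), h⟩)
    · exact h
    · exact absurd rfl hw
    · exact absurd rfl hw

theorem pending_step (he : Enabled P now s a) {w : V} {tx : Tx U R O C}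
    (h : tx ∈ ((perform P now s a).val w).pending) :
    (tx ∈ (s.val w).pending ∧ a ≠ Action.execUA w tx) ∨
      (w ∈ P.honest ∧ tx ∈ s.signed ∧ lockOf (s.val w).pobDec tx = none ∧
      ∀ l, tx.slot = some l → ((perform P now s a).val w).pobDec l = some tx) := by
  by_cases hw : a.actor = some w
  · have hh := honest_of_actor he hw
    cases a <;> simp only [Action.actor, reduceCtorEq, Option.some.injEq] at hw <;> subst hw <;>
      simp only [↓perform_fpLock, ↓perform_poolAdd, ↓perform_startLocks, ↓perform_qcDecide,
        ↓perform_taDecide, perform, Enabled, State.setVal_val_self, VState.receive_eq,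
        VState.execute_eq, VState.pobDecide, VState.taPropose, VState.settle, VState.broadcast,
        VState.poaDecide_eq, VState.setLockStatus_eq, VState.setSlow_eq, VState.qcPropose_eq,
        VState.initiate_eq, VState.receiveTx, Set.mem_union, Set.mem_ofPred_eq,
        Set.mem_singleton_iff, Set.mem_sdiff, Finset.mem_insert, Finset.mem_sdiff,
            reduceCtorEq] at h he ⊢ <;>
      first | done | exact h | exact Or.inl h | grind
  · simp only [perform_val_of_ne hw] at h ⊢;
    exact Or.inl ⟨h, by rintro rfl; exact hw rfl⟩

/-- An entity is an automaton, and the five disjuncts are its moves in order: no change of control,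
creation, start of the next instance, decision, processing of one queued transaction. The decision
records its justification: a fast certificate, whose proof is broadcast, or the outcome of the two
primitives. -/
theorem control_step (he : Enabled P now s a) {w : V} {X : R} :
    (((((perform P now s a).val w).ra X).active ↔ ((s.val w).ra X).active) ∧
        (((perform P now s a).val w).ra X).inst = ((s.val w).ra X).inst ∧
      ((((perform P now s a).val w).ra X).running ↔ ((s.val w).ra X).running) ∧
          (((perform P now s a).val w).ra X).queue = ((s.val w).ra X).queue ∧
      (((perform P now s a).val w).ra X).start = ((s.val w).ra X).start ∧ ∀ tx,
          a ≠ Action.exec w X tx) ∨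
    (¬ ((s.val w).ra X).active ∧ (((perform P now s a).val w).ra X).active ∧
        (((perform P now s a).val w).ra X).inst = 0 ∧ (((perform P now s a).val w).ra X).running ∧
      (((perform P now s a).val w).ra X).queue = ((s.val w).ra X).queue ∧ a = Action.create w X) ∨
    (((s.val w).ra X).active ∧ ¬ ((s.val w).ra X).running ∧ ((s.val w).ra X).queue = [] ∧
        (((perform P now s a).val w).ra X).active ∧
      (((perform P now s a).val w).ra X).inst = ((s.val w).ra X).inst + 1 ∧
          (((perform P now s a).val w).ra X).running ∧
              (((perform P now s a).val w).ra X).queue = [] ∧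
      a = Action.next w X ((s.val w).ra X).inst) ∨
    (w ∈ P.honest ∧ ((s.val w).ra X).active ∧ ((s.val w).ra X).running ∧
        (((perform P now s a).val w).ra X).active ∧
      (((perform P now s a).val w).ra X).inst = ((s.val w).ra X).inst ∧
          ¬ (((perform P now s a).val w).ra X).running ∧ (∀ tx, a ≠ Action.exec w X tx) ∧
      ∃ B, (((perform P now s a).val w).ra X).queue = P.order B ∧
      (((Fintype.card V - P.p ≤ ((s.val w).votersFor X ((s.val w).ra X).inst (some B)).card ∨
          s.verifyPoa P X ((s.val w).ra X).inst B) ∧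
          Msg.proof X ((s.val w).ra X).inst B ∈ ((perform P now s a).val w).sent) ∨
        ∃ B₀, ((s.val w).ra X).qcDec ((s.val w).ra X).inst = some B₀ ∧
          (∀ tx ∈ B₀, tx.IsUARA → ∀ l, tx.slot = some l → (s.val w).taDec l ≠ none) ∧
          B = B₀.filter fun tx => ∀ l, tx.slot = some l → (s.val w).taDec l = some (some tx))) ∨
    ∃ tx, a = Action.exec w X tx ∧ ((s.val w).ra X).active ∧ ¬ ((s.val w).ra X).running ∧
      ((s.val w).ra X).queue.head? = some tx ∧ (((perform P now s a).val w).ra X).queue = ((s.val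
          w).ra X).queue.tail ∧ (((perform P now s a).val w).ra X).active ∧
      ¬ (((perform P now s a).val w).ra X).running ∧
          (((perform P now s a).val w).ra X).inst = ((s.val w).ra X).inst := by
  by_cases hw : a.actor = some w
  · have hh := honest_of_actor he hw
    cases a <;> simp only [Action.actor, reduceCtorEq, Option.some.injEq] at hw <;> subst hw <;>
      simp only [↓perform_fpLock, ↓perform_poolAdd, ↓perform_startLocks, ↓perform_qcDecide,
        ↓perform_taDecide, perform, Enabled, State.setVal_val_self, VState.receive_eq,
        VState.execute_eq, VState.pobDecide, VState.taPropose, VState.settle, VState.broadcast,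
        VState.poaDecide_eq, VState.setLockStatus_eq, VState.setSlow_eq, VState.qcPropose_eq,
        VState.initiate_eq, VState.receiveTx, Set.mem_union, Set.mem_ofPred_eq,
        Set.mem_singleton_iff, Set.mem_sdiff, Finset.mem_insert, Finset.mem_sdiff,
            reduceCtorEq] at he ⊢ <;>
      first | done | exact h | exact Or.inl h | grind [VState.InInst]
  · simp only [perform_val_of_ne hw];
    exact Or.inl ⟨trivial, trivial, trivial, trivial, trivial, by rintro tx rfl; exact hw rfl⟩

theorem exec_frame (he : Enabled P now s a) {w : V} {X : R} (h : ∀ tx, a ≠ Action.exec w X tx) :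
    (((perform P now s a).val w).ra X).executed = ((s.val w).ra X).executed ∧
        (((perform P now s a).val w).ra X).state = ((s.val w).ra X).state ∧
      (((perform P now s a).val w).ra X).objs = ((s.val w).ra X).objs := by
  by_cases hw : a.actor = some w
  · have hh := honest_of_actor he hw
    cases a <;> simp only [Action.actor, reduceCtorEq, Option.some.injEq] at hw <;> subst hw <;>
      simp only [↓perform_fpLock, ↓perform_poolAdd, ↓perform_startLocks, ↓perform_qcDecide,
        ↓perform_taDecide, perform, Enabled, State.setVal_val_self, VState.receive_eq,
        VState.execute_eq, VState.pobDecide, VState.taPropose, VState.settle, VState.broadcast,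
        VState.poaDecide_eq, VState.setLockStatus_eq, VState.setSlow_eq, VState.qcPropose_eq,
        VState.initiate_eq, VState.receiveTx, Set.mem_union, Set.mem_ofPred_eq,
        Set.mem_singleton_iff, Set.mem_sdiff, Finset.mem_insert, Finset.mem_sdiff,
            reduceCtorEq] at h he ⊢ <;>
      first | done | exact h | exact Or.inl h | grind
  · simp only [perform_val_of_ne hw] at h ⊢; exact ⟨trivial, trivial, trivial⟩

theorem signed_mono {tx : Tx U R O C} (h : tx ∈ s.signed) : tx ∈ (perform P now s a).signed := by
  cases a <;> simp only [perform, State.setVal] <;> (try split_ifs) <;> simp [h]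

theorem signed_step {tx : Tx U R O C} (h : tx ∈ (perform P now s a).signed) :
    tx ∈ s.signed ∨ a = Action.issue tx ∨ a = Action.byzSign tx := by
  cases a <;> simp only [perform, State.setVal] at h <;> (try split_ifs at h) <;>
    first | exact Or.inl h | (simp at h; rcases h with h | h <;> simp [h])

end StepLemmas

/-! Elementary facts -/

theorem Tx.IsUARA.exists_slot {tx : Tx U R O C} (h : tx.IsUARA) : ∃ l, tx.slot = some l := by
  cases tx <;> simp_all [Tx.IsUARA, Tx.slot]

theorem Tx.IsUA.exists_slot {tx : Tx U R O C} (h : tx.IsUA) : ∃ l, tx.slot = some l := by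
  cases tx <;> simp_all [Tx.IsUA, Tx.slot]

theorem Tx.IsRARA.slot_eq {tx : Tx U R O C} (h : tx.IsRARA) : tx.slot = none := by
  cases tx <;> simp_all [Tx.IsRARA, Tx.slot]

theorem Tx.isRARA_or_isUARA {tx : Tx U R O C} {X : R} (h : tx.recv = some X) :
    tx.IsRARA ∨ tx.IsUARA := by
  cases tx <;> simp_all [Tx.IsRARA, Tx.IsUARA, Tx.recv]

theorem lockOf_of_slot {L : U × ℕ → Option (Tx U R O C)} {tx : Tx U R O C} {l : U × ℕ}
    (h : tx.slot = some l) : lockOf L tx = L l := by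
  simp [lockOf, h]

theorem lockOf_eq_some {L : U × ℕ → Option (Tx U R O C)} {tx tx' : Tx U R O C} :
    lockOf L tx = some tx' ↔ ∃ l, tx.slot = some l ∧ L l = some tx' := by
  simp [lockOf, Option.bind_eq_some_iff]

theorem release_isRARA {X : R} {owned : Finset O} {cs : List (OutCall R O C)} {tx : Tx U R O C}
    (h : tx ∈ (release (U := U) X owned cs).2) : tx.IsRARA := by
  induction cs generalizing owned with
  | nil => simp [release] at h
  | cons c cs ih =>
    simp only [release] at h
    split_ifs at h
    · rcases List.mem_cons.1 h with rfl | h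
      · trivial
      · exact ih h
    · exact ih h

theorem outgoing_isRARA {g : VState V U R O C S} {P : Sys V U R O C S} {X : R} {tx tx' : Tx U R O C}
    (h : tx ∈ (g.outgoing P X tx').2) : tx.IsRARA :=
  release_isRARA h

/-! Quorums -/

namespace Sys.Valid

variable {P : Sys V U R O C S} (hP : P.Valid)

include hP

/-- The intersection has at least `f + 1` elements, more than there are Byzantine validators. -/
theorem honest_inter {Q₁ Q₂ : Finset V} (h : Fintype.card V + P.f + 1 ≤ Q₁.card + Q₂.card) :
    ∃ u ∈ P.honest, u ∈ Q₁ ∧ u ∈ Q₂ := by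
  by_contra hc
  push Not at hc
  have h1 : Q₁ ∩ Q₂ ⊆ Finset.univ \ P.honest := by
    intro u hu
    rw [Finset.mem_inter] at hu
    simp only [Finset.mem_sdiff, Finset.mem_univ, true_and]
    exact fun hh => hc u hh hu.1 hu.2
  have h2 := Finset.card_le_card h1
  have h3 := hP.byzantine
  have h4 := Finset.card_union_add_card_inter Q₁ Q₂
  have h5 := Finset.card_le_univ (Q₁ ∪ Q₂)
  omega

theorem exists_honest {Q : Finset V} (h : P.f + 1 ≤ Q.card) : ∃ u ∈ P.honest, u ∈ Q := by
  obtain ⟨u, hu, h1, -⟩ := hP.honest_inter (Q₁ := Q) (Q₂ := Finset.univ)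
    (by rw [Finset.card_univ]; omega)
  exact ⟨u, hu, h1⟩

theorem card_honest : Fintype.card V ≤ P.honest.card + P.f := by
  have h1 := Finset.card_sdiff_add_card (s := Finset.univ) (t := P.honest)
  have h2 := hP.byzantine
  have h3 : (Finset.univ ∪ P.honest).card = Fintype.card V := by
    rw [Finset.union_eq_left.2 (Finset.subset_univ _), Finset.card_univ]
  omega

end Sys.Valid

/-! Monotonicity along executions -/

variable {P : Sys V U R O C S} {T : Trace V U R O C S}

namespace Trace.IsExecution

variable (hT : T.IsExecution P)

include hT

theorem mono_of_step {φ : State V U R O C S → Prop}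
    (hs : ∀ {now s a}, Enabled P now s a → φ s → φ (perform P now s a)) {i j : ℕ} (hij : i ≤ j)
    (h : φ (T.state i)) : φ (T.state j) := by
  induction hij with
  | refl => exact h
  | step _ ih => rw [hT.step]; exact hs (hT.enabled _) ih

theorem sent_mono {i j : ℕ} (hij : i ≤ j) {v : V} {m : Msg U R O C}
    (h : m ∈ ((T.state i).val v).sent) : m ∈ ((T.state j).val v).sent :=
  hT.mono_of_step (φ := fun s => m ∈ (s.val v).sent) (fun he h => (message_step he _).mem_sent_mono
      h) hij h

theorem rcvd_mono {i j : ℕ} (hij : i ≤ j) {v : V} {e : V × Msg U R O C}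
    (h : e ∈ ((T.state i).val v).rcvd) : e ∈ ((T.state j).val v).rcvd :=
  hT.mono_of_step (φ := fun s => e ∈ (s.val v).rcvd) (fun he h => (message_step he _).mem_rcvd_mono
      h) hij h

theorem signed_mono {i j : ℕ} (hij : i ≤ j) {tx : Tx U R O C}
    (h : tx ∈ (T.state i).signed) : tx ∈ (T.state j).signed :=
  hT.mono_of_step (φ := fun s => tx ∈ s.signed) (fun _ h => Mangrove.signed_mono h) hij h

theorem fpLocked_mono {i j : ℕ} (hij : i ≤ j) {v : V} {l : U × ℕ} {tx : Tx U R O C}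
    (h : ((T.state i).val v).fpLocked l = some tx) : ((T.state j).val v).fpLocked l = some tx :=
  hT.mono_of_step (φ := fun s => (s.val v).fpLocked l = some tx)
    (fun he h => (userActor_step he _).fpLocked_mono h) hij h

theorem spLocked_mono {i j : ℕ} (hij : i ≤ j) {v : V} {l : U × ℕ} {tx : Tx U R O C}
    (h : ((T.state i).val v).spLocked l = some tx) : ((T.state j).val v).spLocked l = some tx :=
  hT.mono_of_step (φ := fun s => (s.val v).spLocked l = some tx)
    (fun he h => (userActor_step he _).spLocked_mono h) hij h

theorem taDec_mono {i j : ℕ} (hij : i ≤ j) {v : V} {l : U × ℕ} {d : Option (Tx U R O C)}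
    (h : ((T.state i).val v).taDec l = some d) : ((T.state j).val v).taDec l = some d :=
  hT.mono_of_step (φ := fun s => (s.val v).taDec l = some d)
    (fun he h => (userActor_step he _).taDec_mono h) hij h

theorem pobDec_mono {i j : ℕ} (hij : i ≤ j) {v : V} {l : U × ℕ} {tx : Tx U R O C}
    (h : ((T.state i).val v).pobDec l = some tx) : ((T.state j).val v).pobDec l = some tx :=
  hT.mono_of_step (φ := fun s => (s.val v).pobDec l = some tx)
    (fun he h => (userActor_step he _).pobDec_mono h) hij h

theorem notices_mono {i j : ℕ} (hij : i ≤ j) {v : V} {d : Tx U R O C × Finset (U × O)}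
    (h : d ∈ ((T.state i).val v).notices) : d ∈ ((T.state j).val v).notices :=
  hT.mono_of_step (φ := fun s => d ∈ (s.val v).notices)
    (fun he h => (userActor_step he _).notices_mono h) hij h

theorem actors_mono {i j : ℕ} (hij : i ≤ j) {v : V} {X : R}
    (h : X ∈ ((T.state i).val v).actors) : X ∈ ((T.state j).val v).actors :=
  hT.mono_of_step (φ := fun s => X ∈ (s.val v).actors)
    (fun he h => (userActor_step he _).actors_mono h) hij h

theorem block_mono {i j : ℕ} (hij : i ≤ j) {v : V} {X : R} {k : ℕ} {B : Block U R O C}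
    (h : (((T.state i).val v).ra X).block k = some B) :
    (((T.state j).val v).ra X).block k = some B :=
  hT.mono_of_step (φ := fun s => ((s.val v).ra X).block k = some B)
    (fun he h => (reactiveActor_step he _ _).block_mono h) hij h

theorem lockPhase_mono {i j : ℕ} (hij : i ≤ j) {v : V} {X : R} {k : ℕ}
    (h : k ∈ (((T.state i).val v).ra X).lockPhase) :
    k ∈ (((T.state j).val v).ra X).lockPhase :=
  hT.mono_of_step (φ := fun s => k ∈ ((s.val v).ra X).lockPhase)
    (fun he h => (reactiveActor_step he _ _).lockPhase_mono h) hij h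

theorem answered_mono {i j : ℕ} (hij : i ≤ j) {v : V} {X : R} {k : ℕ} {tx : Tx U R O C} {b : Bool}
    (h : (((T.state i).val v).ra X).lockStatus k tx = LockStatus.answered b) :
    (((T.state j).val v).ra X).lockStatus k tx = LockStatus.answered b :=
  hT.mono_of_step (φ := fun s => ((s.val v).ra X).lockStatus k tx = LockStatus.answered b)
    (fun he h => (reactiveActor_step he _ _).lockStatus_answered_mono h) hij h

theorem qcProp_mono {i j : ℕ} (hij : i ≤ j) {v : V} {X : R} {k : ℕ}
    (h : (((T.state i).val v).ra X).qcProp k ≠ none) :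
    (((T.state j).val v).ra X).qcProp k ≠ none :=
  hT.mono_of_step (φ := fun s => ((s.val v).ra X).qcProp k ≠ none)
    (fun he h => (reactiveActor_step he _ _).qcProp_mono h) hij h

theorem qcDec_mono {i j : ℕ} (hij : i ≤ j) {v : V} {X : R} {k : ℕ} {B : Block U R O C}
    (h : (((T.state i).val v).ra X).qcDec k = some B) :
    (((T.state j).val v).ra X).qcDec k = some B :=
  hT.mono_of_step (φ := fun s => ((s.val v).ra X).qcDec k = some B)
    (fun he h => (reactiveActor_step he _ _).qcDec_mono h) hij h

theorem done_mono {i j : ℕ} (hij : i ≤ j) {v : V} {l : U × ℕ}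
    (h : l ∈ ((T.state i).val v).done) : l ∈ ((T.state j).val v).done :=
  hT.mono_of_step (φ := fun s => l ∈ (s.val v).done)
    (fun he h => (done_step he).2 (Or.inl h)) hij h

/-! Facts about the state of the execution that hold initially and are preserved by steps -/

theorem rcvd_sent {i : ℕ} {v u : V} {m : Msg U R O C} (h : (u, m) ∈ ((T.state i).val v).rcvd)
    (hu : u ∈ P.honest) : m ∈ ((T.state i).val u).sent := by
  induction i with
  | zero => rw [hT.initial] at h; simp [Sys.initial] at h
  | succ i ih =>
    refine hT.sent_mono (Nat.le_succ i) ?_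
    rw [hT.step i] at h
    rcases (message_step (hT.enabled i) _).rcvd_step h with h | h
    · exact ih h
    · exact h hu

theorem fpLocked_spec {i : ℕ} {v : V} {l : U × ℕ} {tx : Tx U R O C}
    (h : ((T.state i).val v).fpLocked l = some tx) :
    tx ∈ (T.state i).signed ∧ tx.slot = some l := by
  induction i with
  | zero => rw [hT.initial] at h; simp [Sys.initial] at h
  | succ i ih =>
    rw [hT.step i] at h
    rcases (userActor_step (hT.enabled i) _).fpLocked_step h with h | h
    · exact ⟨hT.signed_mono (Nat.le_succ i) (ih h).1, (ih h).2⟩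
    · exact ⟨hT.signed_mono (Nat.le_succ i) h.2.1, h.2.2⟩

theorem lockOf_fpLocked_mono {i j : ℕ} (hij : i ≤ j) {v : V} {tx tx' : Tx U R O C}
    (h : lockOf ((T.state i).val v).fpLocked tx = some tx') :
    lockOf ((T.state j).val v).fpLocked tx = some tx' := by
  obtain ⟨l, hl, h⟩ := lockOf_eq_some.1 h
  exact lockOf_eq_some.2 ⟨l, hl, hT.fpLocked_mono hij h⟩

theorem lockOf_spLocked_mono {i j : ℕ} (hij : i ≤ j) {v : V} {tx tx' : Tx U R O C}
    (h : lockOf ((T.state i).val v).spLocked tx = some tx') :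
    lockOf ((T.state j).val v).spLocked tx = some tx' := by
  obtain ⟨l, hl, h⟩ := lockOf_eq_some.1 h
  exact lockOf_eq_some.2 ⟨l, hl, hT.spLocked_mono hij h⟩

/-- An honest validator FP-locks at most one transaction per slot. -/
theorem fpLocked_unique {i j : ℕ} {v : V} {tx tx' : Tx U R O C} {l : U × ℕ}
    (hs : tx.slot = some l) (hs' : tx'.slot = some l)
    (h : lockOf ((T.state i).val v).fpLocked tx = some tx)
    (h' : lockOf ((T.state j).val v).fpLocked tx' = some tx') : tx = tx' := by
  have h1 := hT.lockOf_fpLocked_mono (le_max_left i j) h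
  have h2 := hT.lockOf_fpLocked_mono (le_max_right i j) h'
  rw [lockOf_of_slot hs] at h1
  rw [lockOf_of_slot hs'] at h2
  rw [h1] at h2
  exact Option.some.inj h2

theorem spLocked_slot {i : ℕ} {v : V} {l : U × ℕ} {tx : Tx U R O C}
    (h : ((T.state i).val v).spLocked l = some tx) : tx.slot = some l := by
  induction i with
  | zero => rw [hT.initial] at h; simp [Sys.initial] at h
  | succ i ih =>
    rw [hT.step i] at h
    rcases (userActor_step (hT.enabled i) _).spLocked_step h with h | h
    · exact ih h
    · exact h.2.1

theorem taProp_spLocked {i : ℕ} {v : V} {l : U × ℕ} {tx : Tx U R O C}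
    (h : ((T.state i).val v).taProp l = some tx) : ((T.state i).val v).spLocked l = some tx := by
  induction i with
  | zero => rw [hT.initial] at h; simp [Sys.initial] at h
  | succ i ih =>
    rw [hT.step i] at h ⊢
    rcases (userActor_step (hT.enabled i) _).taProp_step h with h | h
    · exact (userActor_step (hT.enabled i) _).spLocked_mono (ih h)
    · exact h

theorem lockStatus_fpLocked {i : ℕ} {v : V} {X : R} {k : ℕ} {tx : Tx U R O C}
    (h : (∃ t, (((T.state i).val v).ra X).lockStatus k tx = LockStatus.waiting t) ∨
      (((T.state i).val v).ra X).lockStatus k tx = LockStatus.answered true) :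
    lockOf ((T.state i).val v).fpLocked tx = some tx := by
  induction i with
  | zero => rw [hT.initial] at h; simp [Sys.initial] at h
  | succ i ih =>
    have hm := hT.lockOf_fpLocked_mono (Nat.le_succ i) (v := v) (tx := tx) (tx' := tx)
    rcases h with ⟨t, h⟩ | h
    · rw [hT.step i] at h
      rcases (reactiveActor_step (hT.enabled i) _ _).lockStatus_waiting_step h with h | h
      · exact hm (ih (Or.inl ⟨t, h⟩))
      · rwa [hT.step i]
    · rw [hT.step i] at h
      rcases (reactiveActor_step (hT.enabled i) _ _).lockStatus_answered_step h with h | h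
      · exact hm (ih (Or.inr h))
      · exact hm (ih (Or.inl h.2.1))

theorem pobVote_fpLocked {i : ℕ} {v : V} {l : U × ℕ} {tx : Tx U R O C}
    (h : Msg.pobVote l (some tx) ∈ ((T.state i).val v).sent) :
    lockOf ((T.state i).val v).fpLocked tx = some tx := by
  induction i with
  | zero => rw [hT.initial] at h; simp [Sys.initial] at h
  | succ i ih =>
    have hm := hT.lockOf_fpLocked_mono (Nat.le_succ i) (v := v) (tx := tx) (tx' := tx)
    rw [hT.step i] at h
    rcases (message_step (hT.enabled i) _).pobVote_step h with h | h
    · exact hm (ih h)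
    · rw [hT.step i, lockOf_of_slot h.2.1]; exact h.2.2

/-- A vote is cast only while none has been sent in the instance, so two votes must come from the
same step, and the action of that step determines both. -/
theorem vote_unique {i : ℕ} {v : V} {X : R} {k : ℕ} {w w' : Option (Block U R O C)}
    {b b' : Block U R O C} (h : Msg.vote X k w b ∈ ((T.state i).val v).sent)
    (h' : Msg.vote X k w' b' ∈ ((T.state i).val v).sent) : w = w' ∧ b = b' := by
  induction i with
  | zero => rw [hT.initial] at h; simp [Sys.initial] at h
  | succ i ih =>
    have hs := hT.step i
    have he := hT.enabled i
    rw [hs] at h h'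
    by_cases hv : ((T.state i).val v).Voted X k
    · rcases (message_step he _).vote_step h with h1 | h1
      · rcases (message_step he _).vote_step h' with h2 | h2
        · exact ih h1 h2
        · exact absurd hv h2.2.1
      · exact absurd hv h1.2.1
    · have h1 := ((message_step he _).vote_step h).resolve_left fun h => hv ⟨_, _, h⟩
      have h2 := ((message_step he _).vote_step h').resolve_left fun h => hv ⟨_, _, h⟩
      obtain ⟨-, -, -, rfl, h1⟩ := h1
      obtain ⟨-, -, -, rfl, h2⟩ := h2
      refine ⟨?_, rfl⟩
      rcases h1 with ⟨rfl, e⟩ | ⟨B, e, -, -, rfl⟩ <;> rcases h2 with ⟨rfl, e'⟩ | ⟨B', e', -, -,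
          rfl⟩ <;>
        rw [e] at e' <;> cases e' <;> rfl

end Trace.IsExecution

/-! ### Support of transactions by quorums. -/

/-- `tx` was emitted before step `i`. -/
def Trace.EmittedBefore (T : Trace V U R O C S) (P : Sys V U R O C S) (tx : Tx U R O C) (i : ℕ) :
    Prop :=
  ∃ j, j < i ∧ T.Emitted P tx j

/-- What holds before step `i` of a transaction in the pool of the entity for `X` at `v`, or in a
block for which that entity has voted. -/
structure Trace.Supports (T : Trace V U R O C S) (P : Sys V U R O C S) (v : V) (X : R)
    (tx : Tx U R O C) (i : ℕ) : Prop where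
  recv : tx.recv = some X
  emitted : T.EmittedBefore P tx i
  locked : tx.IsUARA → lockOf ((T.state i).val v).fpLocked tx = some tx

/-- A quorum of `m` validators the honest members of which support `tx`. -/
def Trace.SupportedBy (T : Trace V U R O C S) (P : Sys V U R O C S) (m : ℕ) (X : R)
    (tx : Tx U R O C) (i : ℕ) : Prop :=
  ∃ Q : Finset V, m ≤ Q.card ∧ ∀ u ∈ Q, u ∈ P.honest → T.Supports P u X tx i

/-- A quorum of `m` validators the honest members of which have FP-locked `tx`. -/
def Trace.LockedBy (T : Trace V U R O C S) (P : Sys V U R O C S) (m : ℕ) (tx : Tx U R O C) (i : ℕ) :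
    Prop :=
  ∃ Q : Finset V, m ≤ Q.card ∧ ∀ u ∈ Q, u ∈ P.honest →
    lockOf ((T.state i).val u).fpLocked tx = some tx

theorem Trace.EmittedBefore.mono {tx : Tx U R O C} {i j : ℕ} (hij : i ≤ j)
    (h : T.EmittedBefore P tx i) : T.EmittedBefore P tx j := by
  obtain ⟨k, hk, h⟩ := h
  exact ⟨k, hk.trans_le hij, h⟩

theorem Trace.SupportedBy.lockedBy {m : ℕ} {X : R} {tx : Tx U R O C} {i : ℕ}
    (h : T.SupportedBy P m X tx i) (ht : tx.IsUARA) : T.LockedBy P m tx i := by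
  obtain ⟨Q, hQ, h⟩ := h
  exact ⟨Q, hQ, fun u hu hh => (h u hu hh).locked ht⟩

theorem Trace.SupportedBy.of_le {m m' : ℕ} {X : R} {tx : Tx U R O C} {i : ℕ}
    (h : T.SupportedBy P m X tx i) (hm : m' ≤ m) : T.SupportedBy P m' X tx i := by
  obtain ⟨Q, hQ, h⟩ := h
  exact ⟨Q, hm.trans hQ, h⟩

theorem Trace.LockedBy.of_le {m m' : ℕ} {tx : Tx U R O C} {i : ℕ}
    (h : T.LockedBy P m tx i) (hm : m' ≤ m) : T.LockedBy P m' tx i := by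
  obtain ⟨Q, hQ, h⟩ := h
  exact ⟨Q, hm.trans hQ, h⟩

namespace Trace.IsExecution

variable (hT : T.IsExecution P)

include hT

theorem supports_mono {i j : ℕ} (hij : i ≤ j) {v : V} {X : R} {tx : Tx U R O C}
    (h : T.Supports P v X tx i) : T.Supports P v X tx j :=
  ⟨h.recv, h.emitted.mono hij, fun ht => hT.lockOf_fpLocked_mono hij (h.locked ht)⟩

theorem supportedBy_mono {i j : ℕ} (hij : i ≤ j) {m : ℕ} {X : R} {tx : Tx U R O C}
    (h : T.SupportedBy P m X tx i) : T.SupportedBy P m X tx j := by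
  obtain ⟨Q, hQ, h⟩ := h
  exact ⟨Q, hQ, fun u hu hh => hT.supports_mono hij (h u hu hh)⟩

theorem lockedBy_mono {i j : ℕ} (hij : i ≤ j) {m : ℕ} {tx : Tx U R O C}
    (h : T.LockedBy P m tx i) : T.LockedBy P m tx j := by
  obtain ⟨Q, hQ, h⟩ := h
  exact ⟨Q, hQ, fun u hu hh => hT.lockOf_fpLocked_mono hij (h u hu hh)⟩

theorem exists_signs {i : ℕ} {tx : Tx U R O C} (h : tx ∈ (T.state i).signed) :
    ∃ j, j < i ∧ T.Signs tx j := by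
  induction i with
  | zero => rw [hT.initial] at h; simp [Sys.initial] at h
  | succ i ih =>
    rw [hT.step i] at h
    rcases signed_step h with h | h
    · obtain ⟨j, hj, h⟩ := ih h
      exact ⟨j, hj.trans (Nat.lt_succ_self i), h⟩
    · exact ⟨i, Nat.lt_succ_self i, h⟩

/-- A signed user transaction is emitted once its preconditions hold at an honest validator. -/
theorem emittedBefore_of_ready {i : ℕ} {v : V} (hv : v ∈ P.honest) {tx : Tx U R O C}
    (hs : tx ∈ (T.state i).signed) (ht : tx.IsUARA) (hr : ((T.state i).val v).Ready tx) :
    T.EmittedBefore P tx i := by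
  obtain ⟨j, hj, h⟩ := hT.exists_signs hs
  obtain ⟨⟨A, sn⟩, hl⟩ := ht.exists_slot
  obtain ⟨h1, h2⟩ := hr A sn hl
  -- The emission is dated at the signature, step `j`; the current step `i` serves as the later
  -- moment at which the preconditions hold.
  exact ⟨j, hj, Or.inl ⟨A, sn, hl, h, v, hv, fun m hm => ⟨i, hj.le, h1 m hm⟩, i, hj.le, h2⟩⟩

theorem awaiting_spec {i : ℕ} {v : V} {tx : Tx U R O C}
    (h : tx ∈ ((T.state i).val v).awaiting) :
    tx.IsUARA ∧ lockOf ((T.state i).val v).fpLocked tx = some tx := by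
  induction i with
  | zero => rw [hT.initial] at h; simp [Sys.initial] at h
  | succ i ih =>
    rw [hT.step i] at h
    rcases (userActor_step (hT.enabled i) _).awaiting_step h with h | ⟨-, h1, -, h2⟩
    · exact ⟨(ih h).1, hT.lockOf_fpLocked_mono (Nat.le_succ i) (ih h).2⟩
    · obtain ⟨l, hl⟩ := h1.exists_slot
      refine ⟨h1, ?_⟩
      rw [lockOf_of_slot hl, hT.step i]
      exact h2 l hl

theorem locked_signed {i : ℕ} {v : V} {tx : Tx U R O C}
    (h : lockOf ((T.state i).val v).fpLocked tx = some tx) : tx ∈ (T.state i).signed := by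
  obtain ⟨l, -, h⟩ := lockOf_eq_some.1 h
  exact (hT.fpLocked_spec h).1

/-- A transaction enters an inner link either when it is forwarded, thus signed, FP-locked and
ready, or as an output of an execution, which is an emission by definition. -/
theorem inbox_spec {i : ℕ} {v : V} {tx : Tx U R O C} (h : tx ∈ ((T.state i).val v).inbox) :
    T.EmittedBefore P tx i ∧
      (tx.IsUARA → lockOf ((T.state i).val v).fpLocked tx = some tx) := by
  induction i with
  | zero => rw [hT.initial] at h; simp [Sys.initial] at h
  | succ i ih =>
    have hm := hT.lockOf_fpLocked_mono (Nat.le_succ i) (v := v) (tx := tx) (tx' := tx)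
    rw [hT.step i] at h
    rcases (userActor_step (hT.enabled i) _).inbox_step h with h | ⟨hv, h, hr⟩ | ⟨X, tx', hv, ha,
        he, h⟩
    · exact ⟨(ih h).1.mono (Nat.le_succ i), fun ht => hm ((ih h).2 ht)⟩
    · obtain ⟨h1, h2⟩ := hT.awaiting_spec h
      exact ⟨(hT.emittedBefore_of_ready hv (hT.locked_signed h2) h1 hr).mono (Nat.le_succ i),
        fun _ => hm h2⟩
    · refine ⟨⟨i, Nat.lt_succ_self i, Or.inr ⟨v, hv, X, tx', ⟨ha, he⟩, h⟩⟩, fun ht => ?_⟩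
      have := outgoing_isRARA h
      cases tx <;> simp_all [Tx.IsRARA, Tx.IsUARA]

theorem pool_supports {i : ℕ} {v : V} {X : R} {tx : Tx U R O C}
    (h : tx ∈ (((T.state i).val v).ra X).pool) : T.Supports P v X tx i := by
  induction i with
  | zero => rw [hT.initial] at h; simp [Sys.initial] at h
  | succ i ih =>
    refine hT.supports_mono (Nat.le_succ i) ?_
    rw [hT.step i] at h
    rcases (reactiveActor_step (hT.enabled i) _ _).pool_step h with h | ⟨-, h, hr⟩
    · exact ih h
    · exact ⟨hr, (hT.inbox_spec h).1, (hT.inbox_spec h).2⟩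

theorem block_recv {i : ℕ} {v : V} {X : R} {k : ℕ} {B : Block U R O C}
    (h : (((T.state i).val v).ra X).block k = some B) : ∀ tx ∈ B, tx.recv = some X := by
  induction i with
  | zero => rw [hT.initial] at h; simp [Sys.initial] at h
  | succ i ih =>
    rw [hT.step i] at h
    rcases (reactiveActor_step (hT.enabled i) _ _).block_step h with h | h
    · exact ih h
    · exact h.2

/-- A recorded proposal of an honest leader was sent by the leader. -/
theorem block_sent {i : ℕ} {v : V} {X : R} {k : ℕ} {B : Block U R O C}
    (h : (((T.state i).val v).ra X).block k = some B) (hl : P.leader k ∈ P.honest) :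
    Msg.proposal X k B ∈ ((T.state i).val (P.leader k)).sent := by
  induction i with
  | zero => rw [hT.initial] at h; simp [Sys.initial] at h
  | succ i ih =>
    refine hT.sent_mono (Nat.le_succ i) ?_
    rw [hT.step i] at h
    rcases (reactiveActor_step (hT.enabled i) _ _).block_step h with h | h
    · exact ih h
    · exact h.1 hl

/-- Locks are requested only after the RA-RA transactions of the recorded proposal have been found
in the pool. A recorded proposal is never replaced, so the block checked then is the present `B`. -/
theorem lockPhase_emitted {i : ℕ} {v : V} {X : R} {k : ℕ} {B : Block U R O C}
    (h : k ∈ (((T.state i).val v).ra X).lockPhase)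
    (hB : (((T.state i).val v).ra X).block k = some B) {tx : Tx U R O C} (ht : tx ∈ B)
    (hr : tx.IsRARA) : T.EmittedBefore P tx i := by
  induction i with
  | zero => rw [hT.initial] at h; simp [Sys.initial] at h
  | succ i ih =>
    refine Trace.EmittedBefore.mono (Nat.le_succ i) ?_
    have h' := h
    rw [hT.step i] at h'
    have key : ∀ B', (((T.state i).val v).ra X).block k = some B' → B' = B := fun B' hB' => by
      have := hT.block_mono (Nat.le_succ i) hB'
      rw [hB] at this
      exact (Option.some.inj this).symm
    rcases (reactiveActor_step (hT.enabled i) _ _).lockPhase_step h' with h' | ⟨-, -, B', hB', h'⟩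
    · by_cases hn : ∃ B', (((T.state i).val v).ra X).block k = some B'
      · obtain ⟨B', hB'⟩ := hn
        exact ih h' (key B' hB' ▸ hB')
      · exfalso
        -- A lock phase is entered only with a recorded proposal, so the case without one is void.
        have hex : ∀ j, k ∈ (((T.state j).val v).ra X).lockPhase →
            ∃ B', (((T.state j).val v).ra X).block k = some B' := by
          intro j
          induction j with
          | zero => intro h; rw [hT.initial] at h; simp [Sys.initial] at h
          | succ j ihj =>
            intro h
            rw [hT.step j] at h
            rcases (reactiveActor_step (hT.enabled j) _ _).lockPhase_step h with h | ⟨-, -, B',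
                hB', -⟩
            · obtain ⟨B', hB'⟩ := ihj h
              exact ⟨B', hT.block_mono (Nat.le_succ j) hB'⟩
            · exact ⟨B', hT.block_mono (Nat.le_succ j) hB'⟩
        exact hn (hex i h')
    · exact (hT.pool_supports (h' tx (key B' hB' ▸ ht) hr)).emitted

theorem answered_emitted {i : ℕ} {v : V} {X : R} {k : ℕ} {tx : Tx U R O C} (ht : tx.IsUARA)
    (h : (((T.state i).val v).ra X).lockStatus k tx = LockStatus.answered true) :
    T.EmittedBefore P tx i := by
  induction i with
  | zero => rw [hT.initial] at h; simp [Sys.initial] at h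
  | succ i ih =>
    refine Trace.EmittedBefore.mono (Nat.le_succ i) ?_
    rw [hT.step i] at h
    rcases (reactiveActor_step (hT.enabled i) _ _).lockStatus_answered_step h with h | ⟨hv, h, hr⟩
    · exact ih h
    · exact hT.emittedBefore_of_ready hv
        (hT.locked_signed (hT.lockStatus_fpLocked (Or.inl h))) ht hr

theorem vote_fallback {i : ℕ} {v : V} {X : R} {k : ℕ} {w : Option (Block U R O C)}
    {b : Block U R O C} (h : Msg.vote X k w b ∈ ((T.state i).val v).sent) :
    ∀ tx ∈ b, T.Supports P v X tx i := by
  intro tx ht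
  induction i with
  | zero => rw [hT.initial] at h; simp [Sys.initial] at h
  | succ i ih =>
    refine hT.supports_mono (Nat.le_succ i) ?_
    rw [hT.step i] at h
    rcases (message_step (hT.enabled i) _).vote_step h with h | ⟨-, -, -, rfl, -⟩
    · exact ih h
    · exact hT.pool_supports ht

/-- A positive vote vouches for the whole block: the RA-RA transactions were in the voter's pool,
and each lock for a UA-RA transaction was granted, which required the FP-lock and, at that moment,
the preconditions. -/
theorem vote_block_eq {i : ℕ} {v : V} {X : R} {k : ℕ} {B : Block U R O C}
    {b : Block U R O C} (h : Msg.vote X k (some B) b ∈ ((T.state i).val v).sent) :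
    (((T.state i).val v).ra X).block k = some B ∧ ∀ tx ∈ B, T.Supports P v X tx i := by
  induction i with
  | zero => rw [hT.initial] at h; simp [Sys.initial] at h
  | succ i ih =>
    rw [hT.step i] at h
    suffices h : (((T.state i).val v).ra X).block k = some B ∧ ∀ tx ∈ B, T.Supports P v X tx i from
      ⟨hT.block_mono (Nat.le_succ i) h.1, fun tx ht => hT.supports_mono (Nat.le_succ i) (h.2 tx ht)⟩
    rcases (message_step (hT.enabled i) _).vote_step h with h | ⟨-, -, -, -, h⟩
    · exact ih h
    · rcases h with ⟨h, -⟩ | ⟨B', -, hB, hl, h⟩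
      · simp at h
      · split_ifs at h with ha
        cases h
        refine ⟨hB, fun tx ht => ⟨hT.block_recv hB tx ht, ?_, fun hu =>
          hT.lockStatus_fpLocked (Or.inr (ha tx ht hu))⟩⟩
        rcases Tx.isRARA_or_isUARA (hT.block_recv hB tx ht) with hr | hu
        · exact hT.lockPhase_emitted hl hB ht hr
        · exact hT.answered_emitted hu (ha tx ht hu)

theorem votersFor_spec {i : ℕ} {v u : V} {X : R} {k : ℕ} {w : Option (Block U R O C)}
    (h : u ∈ ((T.state i).val v).votersFor X k w) (hu : u ∈ P.honest) :
    ∃ b, Msg.vote X k w b ∈ ((T.state i).val u).sent := by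
  simp only [VState.votersFor, Finset.mem_filter, Finset.mem_univ, true_and] at h
  obtain ⟨b, h⟩ := h
  exact ⟨b, hT.rcvd_sent h hu⟩

theorem votersFor_mono {i j : ℕ} (hij : i ≤ j) {v : V} {X : R} {k : ℕ}
    {w : Option (Block U R O C)} :
    ((T.state i).val v).votersFor X k w ⊆ ((T.state j).val v).votersFor X k w := by
  intro u h
  simp only [VState.votersFor, Finset.mem_filter, Finset.mem_univ, true_and] at h ⊢
  obtain ⟨b, h⟩ := h
  exact ⟨b, hT.rcvd_mono hij h⟩

theorem voters_mono {i j : ℕ} (hij : i ≤ j) {v : V} {X : R} {k : ℕ} :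
    ((T.state i).val v).voters X k ⊆ ((T.state j).val v).voters X k := by
  intro u h
  simp only [VState.voters, Finset.mem_filter, Finset.mem_univ, true_and] at h ⊢
  obtain ⟨w, b, h⟩ := h
  exact ⟨w, b, hT.rcvd_mono hij h⟩

theorem verifyPoa_mono {i j : ℕ} (hij : i ≤ j) {X : R} {k : ℕ} {B : Block U R O C}
    (h : (T.state i).verifyPoa P X k B) : (T.state j).verifyPoa P X k B := by
  obtain ⟨Q, hQ, h⟩ := h
  refine ⟨Q, hQ, fun u hu hh => ?_⟩
  obtain ⟨b, hb⟩ := h u hu hh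
  exact ⟨b, hT.sent_mono hij hb⟩

theorem verifyPob_mono {i j : ℕ} (hij : i ≤ j) {tx : Tx U R O C}
    (h : (T.state i).verifyPob P tx) : (T.state j).verifyPob P tx := by
  obtain ⟨Q, hQ, h⟩ := h
  refine ⟨Q, hQ, fun u hu hh => ?_⟩
  obtain ⟨l, hl, hb⟩ := h u hu hh
  exact ⟨l, hl, hT.sent_mono hij hb⟩

theorem verifyPoa_of_votersFor {i : ℕ} {v : V} {X : R} {k : ℕ} {B : Block U R O C}
    (h : Fintype.card V - P.p ≤ (((T.state i).val v).votersFor X k (some B)).card) :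
    (T.state i).verifyPoa P X k B :=
  ⟨_, h, fun _ hu hh => hT.votersFor_spec hu hh⟩

theorem verifyPoa_supportedBy {i : ℕ} {X : R} {k : ℕ} {B : Block U R O C}
    (h : (T.state i).verifyPoa P X k B) :
    ∀ tx ∈ B, T.SupportedBy P (Fintype.card V - P.p) X tx i := by
  obtain ⟨Q, hQ, h⟩ := h
  refine fun tx ht => ⟨Q, hQ, fun u hu hh => ?_⟩
  obtain ⟨b, hb⟩ := h u hu hh
  exact (hT.vote_block_eq hb).2 tx ht

theorem votersFor_supportedBy {i : ℕ} {v : V} {m : ℕ} {X : R} {k : ℕ} {B : Block U R O C}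
    (h : m ≤ (((T.state i).val v).votersFor X k (some B)).card) :
    ∀ tx ∈ B, T.SupportedBy P m X tx i := by
  refine fun tx ht => ⟨_, h, fun u hu hh => ?_⟩
  obtain ⟨b, hb⟩ := hT.votersFor_spec hu hh
  exact (hT.vote_block_eq hb).2 tx ht

theorem fallbackBlock_supportedBy {i : ℕ} {v : V} {m : ℕ} {X : R} {k : ℕ} :
    ∀ tx ∈ ((T.state i).val v).fallbackBlock X k m, T.SupportedBy P m X tx i := by
  intro tx ht
  simp only [VState.fallbackBlock, Finset.mem_filter] at ht
  refine ⟨_, ht.2, fun u hu hh => ?_⟩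
  simp only [VState.fallbackVoters, Finset.mem_filter, Finset.mem_univ, true_and] at hu
  obtain ⟨w, b, hu, hb⟩ := hu
  exact hT.vote_fallback (hT.rcvd_sent hu hh) tx hb

theorem pobVoters_lockedBy {i : ℕ} {v : V} {m : ℕ} {tx : Tx U R O C}
    (h : m ≤ (((T.state i).val v).pobVoters tx).card) : T.LockedBy P m tx i := by
  refine ⟨_, h, fun u hu hh => ?_⟩
  simp only [VState.pobVoters, Finset.mem_filter, Finset.mem_univ, true_and] at hu
  obtain ⟨l, hl, hu⟩ := hu
  exact hT.pobVote_fpLocked (hT.rcvd_sent hu hh)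

theorem verifyPob_lockedBy {i : ℕ} {tx : Tx U R O C} (h : (T.state i).verifyPob P tx) :
    T.LockedBy P (Fintype.card V - P.p) tx i := by
  obtain ⟨Q, hQ, h⟩ := h
  refine ⟨Q, hQ, fun u hu hh => ?_⟩
  obtain ⟨l, hl, h⟩ := h u hu hh
  exact hT.pobVote_fpLocked h

/-- Blocks on the slow path consist of supported transactions. -/
theorem slow_supportedBy {i : ℕ} {v : V} {X : R} {k : ℕ} {B : Block U R O C}
    (h : (((T.state i).val v).ra X).slow k = SlowPhase.candidate B ∨
      (((T.state i).val v).ra X).slow k = SlowPhase.fallback B) :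
    ∀ tx ∈ B, T.SupportedBy P (Fintype.card V - P.p - 2 * P.f) X tx i := by
  intro tx ht
  induction i with
  | zero => rw [hT.initial] at h; simp [Sys.initial] at h
  | succ i ih =>
    refine hT.supportedBy_mono (Nat.le_succ i) ?_
    rw [hT.step i] at h
    rcases h with h | h
    · rcases (reactiveActor_step (hT.enabled i) _ _).slow_candidate_step h with h | ⟨-, -, h⟩
      · exact ih (Or.inl h)
      · exact hT.votersFor_supportedBy h tx ht
    · rcases (reactiveActor_step (hT.enabled i) _ _).slow_fallback_step h with h | ⟨-, rfl, -⟩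
      · exact ih (Or.inr h)
      -- The fallback threshold `n - 2f` is at least `n - p - 2f`.
      · exact (hT.fallbackBlock_supportedBy tx ht).of_le (by omega)

theorem qcProp_spec {i : ℕ} {v : V} {X : R} {k : ℕ} {B : Block U R O C}
    (h : (((T.state i).val v).ra X).qcProp k = some B) :
    ∀ tx ∈ B, T.SupportedBy P (Fintype.card V - P.p - 2 * P.f) X tx i ∧
      (tx.IsUARA → lockOf ((T.state i).val v).spLocked tx = some tx) := by
  intro tx ht
  induction i with
  | zero => rw [hT.initial] at h; simp [Sys.initial] at h
  | succ i ih =>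
    rw [hT.step i] at h
    suffices h : T.SupportedBy P (Fintype.card V - P.p - 2 * P.f) X tx i ∧
      (tx.IsUARA → lockOf ((T.state i).val v).spLocked tx = some tx) from
      ⟨hT.supportedBy_mono (Nat.le_succ i) h.1,
        fun hu => hT.lockOf_spLocked_mono (Nat.le_succ i) (h.2 hu)⟩
    rcases (reactiveActor_step (hT.enabled i) _ _).qcProp_step h with h | ⟨h, hs⟩ | ⟨B', h', -, rfl⟩
    · exact ih h
    · exact ⟨hT.slow_supportedBy (Or.inl h) tx ht, hs tx ht⟩
    · rw [Finset.mem_filter] at ht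
      refine ⟨hT.slow_supportedBy (Or.inr h') tx ht.1, fun hu => ?_⟩
      rcases ht.2 with hr | ⟨-, hs⟩
      · cases tx <;> simp_all [Tx.IsRARA, Tx.IsUARA]
      · exact hs

/-- Since `n - 3f` is positive, Quorum Validity yields an honest proposer whose proposal contains
`tx`, and what is known of proposals applies to it. -/
theorem qcDec_spec (hP : P.Valid) {i : ℕ} {v : V} (hv : v ∈ P.honest) {X : R} {k : ℕ} {B : Block U
    R O C}
    (h : (((T.state i).val v).ra X).qcDec k = some B) {tx : Tx U R O C} (ht : tx ∈ B) :
    T.SupportedBy P (Fintype.card V - P.p - 2 * P.f) X tx i ∧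
      (tx.IsUARA → ∃ u ∈ P.honest, lockOf ((T.state i).val u).spLocked tx = some tx) := by
  have hq := (hT.quorumConsensus X k).validity_quorum v hv i B tx h ht
  have hr := hP.resilience
  obtain ⟨u, hu⟩ := Finset.card_pos.1 (show 0 < _ from lt_of_lt_of_le (by omega) hq)
  rw [Finset.mem_filter] at hu
  obtain ⟨hu, B', hB', ht'⟩ := hu
  obtain ⟨h1, h2⟩ := hT.qcProp_spec hB' tx ht'
  exact ⟨h1, fun h => ⟨u, hu, h2 h⟩⟩

end Trace.IsExecution

/-! ### Uniqueness of decisions. -/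

/-- `tx` is the decided transaction of its slot. -/
def Trace.Settled (T : Trace V U R O C S) (P : Sys V U R O C S) (tx : Tx U R O C) (i : ℕ) : Prop :=
  T.LockedBy P (Fintype.card V - P.p) tx i ∨
    ∃ v ∈ P.honest, ∃ l, tx.slot = some l ∧ ((T.state i).val v).taDec l = some (some tx)

/-- The block `B` may be decided by `v` in instance `k` of `X`. -/
def Trace.Decides (T : Trace V U R O C S) (P : Sys V U R O C S) (v : V) (X : R) (k : ℕ)
    (B : Block U R O C) (i : ℕ) : Prop :=
  (T.state i).verifyPoa P X k B ∨ ∃ B₀, (((T.state i).val v).ra X).qcDec k = some B₀ ∧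
    (∀ tx ∈ B₀, tx.IsUARA → ∀ l, tx.slot = some l → ((T.state i).val v).taDec l ≠ none) ∧
    B = B₀.filter fun tx => ∀ l, tx.slot = some l → ((T.state i).val v).taDec l = some (some tx)

namespace Trace.IsExecution

variable (hP : P.Valid) (hT : T.IsExecution P)

include hP hT

/-- The two thresholds add up to `2n - 2p - 2f`, which is at least `n + f + 1` precisely because of
the resilience bound. A common honest validator holds a single FP-lock for the slot. -/
theorem locked_unique {i j : ℕ} {tx tx' : Tx U R O C} {l : U × ℕ}
    (hs : tx.slot = some l) (hs' : tx'.slot = some l)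
    (h : T.LockedBy P (Fintype.card V - P.p) tx i)
    (h' : T.LockedBy P (Fintype.card V - P.p - 2 * P.f) tx' j) : tx = tx' := by
  obtain ⟨Q, hQ, h⟩ := h
  obtain ⟨Q', hQ', h'⟩ := h'
  have hr := hP.resilience
  obtain ⟨u, hu, h1, h2⟩ := hP.honest_inter (Q₁ := Q) (Q₂ := Q') (by omega)
  exact hT.fpLocked_unique hs hs' (h u h1 hu) (h' u h2 hu)

theorem exists_locked {m i : ℕ} {tx : Tx U R O C} (hm : P.f + 1 ≤ m) (h : T.LockedBy P m tx i) :
    ∃ u ∈ P.honest, lockOf ((T.state i).val u).fpLocked tx = some tx := by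
  obtain ⟨Q, hQ, h⟩ := h
  obtain ⟨u, hu, h1⟩ := hP.exists_honest (hm.trans hQ)
  exact ⟨u, hu, h u h1 hu⟩

/-- Each origin of an SP-lock brings such a quorum: a slow-path block has supporters, a broadcast
proposal has that many votes, and a block of Quorum Consensus was proposed by an honest validator
out of supported transactions. -/
theorem spLocked_lockedBy {i : ℕ} {v : V} {l : U × ℕ} {tx : Tx U R O C}
    (h : ((T.state i).val v).spLocked l = some tx) :
    T.LockedBy P (Fintype.card V - P.p - 2 * P.f) tx i := by
  induction i generalizing v l with
  | zero => rw [hT.initial] at h; simp [Sys.initial] at h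
  | succ i ih =>
    refine hT.lockedBy_mono (Nat.le_succ i) ?_
    rw [hT.step i] at h
    rcases (userActor_step (hT.enabled i) _).spLocked_step h with h | ⟨hv, hl, ⟨X, k, B, hu, ht,
        h⟩ | h | ⟨X, k, B, hu, h, ht⟩⟩
    · exact ih h
    · exact (hT.slow_supportedBy h tx ht).lockedBy hu
    · exact hT.pobVoters_lockedBy h
    · exact (hT.qcDec_spec hP hv h ht).1.lockedBy hu

/-- A decided transaction has at least one honest proposer, since `n - 3f > 0`, and honest
validators propose only what they have SP-locked. -/
theorem taDec_spLocked {i : ℕ} {v : V} (hv : v ∈ P.honest) {l : U × ℕ} {tx : Tx U R O C}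
    (h : ((T.state i).val v).taDec l = some (some tx)) :
    tx.slot = some l ∧ T.LockedBy P (Fintype.card V - P.p - 2 * P.f) tx i := by
  have hq := (hT.transactionAgreement l).validity_quorum v hv i tx h
  have hr := hP.resilience
  obtain ⟨u, hu⟩ := Finset.card_pos.1 (show 0 < _ from lt_of_lt_of_le (by omega) hq)
  rw [Finset.mem_filter] at hu
  have h1 := hT.taProp_spLocked hu.2
  exact ⟨hT.spLocked_slot h1, hT.spLocked_lockedBy hP h1⟩

theorem Settled.lockedBy {i : ℕ} {tx : Tx U R O C} (h : T.Settled P tx i) :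
    T.LockedBy P (Fintype.card V - P.p - 2 * P.f) tx i := by
  rcases h with h | ⟨v, hv, l, hl, h⟩
  · exact h.of_le (by omega)
  · exact (hT.taDec_spLocked hP hv h).2

theorem Settled.signed {i : ℕ} {tx : Tx U R O C} (h : T.Settled P tx i) :
    tx ∈ (T.state i).signed := by
  have hr := hP.resilience
  obtain ⟨u, -, hu⟩ := hT.exists_locked hP (by omega) (Settled.lockedBy hP hT h)
  exact hT.locked_signed hu

/-- At most one transaction of a slot is decided. -/
theorem Settled.unique {i j : ℕ} {tx tx' : Tx U R O C} {l : U × ℕ}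
    (hs : tx.slot = some l) (hs' : tx'.slot = some l)
    (h : T.Settled P tx i) (h' : T.Settled P tx' j) : tx = tx' := by
  have hw := Settled.lockedBy hP hT h
  have hw' := Settled.lockedBy hP hT h'
  -- A fast decision excludes every rival with `n - p - 2f` locks, and any settled transaction has
  -- that many; two decisions of Transaction Agreement are compared by its own agreement.
  rcases h with h | ⟨v, hv, m, hm, h⟩
  · exact hT.locked_unique hP hs hs' h hw'
  · rcases h' with h' | ⟨v', hv', m', hm', h'⟩
    · exact (hT.locked_unique hP hs' hs h' hw).symm
    · rw [hs] at hm
      rw [hs'] at hm'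
      cases hm; cases hm'
      exact Option.some.inj ((hT.transactionAgreement l).agreement v hv v' hv' i j _ _ h h')

/-- Transaction Agreement decides what the fast path has decided. -/
theorem taDec_of_locked {i j : ℕ} {v : V} (hv : v ∈ P.honest) {l : U × ℕ} {tx : Tx U R O C}
    {d : Option (Tx U R O C)} (hs : tx.slot = some l)
    (h : T.LockedBy P (Fintype.card V - P.p) tx i)
    (hd : ((T.state j).val v).taDec l = some d) : d = some tx := by
  -- Every honest proposal is SP-locked, hence has `n - p - 2f` FP-locks behind it, and so cannot
  -- differ from `tx`.
  refine (hT.transactionAgreement l).validity_all v hv j d tx hd fun u _ n y hy => ?_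
  have h1 := hT.taProp_spLocked hy
  exact (hT.locked_unique hP hs (hT.spLocked_slot h1) h (hT.spLocked_lockedBy hP h1)).symm

theorem verifyPoa_unique {i j : ℕ} {X : R} {k : ℕ} {B B' : Block U R O C}
    (h : (T.state i).verifyPoa P X k B) (h' : (T.state j).verifyPoa P X k B') : B = B' := by
  obtain ⟨Q, hQ, h⟩ := hT.verifyPoa_mono (le_max_left i j) h
  obtain ⟨Q', hQ', h'⟩ := hT.verifyPoa_mono (le_max_right i j) h'
  have hr := hP.resilience
  obtain ⟨u, hu, h1, h2⟩ := hP.honest_inter (Q₁ := Q) (Q₂ := Q') (by omega)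
  obtain ⟨b, hb⟩ := h u h1 hu
  obtain ⟨b', hb'⟩ := h' u h2 hu
  exact Option.some.inj (hT.vote_unique hb hb').1

/-- Among the `n - f` validators heard from, at least `n - p - f` belong to the certificate and at
least `n - p - 2f` of these are honest. The only vote of such a validator is the one for `B`. -/
theorem verifyPoa_votersFor {i j : ℕ} {v : V} {X : R} {k : ℕ} {B : Block U R O C}
    (h : (T.state i).verifyPoa P X k B)
    (hv : Fintype.card V - P.f ≤ (((T.state j).val v).voters X k).card) :
    Fintype.card V - P.p - 2 * P.f ≤ (((T.state j).val v).votersFor X k (some B)).card := by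
  obtain ⟨Q, hQ, h⟩ := h
  have hsub : (Q ∩ ((T.state j).val v).voters X k) ∩ P.honest ⊆
      ((T.state j).val v).votersFor X k (some B) := by
    intro u hu
    simp only [Finset.mem_inter] at hu
    obtain ⟨⟨hu1, hu2⟩, hu3⟩ := hu
    simp only [VState.voters, Finset.mem_filter, Finset.mem_univ, true_and] at hu2
    obtain ⟨w, b, hw⟩ := hu2
    obtain ⟨b', hb'⟩ := h u hu1 hu3
    have h1 := hT.sent_mono (le_max_left i j) hb'
    have h2 := hT.sent_mono (le_max_right i j) (hT.rcvd_sent hw hu3)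
    obtain ⟨rfl, rfl⟩ := hT.vote_unique h1 h2
    simp only [VState.votersFor, Finset.mem_filter, Finset.mem_univ, true_and]
    exact ⟨_, hw⟩
  have h1 := Finset.card_le_card hsub
  have h2 := Finset.card_union_add_card_inter Q (((T.state j).val v).voters X k)
  have h3 := Finset.card_union_add_card_inter (Q ∩ ((T.state j).val v).voters X k) P.honest
  have h4 := Finset.card_le_univ (Q ∪ ((T.state j).val v).voters X k)
  have h5 := Finset.card_le_univ ((Q ∩ ((T.state j).val v).voters X k) ∪ P.honest)
  have h6 := hP.card_honest
  have hr := hP.resilience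
  omega

/-- Only a block decided on the fast path can be a candidate of the slow path. -/
theorem votersFor_unique {i j : ℕ} {v : V} {X : R} {k : ℕ} {B B' : Block U R O C}
    (h : (T.state i).verifyPoa P X k B)
    (h' : Fintype.card V - P.p - 2 * P.f ≤ (((T.state j).val v).votersFor X k (some B')).card) :
    B' = B := by
  obtain ⟨Q, hQ, h⟩ := h
  have hr := hP.resilience
  obtain ⟨u, hu, h1, h2⟩ := hP.honest_inter (Q₁ := Q)
    (Q₂ := ((T.state j).val v).votersFor X k (some B')) (by omega)
  obtain ⟨b, hb⟩ := h u h1 hu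
  obtain ⟨b', hb'⟩ := hT.votersFor_spec h2 hu
  have h1 := hT.sent_mono (le_max_left i j) hb
  have h2 := hT.sent_mono (le_max_right i j) hb'
  exact (Option.some.inj (hT.vote_unique h1 h2).1).symm

/-- Once a certificate for `B` exists anywhere in the execution, the slow path has no freedom left,
neither before nor after that point. The three claims are proved together because each phase is
reached from another one. -/
theorem slow_of_verifyPoa {i j : ℕ} {v : V} {X : R} {k : ℕ} {B : Block U R O C}
    (h : (T.state i).verifyPoa P X k B) :
    (∀ B', (((T.state j).val v).ra X).slow k = SlowPhase.candidate B' → B' = B) ∧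
    (∀ B', (((T.state j).val v).ra X).slow k ≠ SlowPhase.fallback B') ∧
    ∀ B', (((T.state j).val v).ra X).qcProp k = some B' → B' = B := by
  induction j with
  | zero => rw [hT.initial]; simp [Sys.initial]
  | succ j ih =>
    rw [hT.step j]
    have he := hT.enabled j
    refine ⟨fun B' h' => ?_, fun B' h' => ?_, fun B' h' => ?_⟩
    · rcases (reactiveActor_step he _ _).slow_candidate_step h' with h' | ⟨-, -, h'⟩
      · exact ih.1 B' h'
      · exact hT.votersFor_unique hP h h'
    · rcases (reactiveActor_step he _ _).slow_fallback_step h' with h' | ⟨-, -, ⟨h1, h2⟩ | ⟨B₁,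
        h1, tx, ht, h2, h3⟩⟩
      · exact ih.2.1 B' h'
      · exact absurd (hT.verifyPoa_votersFor hP h h1) (not_le.2 (h2 B))
      -- The candidate would have to fail because a rival `tx'` holds the SP-lock of the slot. That
      -- rival has `n - p - 2f` FP-locks against the `n - p` of `tx`, so it is `tx` itself.
      · obtain rfl := ih.1 B₁ h1
        obtain ⟨tx', htx'⟩ := Option.ne_none_iff_exists'.1 h2
        obtain ⟨l, hl, hs⟩ := lockOf_eq_some.1 htx'
        have hr : tx.IsUARA := by
          have := hT.verifyPoa_supportedBy h tx ht
          obtain ⟨Q, hQ, h⟩ := this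
          have hr := hP.resilience
          obtain ⟨u, hu, h1⟩ := hP.exists_honest (Q := Q) (by omega)
          rcases Tx.isRARA_or_isUARA (h u h1 hu).recv with hr | hr
          · rw [hr.slot_eq] at hl; simp at hl
          · exact hr
        have := hT.locked_unique hP hl (hT.spLocked_slot hs)
          ((hT.verifyPoa_supportedBy h tx ht).lockedBy hr) (hT.spLocked_lockedBy hP hs)
        subst this
        exact h3 htx'
    · rcases (reactiveActor_step he _ _).qcProp_step h' with h' | ⟨h', -⟩ | ⟨B₁, h', -⟩
      · exact ih.2.2 B' h'
      · exact ih.1 B' h'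
      · exact absurd h' (ih.2.1 B₁)

/-- All honest proposals are `B`. Anything decided stems from an honest proposal, which gives one
inclusion; what is in all honest proposals is decided, which gives the other. -/
theorem qcDec_of_verifyPoa {i j : ℕ} {v : V} (hv : v ∈ P.honest) {X : R} {k : ℕ}
    {B B' : Block U R O C} (h : (T.state i).verifyPoa P X k B)
    (h' : (((T.state j).val v).ra X).qcDec k = some B') : B' = B := by
  ext tx
  constructor
  · intro ht
    have hq := (hT.quorumConsensus X k).validity_quorum v hv j B' tx h' ht
    have hr := hP.resilience
    obtain ⟨u, hu⟩ := Finset.card_pos.1 (show 0 < _ from lt_of_lt_of_le (by omega) hq)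
    rw [Finset.mem_filter] at hu
    obtain ⟨-, B₁, hB₁, ht⟩ := hu
    exact (hT.slow_of_verifyPoa hP h).2.2 B₁ hB₁ ▸ ht
  · intro ht
    exact (hT.quorumConsensus X k).validity_all v hv j B' tx h' fun u _ n B₁ hB₁ =>
      (hT.slow_of_verifyPoa hP h).2.2 B₁ hB₁ ▸ ht

theorem SupportedBy.recv {m i : ℕ} {X : R} {tx : Tx U R O C} (hm : P.f + 1 ≤ m)
    (h : T.SupportedBy P m X tx i) : tx.recv = some X ∧ T.EmittedBefore P tx i := by
  obtain ⟨Q, hQ, h⟩ := h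
  obtain ⟨u, hu, h1⟩ := hP.exists_honest (hm.trans hQ)
  exact ⟨(h u h1 hu).recv, (h u h1 hu).emitted⟩

/-- The transactions of a decided block. -/
theorem Decides.spec {i : ℕ} {v : V} (hv : v ∈ P.honest) {X : R} {k : ℕ}
    {B : Block U R O C} (h : T.Decides P v X k B i) {tx : Tx U R O C} (ht : tx ∈ B) :
    tx.recv = some X ∧ T.EmittedBefore P tx i ∧ (tx.IsUARA → T.Settled P tx i) := by
  have hr := hP.resilience
  rcases h with h | ⟨B₀, h1, h2, rfl⟩
  · have hs := hT.verifyPoa_supportedBy h tx ht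
    obtain ⟨h3, h4⟩ := SupportedBy.recv hP hT (by omega) hs
    exact ⟨h3, h4, fun hu => Or.inl (hs.lockedBy hu)⟩
  · rw [Finset.mem_filter] at ht
    obtain ⟨h3, h4⟩ := SupportedBy.recv hP hT (by omega) (hT.qcDec_spec hP hv h1 ht.1).1
    refine ⟨h3, h4, fun hu => Or.inr ⟨v, hv, ?_⟩⟩
    obtain ⟨l, hl⟩ := hu.exists_slot
    exact ⟨l, hl, ht.2 l hl⟩

/-- On the slow path Quorum Consensus returns `B`, and the final filter removes nothing, because
Transaction Agreement is bound to confirm each UA-RA transaction with `n - p` FP-locks. -/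
theorem Decides.eq_of_verifyPoa {i j : ℕ} {v : V} (hv : v ∈ P.honest) {X : R} {k : ℕ}
    {B B' : Block U R O C} (h : (T.state i).verifyPoa P X k B) (h' : T.Decides P v X k B' j) :
    B' = B := by
  rcases h' with h' | ⟨B₀, h1, h2, rfl⟩
  · exact hT.verifyPoa_unique hP h' h
  · obtain rfl := hT.qcDec_of_verifyPoa hP hv h h1
    refine Finset.filter_true_of_mem fun tx ht l hl => ?_
    have hs := hT.verifyPoa_supportedBy h tx ht
    have hr := hP.resilience
    have hu : tx.IsUARA := by
      rcases Tx.isRARA_or_isUARA (SupportedBy.recv hP hT (by omega) hs).1 with hr | hr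
      · rw [hr.slot_eq] at hl; simp at hl
      · exact hr
    obtain ⟨d, hd⟩ := Option.ne_none_iff_exists'.1 (h2 tx ht hu l hl)
    rw [hd, hT.taDec_of_locked hP hv hl (hs.lockedBy hu) hd]

/-- Honest validators decide the same block in an instance. -/
theorem Decides.unique {i j : ℕ} {v w : V} (hv : v ∈ P.honest) (hw : w ∈ P.honest) {X : R} {k : ℕ}
    {B B' : Block U R O C} (h : T.Decides P v X k B i) (h' : T.Decides P w X k B' j) : B = B' := by
  have hd := h
  have hd' := h'
  rcases h with h | ⟨B₀, h1, h2, rfl⟩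
  · exact (Decides.eq_of_verifyPoa hP hT hw h hd').symm
  · rcases h' with h' | ⟨B₁, h1', h2', rfl⟩
    · exact Decides.eq_of_verifyPoa hP hT hv h' hd
    · obtain rfl := (hT.quorumConsensus X k).agreement v hv w hw i j _ _ h1 h1'
      -- Both validators filter the same block, and for each slot in it both have a decision of
      -- Transaction Agreement, hence the same one.
      refine Finset.filter_congr fun tx ht => ?_
      have hr := hP.resilience
      rcases Tx.isRARA_or_isUARA (SupportedBy.recv hP hT (by omega)
        (hT.qcDec_spec hP hv h1 ht).1).1 with hr | hu
      · simp [hr.slot_eq]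
      · refine forall₂_congr fun l hl => ?_
        obtain ⟨d, hd⟩ := Option.ne_none_iff_exists'.1 (h2 tx ht hu l hl)
        obtain ⟨d', hd'⟩ := Option.ne_none_iff_exists'.1 (h2' tx ht hu l hl)
        rw [hd, hd', (hT.transactionAgreement l).agreement v hv w hw i j _ _ hd hd']

end Trace.IsExecution

/-! ### The common log and the replicated state machine. -/

noncomputable section

/-- The replicated state machine at `X`: the executed transactions, the state, and the owned objects
after processing one more transaction. -/
def Sys.runStep (P : Sys V U R O C S) (X : R) (r : Block U R O C × S × Finset O)
    (tx : Tx U R O C) : Block U R O C × S × Finset O :=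
  if tx ∈ r.1 then r
  else (insert tx r.1, (P.execCall X r.2.1 r.2.2 tx).state,
    (release (U := U) X (r.2.2 ∪ (P.execCall X r.2.1 r.2.2 tx).gained)
      (P.execCall X r.2.1 r.2.2 tx).out).1)

def Sys.run (P : Sys V U R O C S) (X : R) (L : List (Tx U R O C)) :
    Block U R O C × S × Finset O :=
  L.foldl (P.runStep X) (∅, P.initState X, P.initObjs X)

theorem Sys.run_append (P : Sys V U R O C S) (X : R) (L : List (Tx U R O C)) (tx : Tx U R O C) :
    P.run X (L ++ [tx]) = P.runStep X (P.run X L) tx := by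
  simp [Sys.run]

theorem Sys.mem_run (P : Sys V U R O C S) (X : R) (L : List (Tx U R O C)) (tx : Tx U R O C) :
    tx ∈ (P.run X L).1 ↔ tx ∈ L := by
  induction L using List.reverseRecOn with
  | nil => simp [Sys.run]
  | append_singleton L a ih =>
    rw [Sys.run_append, Sys.runStep]
    split_ifs with h
    · rw [ih]; simp only [List.mem_append, List.mem_singleton]
      constructor
      · exact Or.inl
      · rintro (h' | rfl)
        · exact h'
        · exact ih.1 h
    · simp only [Finset.mem_insert, ih, List.mem_append, List.mem_singleton]
      tauto

/-- The transaction processed at the entity of `v` for `X`, if any. -/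
def Action.processed (a : Action V U R O C) (v : V) (X : R) : List (Tx U R O C) :=
  match a with
  | .exec v' X' tx => if v' = v ∧ X' = X then [tx] else []
  | _ => []

/-- The transactions processed at the entity of `v` for `X` before step `i`. -/
def Trace.processed (T : Trace V U R O C S) (v : V) (X : R) : ℕ → List (Tx U R O C)
  | 0 => []
  | i + 1 => T.processed v X i ++ (T.act i).processed v X

/-- The block decided in instance `k` of `X`. -/
def Trace.decided (T : Trace V U R O C S) (P : Sys V U R O C S) (X : R) (k : ℕ) : Block U R O C :=
  -- By `decided_eq` the choice is irrelevant; the empty block only fills in for undecided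
  -- instances.
  if h : ∃ B, ∃ v ∈ P.honest, ∃ i, T.Decides P v X k B i then h.choose else ∅

/-- The transactions of the first `k` instances of `X` in their order. -/
def Trace.log (T : Trace V U R O C S) (P : Sys V U R O C S) (X : R) (k : ℕ) : List (Tx U R O C) :=
  (List.range k).flatMap fun j => P.order (T.decided P X j)

theorem Trace.log_succ (X : R) (k : ℕ) :
    T.log P X (k + 1) = T.log P X k ++ P.order (T.decided P X k) := by
  simp [Trace.log, List.range_succ]

theorem Trace.log_prefix (X : R) {k k' : ℕ} (h : k ≤ k') : T.log P X k <+: T.log P X k' := by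
  induction h with
  | refl => exact List.prefix_rfl
  | step _ ih => rw [Trace.log_succ]; exact ih.trans (List.prefix_append _ _)

theorem Trace.processed_exec {i : ℕ} {v : V} {X : R} {tx : Tx U R O C}
    (h : T.act i = Action.exec v X tx) :
    T.processed v X (i + 1) = T.processed v X i ++ [tx] := by
  simp [Trace.processed, h, Action.processed]

theorem Trace.processed_of_ne {i : ℕ} {v : V} {X : R}
    (h : ∀ tx, T.act i ≠ Action.exec v X tx) :
    T.processed v X (i + 1) = T.processed v X i := by
  simp only [Trace.processed]
  generalize T.act i = a at h
  cases a <;> simp only [Action.processed, List.append_nil]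
  rw [if_neg, List.append_nil]
  rintro ⟨rfl, rfl⟩
  exact h _ rfl

theorem Trace.processed_prefix {v : V} {X : R} {i j : ℕ} (hij : i ≤ j) :
    T.processed v X i <+: T.processed v X j := by
  induction hij with
  | refl => exact List.prefix_rfl
  | step _ ih => exact ih.trans (List.prefix_append _ _)

/-- Turns positions in a list back into steps: the processed list grows by one entry per processing
step, so each of its nonempty prefixes is completed at a definite step. -/
theorem Trace.exists_exec_of_prefix {v : V} {X : R} {i : ℕ} {L : List (Tx U R O C)}
    {tx : Tx U R O C} (h : L ++ [tx] <+: T.processed v X i) :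
    ∃ j, j < i ∧ T.processed v X j = L ∧ T.act j = Action.exec v X tx := by
  induction i with
  | zero => simp [Trace.processed] at h
  | succ i ih =>
    by_cases he : ∃ tx', T.act i = Action.exec v X tx'
    · obtain ⟨tx', he⟩ := he
      rw [Trace.processed_exec he, List.prefix_concat_iff] at h
      rcases h with h | h
      · obtain ⟨h1, h2⟩ := List.append_inj' h rfl
        cases h2
        exact ⟨i, Nat.lt_succ_self i, h1.symm, he⟩
      · obtain ⟨j, hj, h⟩ := ih h
        exact ⟨j, hj.trans (Nat.lt_succ_self i), h⟩
    · push Not at he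
      rw [Trace.processed_of_ne he] at h
      obtain ⟨j, hj, h⟩ := ih h
      exact ⟨j, hj.trans (Nat.lt_succ_self i), h⟩

end

/-! ### Entities of one reactive actor follow the same log. -/

namespace Trace.IsExecution

variable (hP : P.Valid) (hT : T.IsExecution P)

include hP hT in
theorem decided_eq {i : ℕ} {v : V} (hv : v ∈ P.honest) {X : R} {k : ℕ} {B : Block U R O C}
    (h : T.Decides P v X k B i) : T.decided P X k = B := by
  have hex : ∃ B, ∃ v ∈ P.honest, ∃ i, T.Decides P v X k B i := ⟨B, v, hv, i, h⟩
  rw [Trace.decided, dif_pos hex]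
  obtain ⟨w, hw, j, h'⟩ := hex.choose_spec
  exact Decides.unique hP hT hw hv h' h

include hT in
-- Only processing steps change these three components, and they do so deterministically. Hence
-- equal processed lists mean equal executed sets, states and objects.
theorem run_processed (i : ℕ) (v : V) (X : R) :
    ((((T.state i).val v).ra X).executed, (((T.state i).val v).ra X).state,
      (((T.state i).val v).ra X).objs) = P.run X (T.processed v X i) := by
  induction i with
  | zero => rw [hT.initial]; rfl
  | succ i ih =>
    by_cases he : ∃ tx, T.act i = Action.exec v X tx
    · obtain ⟨tx, he⟩ := he
      rw [Trace.processed_exec he, Sys.run_append, ← ih, hT.step i, he, Sys.runStep]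
      simp only [perform, State.setVal_val_self, VState.execute_eq, true_and]
      split_ifs <;> simp_all [VState.outgoing]
    · push Not at he
      obtain ⟨h1, h2, h3⟩ := exec_frame (hT.enabled i) he
      rw [Trace.processed_of_ne he, ← ih, hT.step i, h1, h2, h3]

include hT in
theorem mem_executed {i : ℕ} {v : V} {X : R} {tx : Tx U R O C} :
    tx ∈ (((T.state i).val v).ra X).executed ↔ tx ∈ T.processed v X i := by
  rw [← Sys.mem_run P X, ← hT.run_processed]

include hT in
theorem control_decides {i : ℕ} {v : V} {X : R} {k : ℕ} {B : Block U R O C}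
    (h : (((Fintype.card V - P.p ≤ (((T.state i).val v).votersFor X k (some B)).card ∨
          (T.state i).verifyPoa P X k B) ∧
          Msg.proof X k B ∈ ((perform P (T.time i) (T.state i) (T.act i)).val v).sent) ∨
        ∃ B₀, (((T.state i).val v).ra X).qcDec k = some B₀ ∧
          (∀ tx ∈ B₀, tx.IsUARA → ∀ l, tx.slot = some l → ((T.state i).val v).taDec l ≠ none) ∧
          B = B₀.filter fun tx => ∀ l, tx.slot = some l →
            ((T.state i).val v).taDec l = some (some tx))) :
    T.Decides P v X k B i := by
  rcases h with ⟨h | h, -⟩ | h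
  · exact Or.inl (hT.verifyPoa_of_votersFor h)
  · exact Or.inl h
  · exact Or.inr h

include hP hT in
theorem queue_spec {i : ℕ} {v : V} {X : R} {tx : Tx U R O C}
    (h : tx ∈ (((T.state i).val v).ra X).queue) :
    tx.recv = some X ∧ T.EmittedBefore P tx i ∧ (tx.IsUARA → T.Settled P tx i) := by
  induction i with
  | zero => rw [hT.initial] at h; simp [Sys.initial] at h
  | succ i ih =>
    suffices h : tx.recv = some X ∧ T.EmittedBefore P tx i ∧ (tx.IsUARA → T.Settled P tx i) by
      refine ⟨h.1, h.2.1.mono (Nat.le_succ i), fun hu => ?_⟩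
      rcases h.2.2 hu with h | ⟨w, hw, l, hl, h⟩
      · exact Or.inl (hT.lockedBy_mono (Nat.le_succ i) h)
      · exact Or.inr ⟨w, hw, l, hl, hT.taDec_mono (Nat.le_succ i) h⟩
    rw [hT.step i] at h
    rcases control_step (hT.enabled i) (w := v) (X := X) with hc | hc | hc | hc | hc
    · exact ih (hc.2.2.2.1 ▸ h)
    · exact ih (hc.2.2.2.2.1 ▸ h)
    · rw [hc.2.2.2.2.2.2.1] at h; simp at h
    · obtain ⟨hv, -, -, -, -, -, -, B, hB, hd⟩ := hc
      rw [hB, hP.order_mem] at h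
      exact Decides.spec hP hT hv (hT.control_decides hd) h
    · obtain ⟨tx', -, -, -, -, hq, -⟩ := hc
      rw [hq] at h
      exact ih (List.mem_of_mem_tail h)

include hP hT in
-- The three clauses are the phases of an entity: not created, inside an undecided instance, and
-- working off a decided block. `log k` covers the instances below `k`, so in an undecided instance
-- the list is the log up to its number, and after the decision the queue supplies exactly the next
-- block.
theorem processed_log (i : ℕ) (v : V) (X : R) :
    (¬ (((T.state i).val v).ra X).active → (((T.state i).val v).ra X).inst = 0 ∧
      ¬ (((T.state i).val v).ra X).running ∧ (((T.state i).val v).ra X).queue = [] ∧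
      T.processed v X i = []) ∧
    ((((T.state i).val v).ra X).active → (((T.state i).val v).ra X).running →
      (((T.state i).val v).ra X).queue = [] ∧
      T.processed v X i = T.log P X (((T.state i).val v).ra X).inst) ∧
    ((((T.state i).val v).ra X).active → ¬ (((T.state i).val v).ra X).running →
      T.processed v X i ++ (((T.state i).val v).ra X).queue =
        T.log P X ((((T.state i).val v).ra X).inst + 1)) := by
  induction i with
  | zero => rw [hT.initial]; simp [Sys.initial, Trace.processed]
  | succ i ih =>
    obtain ⟨ih1, ih2, ih3⟩ := ih
    rw [hT.step i]
    rcases control_step (hT.enabled i) (w := v) (X := X) with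
      ⟨h1, h2, h3, h4, -, h5⟩ | ⟨h1, h2, h3, h4, h5, h6⟩ | ⟨h1, h2, h3, h4, h5, h6, h7, h8⟩ |
      ⟨hv, h1, h2, h3, h4, h5, h6, B, hB, hd⟩ | ⟨tx, h1, h2, h3, h4, h5, h6, h7, h8⟩
    · rw [h1, h2, h3, h4, Trace.processed_of_ne h5]
      exact ⟨ih1, ih2, ih3⟩
    · have hp : T.processed v X (i + 1) = T.processed v X i :=
        Trace.processed_of_ne fun tx h => by rw [h6] at h; cases h
      obtain ⟨i1, i2, i3, i4⟩ := ih1 h1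
      rw [hp, h3, h5, i3, i4]
      exact ⟨fun h => absurd h2 h, fun _ _ => ⟨rfl, by simp [Trace.log]⟩, fun _ h => absurd h4 h⟩
    · have hp : T.processed v X (i + 1) = T.processed v X i :=
        Trace.processed_of_ne fun tx h => by rw [h8] at h; cases h
      have i1 := ih3 h1 h2
      rw [h3, List.append_nil] at i1
      rw [hp, h5, h7, i1]
      exact ⟨fun h => absurd h4 h, fun _ _ => ⟨rfl, rfl⟩, fun _ h => absurd h6 h⟩
    · rw [Trace.processed_of_ne h6, hB, h4, (ih2 h1 h2).2]
      refine ⟨fun h => absurd h3 h, fun _ h => absurd h h5, fun _ _ => ?_⟩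
      rw [Trace.log_succ, decided_eq hP hT hv (hT.control_decides hd)]
    · have i1 := ih3 h2 h3
      rw [Trace.processed_exec h1, h5, h8]
      refine ⟨fun h => absurd h6 h, fun _ h => absurd h h7, fun _ _ => ?_⟩
      rw [← i1]
      cases hq : (((T.state i).val v).ra X).queue with
      | nil => rw [hq] at h4; simp at h4
      | cons a q => rw [hq] at h4; simp at h4; simp [h4]

include hP hT in
theorem processed_prefix_log (i : ℕ) (v : V) (X : R) :
    T.processed v X i <+: T.log P X ((((T.state i).val v).ra X).inst + 1) := by
  obtain ⟨h1, h2, h3⟩ := processed_log hP hT i v X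
  by_cases ha : (((T.state i).val v).ra X).active
  · by_cases hr : (((T.state i).val v).ra X).running
    · rw [(h2 ha hr).2]; exact Trace.log_prefix X (Nat.le_succ _)
    · rw [← h3 ha hr]; exact List.prefix_append _ _
  · rw [(h1 ha).2.2.2]; exact List.nil_prefix

include hP hT in
theorem log_prefix_processed {i : ℕ} {v : V} {X : R} {k : ℕ}
    (h : (((T.state i).val v).ra X).active) (hk : k ≤ (((T.state i).val v).ra X).inst)
    (hr : (((T.state i).val v).ra X).running) :
    T.log P X k <+: T.processed v X i := by
  rw [((processed_log hP hT i v X).2.1 h hr).2]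
  exact Trace.log_prefix X hk

/-- The entity for `X` at `v` runs all instances. -/
def Progresses (T : Trace V U R O C S) (v : V) (X : R) : Prop :=
  ∀ k, ∃ i, (((T.state i).val v).ra X).active ∧ (((T.state i).val v).ra X).running ∧
    (((T.state i).val v).ra X).inst = k

include hP hT in
/-- Entities for the same reactive actor process the same transactions in the same order. -/
theorem exec_sync {i : ℕ} {v w : V} {X : R} {tx : Tx U R O C} (hw : Progresses T w X)
    (h : T.act i = Action.exec v X tx) :
    ∃ j, T.act j = Action.exec w X tx ∧ T.processed w X j = T.processed v X i := by
  have h1 := processed_prefix_log hP hT (i + 1) v X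
  rw [Trace.processed_exec h] at h1
  -- Once `w` runs the instance after the one `v` is in, it has processed the log through the
  -- current instance of `v`, which includes this occurrence of `tx`.
  obtain ⟨j, ha, hr, hj⟩ := hw ((((T.state (i + 1)).val v).ra X).inst + 1)
  obtain ⟨n, -, h2, h3⟩ := Trace.exists_exec_of_prefix
    (h1.trans (log_prefix_processed hP hT ha hj.ge hr))
  exact ⟨n, h3, h2⟩

include hT in
theorem executes_iff {i : ℕ} {v : V} {X : R} {tx : Tx U R O C} :
    T.Executes v X tx i ↔ T.act i = Action.exec v X tx ∧ tx ∉ T.processed v X i := by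
  rw [Trace.Executes, hT.mem_executed]

include hP hT in
theorem executes_sync {i : ℕ} {v w : V} {X : R} {tx : Tx U R O C} (hw : Progresses T w X)
    (h : T.Executes v X tx i) :
    ∃ j, T.Executes w X tx j ∧ T.processed w X j = T.processed v X i ∧
      (((T.state j).val w).ra X).state = (((T.state i).val v).ra X).state ∧
      (((T.state j).val w).ra X).objs = (((T.state i).val v).ra X).objs := by
  rw [hT.executes_iff] at h
  obtain ⟨j, h1, h2⟩ := exec_sync hP hT hw h.1
  have e1 := hT.run_processed i v X
  have e2 := hT.run_processed j w X
  rw [h2, ← e1] at e2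
  simp only [Prod.mk.injEq] at e2
  exact ⟨j, hT.executes_iff.2 ⟨h1, h2 ▸ h.2⟩, h2, e2.2⟩

include hT in
-- An execution is the first occurrence in the processed list, which only grows.
theorem executes_unique {i j : ℕ} {v : V} {X : R} {tx : Tx U R O C}
    (h : T.Executes v X tx i) (h' : T.Executes v X tx j) : i = j := by
  rw [hT.executes_iff] at h h'
  have key : ∀ {i j : ℕ}, T.act i = Action.exec v X tx → tx ∉ T.processed v X j → ¬ i < j := by
    intro i j h h' hij
    refine h' ((Trace.processed_prefix (Nat.succ_le_of_lt hij)).subset ?_)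
    rw [Trace.processed_exec h]; simp
  exact le_antisymm (not_lt.1 (key h'.1 h.2)) (not_lt.1 (key h.1 h'.2))

include hP hT in
-- When `w` executes `tx₂` it has the same processed list as `v` had, and the execution of `tx₁` by
-- `v` is recorded in a prefix of this list.
theorem total_order {v w : V} {X : R} {tx₁ tx₂ : Tx U R O C} (hw : Progresses T w X)
    {i₁ i₂ : ℕ} (hi : i₁ < i₂) (h₁ : T.Executes v X tx₁ i₁) (h₂ : T.Executes v X tx₂ i₂) :
    ∃ j₁ j₂, j₁ < j₂ ∧ T.Executes w X tx₁ j₁ ∧ T.Executes w X tx₂ j₂ := by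
  obtain ⟨j₂, h3, h4, -⟩ := executes_sync hP hT hw h₂
  rw [hT.executes_iff] at h₁
  have h5 := Trace.processed_prefix (T := T) (v := v) (X := X) (Nat.succ_le_of_lt hi)
  rw [Nat.succ_eq_add_one, Trace.processed_exec h₁.1, ← h4] at h5
  obtain ⟨j₁, h6, h7, h8⟩ := Trace.exists_exec_of_prefix h5
  exact ⟨j₁, j₂, h6, hT.executes_iff.2 ⟨h8, h7 ▸ h₁.2⟩, h3⟩

include hP hT in
theorem executes_spec {i : ℕ} {v : V} {X : R} {tx : Tx U R O C} (h : T.Executes v X tx i) :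
    tx.recv = some X ∧ T.EmittedBefore P tx i ∧ (tx.IsUARA → T.Settled P tx i) := by
  have he := hT.enabled i
  rw [h.1] at he
  exact queue_spec hP hT (List.mem_of_mem_head? he.2.2.2)

end Trace.IsExecution

/-! ### Liveness tools: fairness, time and delivery. -/

theorem exists_forall_mem_finset {α : Type*} {φ : α → ℕ → Prop} (s : Finset α)
    (hm : ∀ a i j, i ≤ j → φ a i → φ a j) (h : ∀ a ∈ s, ∃ i, φ a i) : ∃ i, ∀ a ∈ s, φ a i := by
  choose! N hN using h
  exact ⟨s.sup N, fun a ha => hm a _ _ (Finset.le_sup ha) (hN a ha)⟩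

namespace Trace.IsExecution

variable (hP : P.Valid) (hT : T.IsExecution P)

include hT in
/-- A step that is enabled until `φ` holds, and that establishes `φ`, is taken. -/
theorem eventually_of_fair {a : Action V U R O C} (ha : a.IsLocal) {φ : ℕ → Prop} (i : ℕ)
    (he : ∀ j, i ≤ j → ¬ φ j → Enabled P (T.time j) (T.state j) a)
    (hs : ∀ j, i ≤ j → ¬ φ j → T.act j = a → φ (j + 1)) : ∃ j, i ≤ j ∧ φ j := by
  by_contra hc
  push Not at hc
  obtain ⟨j, hj, h | h⟩ := hT.fair a ha i
  · exact hc (j + 1) (hj.trans (Nat.le_succ j)) (hs j hj (hc j hj) h)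
  · exact h (he j hj (hc j hj))

include hT in
theorem exists_time_gt (t : ℝ) : ∃ i, ∀ j, i ≤ j → t < T.time j := by
  obtain ⟨i, hi⟩ := hT.time_unbounded (t + 1)
  exact ⟨i, fun j hj => (lt_add_one t).trans_le (hi.trans (hT.time_mono hj))⟩

include hT in
theorem eventually_rcvd {u v : V} (hu : u ∈ P.honest) (hv : v ∈ P.honest) {m : Msg U R O C} {i : ℕ}
    (h : m ∈ ((T.state i).val u).sent) : ∃ j, (u, m) ∈ ((T.state j).val v).rcvd := by
  obtain ⟨j, -, hj⟩ := hT.delivery i u hu v hv m (hT.sent_mono (Nat.le_succ i) h)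
  exact ⟨j + 1, hj⟩

/-! Control flow of an entity -/

include hT in
-- The dichotomy behind all termination arguments: staying keeps the timer unchanged, so every
-- timeout is eventually passed; leaving is possible only by a decision, which carries what the
-- others need in order to follow.
theorem inInst_stays {v : V} {X : R} {k i : ℕ} (h : ((T.state i).val v).InInst X k) :
    (∀ j, i ≤ j → ((T.state j).val v).InInst X k ∧
      (((T.state j).val v).ra X).start = (((T.state i).val v).ra X).start) ∨
    ∃ j, i ≤ j ∧ v ∈ P.honest ∧ ((((T.state (j + 1)).val v).ra X).active ∧
      ¬ (((T.state (j + 1)).val v).ra X).running ∧ (((T.state (j + 1)).val v).ra X).inst = k) ∧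
      ∃ B, T.Decides P v X k B j ∧
        (((T.state j).verifyPoa P X k B ∧ Msg.proof X k B ∈ ((T.state (j + 1)).val v).sent) ∨
          ∃ B₀, (((T.state j).val v).ra X).qcDec k = some B₀ ∧
            ∀ tx ∈ B₀, tx.IsUARA → ∀ l, tx.slot = some l → ((T.state j).val v).taDec l ≠ none) := by
  refine or_iff_not_imp_right.2 fun h2 j hj => ?_
  induction hj with
  | refl => exact ⟨h, rfl⟩
  | @step j hj ih =>
    obtain ⟨⟨i1, i2, i3⟩, i4⟩ := ih
    rcases control_step (hT.enabled j) (w := v) (X := X) with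
      ⟨c1, c2, c3, c4, c5, -⟩ | ⟨c1, -⟩ | ⟨-, c2, -⟩ | ⟨hv, -, -, c3, c4, c5, -, B, -, hd⟩ |
      ⟨tx, -, -, c3, -⟩
    · rw [← hT.step j] at c1 c2 c3 c5
      exact ⟨⟨c1.2 i1, c3.2 i2, c2.trans i3⟩, c5.trans i4⟩
    · exact absurd i1 c1
    · exact absurd i2 c2
    · exfalso
      rw [i3] at hd c4
      refine h2 ⟨j, hj, hv, ?_, B, hT.control_decides hd, ?_⟩
      · rw [hT.step j]; exact ⟨c3, c5, c4⟩
      · rcases hd with ⟨hd, hp⟩ | ⟨B₀, hB₀, hd, -⟩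
        · exact Or.inl ⟨hd.elim hT.verifyPoa_of_votersFor id, by rw [hT.step j]; exact hp⟩
        · exact Or.inr ⟨B₀, hB₀, hd⟩
    · exact absurd i2 c3

include hT in
-- Induction on the length of the queue: nothing except processing its head changes the control
-- state, and with an empty queue only the start of the next instance remains.
theorem eventually_next {v : V} (hv : v ∈ P.honest) {X : R} {k i : ℕ}
    (h1 : (((T.state i).val v).ra X).active) (h2 : ¬ (((T.state i).val v).ra X).running)
    (h3 : (((T.state i).val v).ra X).inst = k) :
    ∃ j, ((T.state j).val v).InInst X (k + 1) := by
  generalize hq : (((T.state i).val v).ra X).queue = q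
  induction q generalizing i with
  | nil =>
    by_contra hc
    push Not at hc
    have key : ∀ j, i ≤ j → (((T.state j).val v).ra X).active ∧
        ¬ (((T.state j).val v).ra X).running ∧ (((T.state j).val v).ra X).inst = k ∧
        (((T.state j).val v).ra X).queue = [] := by
      intro j hj
      induction hj with
      | refl => exact ⟨h1, h2, h3, hq⟩
      | @step j hj ih =>
        obtain ⟨i1, i2, i3, i4⟩ := ih
        have hs := hT.step j
        rcases control_step (hT.enabled j) (w := v) (X := X) with
          ⟨c1, c2, c3, c4, -⟩ | ⟨c1, -⟩ | ⟨-, -, -, c4, c5, c6, -⟩ | ⟨-, -, c2, -⟩ |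
          ⟨tx, -, -, -, c3, -⟩
        · rw [← hs] at c1 c2 c3 c4
          exact ⟨c1.2 i1, fun h => i2 (c3.1 h), c2.trans i3, c4.trans i4⟩
        · exact absurd i1 c1
        · rw [← hs] at c4 c5 c6
          exact absurd ⟨c4, c6, by rw [c5, i3]⟩ (hc (j + 1))
        · exact absurd c2 i2
        · rw [i4] at c3; simp at c3
    obtain ⟨j, hj, h⟩ := hT.eventually_of_fair (a := Action.next v X k) trivial
      (φ := fun j => ((T.state j).val v).InInst X (k + 1)) i
      (fun j hj _ => ⟨hv, (key j hj).1, (key j hj).2.1, (key j hj).2.2.2, (key j hj).2.2.1⟩)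
      (fun j hj _ ha => by
        rw [hT.step j, ha]
        simp [perform, VState.initiate_eq, VState.InInst])
    exact hc j h
  | cons tx q ih =>
    by_contra hc
    have hcase : ∀ j, i ≤ j → (((T.state j).val v).ra X).active ∧
        ¬ (((T.state j).val v).ra X).running ∧ (((T.state j).val v).ra X).inst = k ∧
        (((T.state j).val v).ra X).queue = tx :: q := by
      intro j hj
      induction hj with
      | refl => exact ⟨h1, h2, h3, hq⟩
      | @step j hj ih' =>
        obtain ⟨i1, i2, i3, i4⟩ := ih'
        have hs := hT.step j
        rcases control_step (hT.enabled j) (w := v) (X := X) with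
          ⟨c1, c2, c3, c4, -⟩ | ⟨c1, -⟩ | ⟨-, -, c3, -⟩ | ⟨-, -, c2, -⟩ |
          ⟨tx, -, -, -, c3, c4, c5, c6, c7⟩
        · rw [← hs] at c1 c2 c3 c4
          exact ⟨c1.2 i1, fun h => i2 (c3.1 h), c2.trans i3, c4.trans i4⟩
        · exact absurd i1 c1
        · rw [i4] at c3; simp at c3
        · exact absurd c2 i2
        · rw [← hs] at c4 c5 c6 c7
          rw [i4] at c4
          exact absurd (ih c5 c6 (c7.trans i3) c4) hc
    obtain ⟨j, hj, h⟩ := hT.eventually_of_fair (a := Action.exec v X tx) trivial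
      (φ := fun j => (((T.state j).val v).ra X).queue = q) i
      (fun j hj _ => by
        obtain ⟨i1, i2, i3, i4⟩ := hcase j hj
        exact ⟨hv, i1, i2, by rw [i4]; rfl⟩)
      (fun j hj _ ha => by
        rw [hT.step j, ha]
        simp [perform, VState.execute_eq, (hcase j hj).2.2.2])
    obtain ⟨i1, i2, i3, i4⟩ := hcase j hj
    rw [h] at i4
    simp at i4

include hT in
theorem inInst_zero_of_active {v : V} {X : R} {i : ℕ} (h : (((T.state i).val v).ra X).active) :
    ∃ j, j ≤ i ∧ ((T.state j).val v).InInst X 0 := by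
  induction i with
  | zero => rw [hT.initial] at h; simp [Sys.initial] at h
  | succ i ih =>
    have hs := hT.step i
    by_cases ha : (((T.state i).val v).ra X).active
    · obtain ⟨j, hj, h⟩ := ih ha
      exact ⟨j, hj.trans (Nat.le_succ i), h⟩
    · rcases control_step (hT.enabled i) (w := v) (X := X) with
        ⟨c1, -⟩ | ⟨c1, c2, c3, c4, -⟩ | ⟨c1, -⟩ | ⟨-, c1, -⟩ | ⟨tx, -, c1, -⟩
      · rw [← hs] at c1; exact absurd (c1.1 h) ha
      · rw [← hs] at c2 c3 c4; exact ⟨i + 1, le_rfl, c2, c4, c3⟩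
      · exact absurd c1 ha
      · exact absurd c1 ha
      · exact absurd c1 ha

include hT in
theorem active_mono {v : V} {X : R} {i j : ℕ} (hij : i ≤ j)
    (h : (((T.state i).val v).ra X).active) : (((T.state j).val v).ra X).active := by
  refine hT.mono_of_step (φ := fun s => ((s.val v).ra X).active) (fun he h => ?_) hij h
  rcases control_step he (w := v) (X := X) with
    ⟨c1, -⟩ | ⟨c1, c2, -⟩ | ⟨-, -, -, c1, -⟩ | ⟨-, -, -, c1, -⟩ | ⟨tx, -, -, -, -, -, c1, -⟩
  · exact c1.2 h
  all_goals assumption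

include hT in
theorem eventually_active {v : V} (hv : v ∈ P.honest) {X : R} {i : ℕ}
    (h : X ∈ ((T.state i).val v).actors) : ∃ j, (((T.state j).val v).ra X).active := by
  obtain ⟨j, -, h⟩ := hT.eventually_of_fair (a := Action.create v X) trivial
    (φ := fun j => (((T.state j).val v).ra X).active) i
    (fun j hj h' => ⟨hv, hT.actors_mono hj h, h'⟩)
    (fun j _ _ ha => by rw [hT.step j, ha]; simp [perform, VState.initiate_eq])
  exact ⟨j, h⟩

/-! Termination of an instance -/

include hT in
theorem lockPhase_block {v : V} {X : R} {k j : ℕ}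
    (h : k ∈ (((T.state j).val v).ra X).lockPhase) :
    ∃ B, (((T.state j).val v).ra X).block k = some B := by
  induction j with
  | zero => rw [hT.initial] at h; simp [Sys.initial] at h
  | succ j ihj =>
    rw [hT.step j] at h
    rcases (reactiveActor_step (hT.enabled j) _ _).lockPhase_step h with h | ⟨-, -, B', hB', -⟩
    · obtain ⟨B', hB'⟩ := ihj h
      exact ⟨B', hT.block_mono (Nat.le_succ j) hB'⟩
    · exact ⟨B', hT.block_mono (Nat.le_succ j) hB'⟩

include hT in
-- A request cannot block the vote: once handled it is either answered or waiting, and if no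
-- approval comes it expires after `delta`.
theorem eventually_answered {v : V} (hv : v ∈ P.honest) {X : R} {k i : ℕ} {B : Block U R O C}
    {tx : Tx U R O C} (hk : k ∈ (((T.state i).val v).ra X).lockPhase)
    (hB : (((T.state i).val v).ra X).block k = some B) (ht : tx ∈ B) (hu : tx.IsUARA) :
    ∃ j b, (((T.state j).val v).ra X).lockStatus k tx = LockStatus.answered b := by
  by_contra hc
  push Not at hc
  obtain ⟨j, hj, hf⟩ := hT.eventually_of_fair (a := Action.fpLock v X k tx) trivial
    (φ := fun j => (((T.state j).val v).ra X).lockStatus k tx ≠ LockStatus.fresh) i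
    (fun j hj h => ⟨hv, hT.lockPhase_mono hj hk, hu, ⟨B, hT.block_mono hj hB, ht⟩, not_not.1 h⟩)
    (fun j _ _ ha => by
      rw [hT.step j, ha, perform_fpLock]
      simp only [VState.setLockStatus_eq, true_and, and_self, if_true]
      split_ifs <;> simp)
  cases hs : (((T.state j).val v).ra X).lockStatus k tx with
  | fresh => exact hf hs
  | answered b => exact hc j b hs
  | waiting t =>
    have hw : ∀ n, j ≤ n →
        (((T.state n).val v).ra X).lockStatus k tx = LockStatus.waiting t := by
      intro n hn
      induction hn with
      | refl => exact hs
      | @step n _ ih =>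
        have := (reactiveActor_step (hT.enabled n) _ _).lockStatus_waiting_persist ih
        rw [← hT.step n] at this
        rcases this with h | ⟨b, h⟩
        · exact h
        · exact absurd h (hc _ b)
    obtain ⟨N, hN⟩ := hT.exists_time_gt (t + P.delta)
    obtain ⟨n, -, b, h⟩ := hT.eventually_of_fair (a := Action.fpExpire v X k tx) trivial
      (φ := fun j => ∃ b, (((T.state j).val v).ra X).lockStatus k tx = LockStatus.answered b)
      (max j N)
      (fun n hn _ => ⟨hv, t, hw n ((le_max_left j N).trans hn), hN n ((le_max_right j N).trans hn)⟩)
      (fun n _ _ ha => by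
        refine ⟨false, ?_⟩
        rw [hT.step n, ha]
        simp [perform, VState.setLockStatus_eq])
    exact hc n b h

include hT in
theorem eventually_voted {v : V} (hv : v ∈ P.honest) {X : R} {k i : ℕ}
    (h : ∀ j, i ≤ j → ((T.state j).val v).InInst X k ∧
      (((T.state j).val v).ra X).start = (((T.state i).val v).ra X).start) :
    ∃ j, ((T.state j).val v).Voted X k := by
  -- If the lock phase is ever entered, its finitely many requests get answered and the ordinary
  -- vote stays enabled. If not, the late vote does after the timeout.
  by_cases hl : ∃ j, k ∈ (((T.state j).val v).ra X).lockPhase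
  · obtain ⟨i₁, hl⟩ := hl
    obtain ⟨B, hB⟩ := hT.lockPhase_block hl
    obtain ⟨N, hN⟩ := exists_forall_mem_finset (φ := fun tx j => ∃ b,
      (((T.state j).val v).ra X).lockStatus k tx = LockStatus.answered b)
      (B.filter fun tx => tx.IsUARA) (fun tx a b hab => fun ⟨c, h⟩ => ⟨c, hT.answered_mono hab h⟩)
      (fun tx ht => by
        rw [Finset.mem_filter] at ht
        exact hT.eventually_answered hv hl hB ht.1 ht.2)
    obtain ⟨j, -, h⟩ := hT.eventually_of_fair (a := Action.vote v X k B) trivial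
      (φ := fun j => ((T.state j).val v).Voted X k) (max i (max i₁ N))
      (fun j hj h' => by
        simp only [max_le_iff] at hj
        refine ⟨hv, (h j hj.1).1, h', hT.lockPhase_mono hj.2.1 hl, hT.block_mono hj.2.1 hB,
          fun tx ht hu => ?_⟩
        obtain ⟨b, hb⟩ := hN tx (Finset.mem_filter.2 ⟨ht, hu⟩)
        exact ⟨b, hT.answered_mono hj.2.2 hb⟩)
      (fun j _ _ ha => by
        rw [hT.step j, ha]
        simp only [perform, State.setVal_val_self, VState.broadcast, VState.Voted]
        exact ⟨_, _, Or.inr rfl⟩)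
    exact ⟨j, h⟩
  · push Not at hl
    obtain ⟨N, hN⟩ := hT.exists_time_gt (3 * P.delta + (((T.state i).val v).ra X).start)
    obtain ⟨j, -, h⟩ := hT.eventually_of_fair (a := Action.voteLate v X k) trivial
      (φ := fun j => ((T.state j).val v).Voted X k) (max i N)
      (fun j hj h' => by
        simp only [max_le_iff] at hj
        refine ⟨hv, (h j hj.1).1, h', hl j, ?_⟩
        rw [(h j hj.1).2]
        linarith [hN j hj.2])
      (fun j _ _ ha => by
        rw [hT.step j, ha]
        simp only [perform, State.setVal_val_self, VState.broadcast, VState.Voted]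
        exact ⟨_, _, Or.inr rfl⟩)
    exact ⟨j, h⟩

include hP hT in
theorem eventually_slow {v : V} (hv : v ∈ P.honest) {X : R} {k i : ℕ}
    (h : ∀ j, i ≤ j → ((T.state j).val v).InInst X k ∧
      (((T.state j).val v).ra X).start = (((T.state i).val v).ra X).start)
    (hvote : ∀ u ∈ P.honest, ∃ j, ((T.state j).val u).Voted X k) :
    ∃ j, (((T.state j).val v).ra X).slow k ≠ SlowPhase.off := by
  obtain ⟨N, hN⟩ := exists_forall_mem_finset (φ := fun u j => ∃ w b,
      (u, Msg.vote X k w b) ∈ ((T.state j).val v).rcvd) P.honest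
    (fun u a b hab => fun ⟨w, c, h⟩ => ⟨w, c, hT.rcvd_mono hab h⟩)
    (fun u hu => by
      obtain ⟨j, w, b, hj⟩ := hvote u hu
      obtain ⟨n, hn⟩ := hT.eventually_rcvd hu hv hj
      exact ⟨n, w, b, hn⟩)
  have hvoters : ∀ j, N ≤ j → Fintype.card V - P.f ≤ (((T.state j).val v).voters X k).card := by
    intro j hj
    have hsub : P.honest ⊆ ((T.state j).val v).voters X k := by
      refine Finset.Subset.trans (fun u hu => ?_) (hT.voters_mono hj)
      simp only [VState.voters, Finset.mem_filter, Finset.mem_univ, true_and]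
      exact hN u hu
    have h1 := Finset.card_le_card hsub
    have h2 := hP.card_honest
    omega
  obtain ⟨M, hM⟩ := hT.exists_time_gt (3 * P.delta + (((T.state i).val v).ra X).start)
  -- The set of voters for a block only grows, so one moment with enough votes keeps the candidate
  -- branch enabled. If there is no such moment, the fallback branch is enabled from some point on.
  by_cases hc : ∃ j B, Fintype.card V - P.p - 2 * P.f ≤
      (((T.state j).val v).votersFor X k (some B)).card
  · obtain ⟨i₁, B, hB⟩ := hc
    obtain ⟨j, -, h⟩ := hT.eventually_of_fair (a := Action.slowCandidate v X k B) trivial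
      (φ := fun j => (((T.state j).val v).ra X).slow k ≠ SlowPhase.off)
      (max (max i i₁) (max N M))
      (fun j hj h' => by
        simp only [max_le_iff] at hj
        refine ⟨hv, (h j hj.1.1).1, ?_, not_not.1 h', hvoters j hj.2.1,
          hB.trans (Finset.card_le_card (hT.votersFor_mono hj.1.2))⟩
        rw [(h j hj.1.1).2]
        linarith [hM j hj.2.2])
      (fun j _ _ ha => by
        rw [hT.step j, ha]
        simp [perform, VState.setSlow_eq])
    exact ⟨j, h⟩
  · push Not at hc
    obtain ⟨j, -, h⟩ := hT.eventually_of_fair (a := Action.slowFallback v X k) trivial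
      (φ := fun j => (((T.state j).val v).ra X).slow k ≠ SlowPhase.off)
      (max i (max N M))
      (fun j hj h' => by
        simp only [max_le_iff] at hj
        refine ⟨hv, (h j hj.1).1, ?_, not_not.1 h', hvoters j hj.2.1, hc j⟩
        rw [(h j hj.1).2]
        linarith [hM j hj.2.2])
      (fun j _ _ ha => by
        rw [hT.step j, ha]
        simp [perform, VState.setSlow_eq])
    exact ⟨j, h⟩

include hT in
theorem qcProp_of_proposed {v : V} {X : R} {k i : ℕ}
    (h : (((T.state i).val v).ra X).slow k = SlowPhase.proposed) :
    (((T.state i).val v).ra X).qcProp k ≠ none := by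
  induction i with
  | zero => rw [hT.initial] at h; simp [Sys.initial] at h
  | succ i ih =>
    rw [hT.step i] at h
    rcases (reactiveActor_step (hT.enabled i) _ _).slow_proposed_step h with h | h
    · exact hT.qcProp_mono (Nat.le_succ i) (ih h)
    · rwa [hT.step i]

include hT in
theorem eventually_spAnswered {v : V} (hv : v ∈ P.honest) {X : R} {k i : ℕ} {B : Block U R O C}
    (h : ∀ j, i ≤ j → (((T.state j).val v).ra X).slow k = SlowPhase.candidate B ∨
      (((T.state j).val v).ra X).slow k = SlowPhase.fallback B) :
    ∃ N, i ≤ N ∧ ∀ j, N ≤ j → ∀ tx ∈ B, tx.IsUARA → ((T.state j).val v).SPAnswered tx := by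
  have hm : ∀ (tx : Tx U R O C) (a b : ℕ), a ≤ b → ((T.state a).val v).SPAnswered tx →
      ((T.state b).val v).SPAnswered tx := by
    intro tx a b hab h
    obtain ⟨tx', h⟩ := Option.ne_none_iff_exists'.1 h
    exact Option.ne_none_iff_exists'.2 ⟨tx', hT.lockOf_spLocked_mono hab h⟩
  obtain ⟨N, hN⟩ := exists_forall_mem_finset (φ := fun tx j => ((T.state j).val v).SPAnswered tx)
    (B.filter fun tx => tx.IsUARA) hm
    (fun tx ht => by
      rw [Finset.mem_filter] at ht
      obtain ⟨l, hl⟩ := ht.2.exists_slot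
      obtain ⟨j, -, h⟩ := hT.eventually_of_fair (a := Action.spLock v X k tx) trivial
        (φ := fun j => ((T.state j).val v).SPAnswered tx) i
        (fun j hj h' => ⟨hv, ht.2, h', B, ht.1, h j hj⟩)
        (fun j _ h' ha => by
          rw [hT.step j, ha]
          simp only [VState.SPAnswered, lockOf_of_slot hl, ne_eq, not_not] at h'
          simp [perform, VState.SPAnswered, lockOf_of_slot hl, tryLock, hl, h'])
      exact ⟨j, h⟩)
  exact ⟨max i N, le_max_left _ _, fun j hj tx ht hu =>
    hm tx N j ((le_max_right _ _).trans hj) (hN tx (Finset.mem_filter.2 ⟨ht, hu⟩))⟩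

include hT in
-- Without a proposal the fallback phase would never be left, so all SP-lock requests would be
-- answered, and the proposal would stay enabled.
theorem qcProp_of_fallback {v : V} (hv : v ∈ P.honest) {X : R} {k i : ℕ} {B : Block U R O C}
    (h : (((T.state i).val v).ra X).slow k = SlowPhase.fallback B) :
    ∃ j, (((T.state j).val v).ra X).qcProp k ≠ none := by
  by_contra hc
  push Not at hc
  have hs : ∀ j, i ≤ j → (((T.state j).val v).ra X).slow k = SlowPhase.fallback B := by
    intro j hj
    induction hj with
    | refl => exact h
    | @step j _ ih =>
      have := (reactiveActor_step (hT.enabled j) _ _).slow_fallback_persist ih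
      rw [← hT.step j] at this
      exact this.resolve_right fun h => hT.qcProp_of_proposed h (hc _)
  obtain ⟨N, hN, ha⟩ := hT.eventually_spAnswered hv fun j hj => Or.inr (hs j hj)
  obtain ⟨j, -, h⟩ := hT.eventually_of_fair (a := Action.proposeFallback v X k B) trivial
      (φ := fun j => (((T.state j).val v).ra X).qcProp k ≠ none) N
      (fun j hj _ => ⟨hv, hs j (hN.trans hj), ha j hj⟩)
      (fun j _ _ ha => by
        rw [hT.step j, ha]
        simp [perform, VState.qcPropose_eq])
  exact h (hc j)

include hT in
-- The candidate phase ends in a proposal or in the fallback phase. An SP-lock is permanent once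
-- set, so success or failure of the candidate is final and keeps the corresponding step enabled.
theorem qcProp_of_candidate {v : V} (hv : v ∈ P.honest) {X : R} {k i : ℕ} {B : Block U R O C}
    (h : (((T.state i).val v).ra X).slow k = SlowPhase.candidate B) :
    ∃ j, (((T.state j).val v).ra X).qcProp k ≠ none := by
  by_contra hc
  have hs : ∀ j, i ≤ j → (((T.state j).val v).ra X).slow k = SlowPhase.candidate B := by
    intro j hj
    induction hj with
    | refl => exact h
    | @step j _ ih =>
      have := (reactiveActor_step (hT.enabled j) _ _).slow_candidate_persist ih
      rw [← hT.step j] at this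
      rcases this with h | ⟨B', h⟩ | h
      · exact h
      · exact absurd (hT.qcProp_of_fallback hv h) hc
      · exact absurd ⟨_, hT.qcProp_of_proposed h⟩ hc
  obtain ⟨N, hN, ha⟩ := hT.eventually_spAnswered hv fun j hj => Or.inl (hs j hj)
  push Not at hc
  by_cases hok : ∀ tx ∈ B, tx.IsUARA → ((T.state N).val v).SPSuccess tx
  · obtain ⟨j, -, h⟩ := hT.eventually_of_fair (a := Action.proposeCandidate v X k B) trivial
      (φ := fun j => (((T.state j).val v).ra X).qcProp k ≠ none) N
      (fun j hj _ => ⟨hv, hs j (hN.trans hj), fun tx ht hu =>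
        hT.lockOf_spLocked_mono hj (hok tx ht hu)⟩)
      (fun j _ _ ha => by
        rw [hT.step j, ha]
        simp [perform, VState.qcPropose_eq])
    exact h (hc j)
  · push Not at hok
    obtain ⟨tx, ht, hu, hok⟩ := hok
    obtain ⟨j, hj, h⟩ := hT.eventually_of_fair (a := Action.candidateFails v X k B) trivial
      (φ := fun j => (((T.state j).val v).ra X).slow k ≠ SlowPhase.candidate B) N
      (fun j hj _ => ⟨hv, hs j (hN.trans hj), ha j hj, tx, ht, hu, fun h => by
        obtain ⟨tx', h'⟩ := Option.ne_none_iff_exists'.1 (ha N le_rfl tx ht hu)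
        have h'' := hT.lockOf_spLocked_mono hj h'
        rw [VState.SPSuccess, h''] at h
        rw [Option.some.inj h] at h'
        exact hok h'⟩)
      (fun j _ _ ha => by
        rw [hT.step j, ha]
        simp [perform, VState.setSlow_eq])
    exact h (hs j (hN.trans hj))

include hT in
theorem eventually_taProp {v : V} (hv : v ∈ P.honest) {X : R} {k i : ℕ} {B : Block U R O C}
    (h : (((T.state i).val v).ra X).qcDec k = some B) {tx : Tx U R O C} (ht : tx ∈ B)
    (hu : tx.IsUARA) {l : U × ℕ} (hl : tx.slot = some l) :
    ∃ j x, ((T.state j).val v).taProp l = some x := by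
  obtain ⟨j, -, h⟩ := hT.eventually_of_fair (a := Action.taPropose v X k tx) trivial
      (φ := fun j => ∃ x, ((T.state j).val v).taProp l = some x) i
      (fun j hj h' => ⟨hv, hu, ⟨B, hT.qcDec_mono hj h, ht⟩, by
        rw [lockOf_of_slot hl, Option.eq_none_iff_forall_ne_some]
        exact fun x hx => h' ⟨x, hx⟩⟩)
      (fun j _ _ ha => by
        rw [hT.step j, ha]
        simp only [perform, State.setVal_val_self, VState.taPropose, hl, if_true, tryLock, true_and]
        split_ifs with h
        · exact ⟨_, rfl⟩
        · exact Option.ne_none_iff_exists'.1 h)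
  exact ⟨j, h⟩

include hP hT in
/-- If some honest validator can decide an instance on the slow path, then no honest validator
stays in the instance. -/
theorem not_stays_of_qcDec {u v : V} (hu : u ∈ P.honest) (hv : v ∈ P.honest) {X : R} {k i n : ℕ}
    {B : Block U R O C} (h : ∀ j, i ≤ j → ((T.state j).val v).InInst X k)
    (hB : (((T.state n).val u).ra X).qcDec k = some B)
    (hta : ∀ tx ∈ B, tx.IsUARA → ∀ l, tx.slot = some l → ∃ j, ((T.state j).val u).taDec l ≠ none) :
    False := by
  obtain ⟨N, B', hB'⟩ := (hT.quorumConsensus X k).termination (Or.inr ⟨u, hu, n, B, hB⟩) v hv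
  obtain rfl := (hT.quorumConsensus X k).agreement u hu v hv n N _ _ hB hB'
  obtain ⟨M, hM⟩ := exists_forall_mem_finset
    (φ := fun tx j => ∀ l, tx.slot = some l → ((T.state j).val v).taDec l ≠ none)
    (B.filter fun tx => tx.IsUARA)
    (fun tx a b hab h l hl => by
      obtain ⟨d, hd⟩ := Option.ne_none_iff_exists'.1 (h l hl)
      exact Option.ne_none_iff_exists'.2 ⟨d, hT.taDec_mono hab hd⟩)
    (fun tx ht => by
      rw [Finset.mem_filter] at ht
      obtain ⟨l, hl⟩ := ht.2.exists_slot
      obtain ⟨j, hj⟩ := hta tx ht.1 ht.2 l hl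
      obtain ⟨d, hd⟩ := Option.ne_none_iff_exists'.1 hj
      obtain ⟨m, d', hd'⟩ := (hT.transactionAgreement l).termination (Or.inr ⟨u, hu, j, d, hd⟩) v hv
      refine ⟨m, fun l' hl' => ?_⟩
      rw [hl] at hl'
      cases hl'
      exact Option.ne_none_iff_exists'.2 ⟨d', hd'⟩)
  obtain ⟨j, hj, h'⟩ := hT.eventually_of_fair (a := Action.decideSlow v X k B) trivial
      (φ := fun j => ¬ ((T.state j).val v).InInst X k) (max i (max N M))
      (fun j hj _ => by
        simp only [max_le_iff] at hj
        refine ⟨hv, h j hj.1, hT.qcDec_mono hj.2.1 hB', fun tx ht hu l hl => ?_⟩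
        obtain ⟨d, hd⟩ := Option.ne_none_iff_exists'.1 (hM tx (Finset.mem_filter.2 ⟨ht, hu⟩) l hl)
        exact Option.ne_none_iff_exists'.2 ⟨d, hT.taDec_mono hj.2.2 hd⟩)
      (fun j _ _ ha => by
        rw [hT.step j, ha]
        simp [perform, VState.poaDecide_eq, VState.InInst])
  exact h' (h j ((le_max_left _ _).trans hj))

include hP hT in
/-- An instance that all honest validators enter is decided by all of them. -/
theorem eventually_decided {X : R} {k : ℕ}
    (hin : ∀ u ∈ P.honest, ∃ i, ((T.state i).val u).InInst X k) {v : V} (hv : v ∈ P.honest) :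
    ∃ j, (((T.state j).val v).ra X).active ∧ ¬ (((T.state j).val v).ra X).running ∧
      (((T.state j).val v).ra X).inst = k := by
  obtain ⟨i, hi⟩ := hin v hv
  rcases hT.inInst_stays hi with hst | ⟨j, -, -, h, -⟩
  swap
  · exact ⟨j + 1, h⟩
  exfalso
  -- If all honest validators stay forever, then all vote and all propose, and the termination of
  -- both primitives makes `v` able to decide. Otherwise some `u` has left, and either its proof or
  -- the primitives bring `v` along.
  by_cases hd : ∀ u ∈ P.honest, ∃ i, ∀ j, i ≤ j → ((T.state j).val u).InInst X k ∧
      (((T.state j).val u).ra X).start = (((T.state i).val u).ra X).start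
  · have hvote : ∀ u ∈ P.honest, ∃ j, ((T.state j).val u).Voted X k := fun u hu => by
      obtain ⟨i, h⟩ := hd u hu
      exact hT.eventually_voted hu h
    have hprop : ∀ u ∈ P.honest, ∃ i B, (((T.state i).val u).ra X).qcProp k = some B := by
      intro u hu
      obtain ⟨i, h⟩ := hd u hu
      obtain ⟨j, hj⟩ := eventually_slow hP hT hu h hvote
      suffices h : ∃ j, (((T.state j).val u).ra X).qcProp k ≠ none by
        obtain ⟨j, h⟩ := h
        exact ⟨j, Option.ne_none_iff_exists'.1 h⟩
      cases hs : (((T.state j).val u).ra X).slow k with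
      | off => exact absurd hs hj
      | candidate B => exact hT.qcProp_of_candidate hu hs
      | fallback B => exact hT.qcProp_of_fallback hu hs
      | proposed => exact ⟨j, hT.qcProp_of_proposed hs⟩
    have hqc := (hT.quorumConsensus X k).termination (Or.inl hprop)
    obtain ⟨n, B, hB⟩ := hqc v hv
    refine not_stays_of_qcDec hP hT hv hv (fun j hj => (hst j hj).1) hB fun tx ht hu l hl => ?_
    -- By agreement all honest validators hold the same block of Quorum Consensus, so each of them
    -- makes a proposal for each of its slots.
    obtain ⟨j, d, hj⟩ := (hT.transactionAgreement l).termination (Or.inl fun w hw => by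
      obtain ⟨m, B', hB'⟩ := hqc w hw
      obtain rfl := (hT.quorumConsensus X k).agreement v hv w hw n m _ _ hB hB'
      exact hT.eventually_taProp hw hB' ht hu hl) v hv
    exact ⟨j, Option.ne_none_iff_exists'.2 ⟨d, hj⟩⟩
  · push Not at hd
    obtain ⟨u, hu, hd⟩ := hd
    obtain ⟨i', hi'⟩ := hin u hu
    rcases hT.inInst_stays hi' with h | ⟨j, -, -, -, B, -, h⟩
    · obtain ⟨j, hj, h'⟩ := hd i'
      exact h' (h j hj).1 (h j hj).2
    · rcases h with ⟨hp, hs⟩ | ⟨B₀, hB₀, hta⟩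
      · obtain ⟨N, hN⟩ := hT.eventually_rcvd hu hv hs
        obtain ⟨n, hn, h'⟩ := hT.eventually_of_fair (a := Action.decideByProof v u X k B) trivial
          (φ := fun j => ¬ ((T.state j).val v).InInst X k) (max i (max N j))
          (fun n hn _ => by
            simp only [max_le_iff] at hn
            exact ⟨hv, (hst n hn.1).1, hT.rcvd_mono hn.2.1 hN, hT.verifyPoa_mono hn.2.2 hp⟩)
          (fun n _ _ ha => by
            rw [hT.step n, ha]
            simp [perform, VState.poaDecide_eq, VState.InInst, VState.broadcast])
        exact h' (hst n ((le_max_left _ _).trans hn)).1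
      · exact not_stays_of_qcDec hP hT hu hv (fun j hj => (hst j hj).1) hB₀
          fun tx ht hu l hl => ⟨j, hta tx ht hu l hl⟩

include hP hT in
/-- A reactive actor created at all honest validators runs all instances at all of them. -/
theorem progresses {X : R} (h : ∀ u ∈ P.honest, ∃ i, X ∈ ((T.state i).val u).actors) {v : V}
    (hv : v ∈ P.honest) : Progresses T v X := by
  have key : ∀ k, ∀ u ∈ P.honest, ∃ i, ((T.state i).val u).InInst X k := by
    intro k
    induction k with
    | zero =>
      intro u hu
      obtain ⟨i, hi⟩ := h u hu
      obtain ⟨j, hj⟩ := hT.eventually_active hu hi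
      obtain ⟨n, -, hn⟩ := hT.inInst_zero_of_active hj
      exact ⟨n, hn⟩
    | succ k ih =>
      intro u hu
      obtain ⟨j, h1, h2, h3⟩ := eventually_decided hP hT ih hu
      exact hT.eventually_next hu h1 h2 h3
  exact fun k => key k v hv

end Trace.IsExecution

/-! ### Effects of executed transactions at user actors. -/

theorem Tx.not_isUARA_of_isUA {tx : Tx U R O C} (h : tx.IsUA) : ¬ tx.IsUARA := by
  cases tx <;> simp_all [Tx.IsUA, Tx.IsUARA]

/-- In step `i`, the user actor entities of `v` record the execution of `tx`, which created the
objects `c` at user actors. -/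
def Trace.Applies (T : Trace V U R O C S) (P : Sys V U R O C S) (v : V) (tx : Tx U R O C)
    (c : Finset (U × O)) (i : ℕ) : Prop :=
  (T.act i = Action.execUA v tx ∧ c = (P.execUser tx).created) ∨ T.act i = Action.applyNotice v tx c

/-- In step `i`, the object `c.2` is created at the user actor `c.1` of `v`. -/
def Trace.CreatesAt (T : Trace V U R O C S) (P : Sys V U R O C S) (v : V) (c : U × O) (i : ℕ) :
    Prop :=
  (∃ tx C, T.Applies P v tx C i ∧ c ∈ C) ∨
    ∃ X tx, T.Executes v X tx i ∧ tx.IsRARA ∧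
      c ∈ (P.execCall X (((T.state i).val v).ra X).state (((T.state i).val v).ra X).objs tx).created

/-- Before step `i`, the object `c.2` has been created at the user actor `c.1` of `v`. -/
def Trace.CreatedBefore (T : Trace V U R O C S) (P : Sys V U R O C S) (v : V) (c : U × O) (i : ℕ) :
    Prop :=
  c ∈ P.genesisOwned ∨ ∃ j, j < i ∧ T.CreatesAt P v c j

/-- In step `i`, the object `c.2` is consumed at the user actor `c.1` of `v`. -/
def Trace.Consumes (T : Trace V U R O C S) (P : Sys V U R O C S) (v : V) (c : U × O) (i : ℕ) :
    Prop :=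
  ∃ tx C, T.Applies P v tx C i ∧ c.2 ∈ tx.objs ∧ ∃ sn, tx.slot = some (c.1, sn)

theorem Trace.CreatedBefore.mono {v : V} {c : U × O} {i j : ℕ} (hij : i ≤ j)
    (h : T.CreatedBefore P v c i) : T.CreatedBefore P v c j := by
  rcases h with h | ⟨n, hn, h⟩
  · exact Or.inl h
  · exact Or.inr ⟨n, hn.trans_le hij, h⟩

namespace Trace.IsExecution

variable (hP : P.Valid) (hT : T.IsExecution P)

include hT in
theorem verifyPob_of_pobVoters {i : ℕ} {v : V} {tx : Tx U R O C}
    (h : Fintype.card V - P.p ≤ (((T.state i).val v).pobVoters tx).card) :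
    (T.state i).verifyPob P tx := by
  refine ⟨_, h, fun u hu hh => ?_⟩
  simp only [VState.pobVoters, Finset.mem_filter, Finset.mem_univ, true_and] at hu
  obtain ⟨l, hl, hu⟩ := hu
  exact ⟨l, hl, hT.rcvd_sent hu hh⟩

include hP hT in
-- The last clause is what lets a broadcast decision spread: its holder has either sent a verifiable
-- proof or obtained it from Transaction Agreement.
theorem pobDec_spec {i : ℕ} {v : V} {l : U × ℕ} {tx : Tx U R O C}
    (h : ((T.state i).val v).pobDec l = some tx) :
    tx.slot = some l ∧ tx.IsUA ∧ T.Settled P tx i ∧ (∃ j, tx ∈ ((T.state j).val v).pending) ∧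
      ((Msg.pobProof tx ∈ ((T.state i).val v).sent ∧ (T.state i).verifyPob P tx) ∨
        ((T.state i).val v).taDec l = some (some tx)) := by
  induction i with
  | zero => rw [hT.initial] at h; simp [Sys.initial] at h
  | succ i ih =>
    have hs := hT.step i
    rw [hs] at h
    have hm : T.Settled P tx i → T.Settled P tx (i + 1) := by
      rintro (h | ⟨w, hw, l, hl, h⟩)
      · exact Or.inl (hT.lockedBy_mono (Nat.le_succ i) h)
      · exact Or.inr ⟨w, hw, l, hl, hT.taDec_mono (Nat.le_succ i) h⟩
    rcases (userActor_step (hT.enabled i) _).pobDec_step h with h | ⟨hv, hl, hu, -, hp, hd⟩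
    · obtain ⟨h1, h2, h3, h4, h5⟩ := ih h
      exact ⟨h1, h2, hm h3, h4, h5.imp
        (fun h => ⟨hT.sent_mono (Nat.le_succ i) h.1, hT.verifyPob_mono (Nat.le_succ i) h.2⟩)
        (hT.taDec_mono (Nat.le_succ i))⟩
    · rw [← hs] at hp hd
      have hset : T.Settled P tx i := by
        rcases hd with ⟨-, h | h⟩ | h
        · exact Or.inl (hT.pobVoters_lockedBy h)
        · exact Or.inl (hT.verifyPob_lockedBy h)
        · exact Or.inr ⟨v, hv, l, hl, h⟩
      refine ⟨hl, hu, hm hset, ⟨i + 1, hp (Settled.signed hP hT hset)⟩, ?_⟩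
      rcases hd with ⟨hs, h⟩ | h
      · exact Or.inl ⟨hs, hT.verifyPob_mono (Nat.le_succ i) (h.elim hT.verifyPob_of_pobVoters id)⟩
      · exact Or.inr (hT.taDec_mono (Nat.le_succ i) h)

include hT in
theorem pending_pobDec {i : ℕ} {v : V} {l : U × ℕ} {tx : Tx U R O C}
    (h : tx ∈ ((T.state i).val v).pending) (hl : tx.slot = some l) :
    ((T.state i).val v).pobDec l = some tx := by
  induction i with
  | zero => rw [hT.initial] at h; simp [Sys.initial] at h
  | succ i ih =>
    have hs := hT.step i
    rw [hs] at h
    rcases pending_step (hT.enabled i) h with h | h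
    · exact hT.pobDec_mono (Nat.le_succ i) (ih h.1)
    · rw [hs]; exact h.2.2.2 l hl

include hT in
theorem notice_executes {i : ℕ} {v : V} {tx : Tx U R O C} {c : Finset (U × O)}
    (h : (tx, c) ∈ ((T.state i).val v).notices) :
    tx.IsUARA ∧ ∃ X j, j < i ∧ T.Executes v X tx j ∧
      c = (P.execCall X (((T.state j).val v).ra X).state (((T.state j).val v).ra X).objs
          tx).created := by
  induction i with
  | zero => rw [hT.initial] at h; simp [Sys.initial] at h
  | succ i ih =>
    rw [hT.step i] at h
    rcases (userActor_step (hT.enabled i) _).notices_step h with h | ⟨X, ha, hn, hu, hc⟩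
    · obtain ⟨hu, X, j, hj, h⟩ := ih h
      exact ⟨hu, X, j, hj.trans (Nat.lt_succ_self i), h⟩
    · exact ⟨hu, X, i, Nat.lt_succ_self i, ⟨ha, hn⟩, hc⟩

include hP hT in
-- A transaction names its recipient, and that entity executes it once, so there is only one set of
-- created objects to report.
theorem notice_unique {i j : ℕ} {v : V} {tx : Tx U R O C} {c c' : Finset (U × O)}
    (h : (tx, c) ∈ ((T.state i).val v).notices) (h' : (tx, c') ∈ ((T.state j).val v).notices) :
    c = c' := by
  obtain ⟨-, X, n, -, h1, rfl⟩ := hT.notice_executes h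
  obtain ⟨-, X', n', -, h1', rfl⟩ := hT.notice_executes h'
  have hX := (executes_spec hP hT h1).1
  rw [(executes_spec hP hT h1').1] at hX
  cases hX
  obtain rfl := hT.executes_unique h1 h1'
  rfl

include hT in
-- A transaction becomes pending only while its broadcast instance is undecided, which it no longer
-- is.
theorem not_pending_of_execUA {i j : ℕ} {v : V} {tx : Tx U R O C}
    (h : T.act i = Action.execUA v tx) (hij : i < j) : tx ∉ ((T.state j).val v).pending := by
  have he := hT.enabled i
  rw [h] at he
  obtain ⟨-, hu, hp, -⟩ := he
  obtain ⟨l, hl⟩ := hu.exists_slot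
  have hd := hT.pending_pobDec hp hl
  have key : ∀ n, i ≤ n → tx ∈ ((T.state (n + 1)).val v).pending →
      tx ∈ ((T.state n).val v).pending ∧ T.act n ≠ Action.execUA v tx := by
    intro n hn h
    rw [hT.step n] at h
    rcases pending_step (hT.enabled n) h with h | ⟨-, -, h, -⟩
    · exact h
    · rw [lockOf_of_slot hl, hT.pobDec_mono hn hd] at h; simp at h
  induction hij with
  | refl => exact fun hc => (key i le_rfl hc).2 h
  | step hn ih => exact fun hc => ih (key _ (Nat.le_of_succ_le hn) hc).1

include hP hT in
theorem Applies.spec {i : ℕ} {v : V} {tx : Tx U R O C} {c : Finset (U × O)}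
    (h : T.Applies P v tx c i) :
    v ∈ P.honest ∧ T.Settled P tx i ∧ ((T.state i).val v).Ready tx ∧
      (∃ l, tx.slot = some l) ∧ ∀ x ∈ c, P.Creates tx x := by
  have he := hT.enabled i
  rcases h with ⟨h, rfl⟩ | h
  · rw [h] at he
    obtain ⟨hv, hu, hp, hr⟩ := he
    obtain ⟨l, hl⟩ := hu.exists_slot
    exact ⟨hv, (pobDec_spec hP hT (hT.pending_pobDec hp hl)).2.2.1, hr, ⟨l, hl⟩,
      fun x hx => Or.inl hx⟩
  · rw [h] at he
    obtain ⟨hv, hn, -, hr⟩ := he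
    obtain ⟨hu, X, j, hj, hx, rfl⟩ := hT.notice_executes hn
    refine ⟨hv, ?_, hr, hu.exists_slot, fun x hx => Or.inr ⟨X, _, _, hx⟩⟩
    rcases (executes_spec hP hT hx).2.2 hu with h | ⟨w, hw, l, hl, h⟩
    · exact Or.inl (hT.lockedBy_mono hj.le h)
    · exact Or.inr ⟨w, hw, l, hl, hT.taDec_mono hj.le h⟩

include hP hT in
theorem mem_done_iff {i : ℕ} {v : V} {l : U × ℕ} :
    l ∈ ((T.state i).val v).done ↔ ∃ j, j < i ∧ ∃ tx c, T.Applies P v tx c j ∧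
        tx.slot = some l := by
  induction i with
  | zero => rw [hT.initial]; simp [Sys.initial]
  | succ i ih =>
    rw [hT.step i, done_step (hT.enabled i), ih]
    constructor
    · rintro (⟨j, hj, h⟩ | ⟨tx, h, hl⟩)
      · exact ⟨j, hj.trans (Nat.lt_succ_self i), h⟩
      · refine ⟨i, Nat.lt_succ_self i, tx, ?_⟩
        rcases h with h | ⟨c, h⟩
        · exact ⟨_, Or.inl ⟨h, rfl⟩, hl⟩
        · exact ⟨c, Or.inr h, hl⟩
    · rintro ⟨j, hj, tx, c, h, hl⟩
      rcases Nat.lt_succ_iff_lt_or_eq.1 hj with hj | rfl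
      · exact Or.inl ⟨j, hj, tx, c, h, hl⟩
      · exact Or.inr ⟨tx, h.imp And.left fun h => ⟨c, h⟩, hl⟩

include hP hT in
theorem Applies.tx_unique {i j : ℕ} {v w : V} {tx tx' : Tx U R O C} {c c' : Finset (U × O)}
    {l : U × ℕ} (h : T.Applies P v tx c i) (h' : T.Applies P w tx' c' j)
    (hl : tx.slot = some l) (hl' : tx'.slot = some l) : tx = tx' :=
  Settled.unique hP hT hl hl' (Applies.spec hP hT h).2.1 (Applies.spec hP hT h').2.1

include hP hT in
-- A UA transaction does not become pending again after its execution. For a UA-RA transaction a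
-- second application is ruled out by the guard that the sequence number is not yet executed.
theorem Applies.step_unique {i j : ℕ} {v : V} {tx : Tx U R O C} {c c' : Finset (U × O)}
    (h : T.Applies P v tx c i) (h' : T.Applies P v tx c' j) : i = j := by
  have key : ∀ {i j : ℕ} {c c' : Finset (U × O)}, T.Applies P v tx c i → T.Applies P v tx c' j →
      ¬ i < j := by
    intro i j c c' h h' hij
    obtain ⟨-, -, -, ⟨l, hl⟩, -⟩ := Applies.spec hP hT h
    have he := hT.enabled j
    rcases h' with ⟨h', -⟩ | h'
    · rw [h'] at he
      rcases h with ⟨h, -⟩ | h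
      · exact hT.not_pending_of_execUA h hij he.2.2.1
      · have he' := hT.enabled i
        rw [h] at he'
        exact Tx.not_isUARA_of_isUA he.2.1 (hT.notice_executes he'.2.1).1
    · rw [h'] at he
      exact he.2.2.1 l hl ((mem_done_iff hP hT).2 ⟨i, hij, tx, c, h, hl⟩)
  exact le_antisymm (not_lt.1 (key h' h)) (not_lt.1 (key h h'))

include hP hT in
theorem Applies.created_unique {i j : ℕ} {v w : V} {tx : Tx U R O C} {c c' : Finset (U × O)}
    (h : T.Applies P v tx c i) (h' : T.Applies P w tx c' j)
    (hn : tx.IsUARA → (tx, c) ∈ ((T.state j).val w).notices) : c = c' := by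
  have he := hT.enabled i
  have he' := hT.enabled j
  rcases h with ⟨h, rfl⟩ | h
  · rcases h' with ⟨h', rfl⟩ | h'
    · rfl
    · rw [h] at he
      rw [h'] at he'
      exact absurd (hT.notice_executes he'.2.1).1 (Tx.not_isUARA_of_isUA he.2.1)
  · rw [h] at he
    have hu := (hT.notice_executes he.2.1).1
    rcases h' with ⟨h', rfl⟩ | h'
    · rw [h'] at he'
      exact absurd hu (Tx.not_isUARA_of_isUA he'.2.1)
    · rw [h'] at he'
      exact notice_unique hP hT (hn hu) he'.2.1

include hP hT in
-- Applying a transaction presupposes the preceding sequence number, so the executed numbers form an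
-- initial segment.
theorem done_of_le {i : ℕ} {v : V} {A : U} {m n : ℕ} (h : (A, n) ∈ ((T.state i).val v).done)
    (hmn : m ≤ n) : (A, m) ∈ ((T.state i).val v).done := by
  induction n with
  | zero => obtain rfl : m = 0 := by omega
            exact h
  | succ n ih =>
    rcases hmn.lt_or_eq with hlt | rfl
    · refine ih ?_ (by omega)
      obtain ⟨j, hj, tx, c, ha, hl⟩ := (mem_done_iff hP hT).1 h
      exact hT.done_mono hj.le (((Applies.spec hP hT ha).2.2.1 A (n + 1) hl).1 n rfl)
    · exact h

/-! Ownership -/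

include hP hT in
theorem CreatesAt.spec {i : ℕ} {v : V} {c : U × O} (h : T.CreatesAt P v c i) :
    ∃ tx, P.Creates tx c ∧ ((∃ C, T.Applies P v tx C i) ∨ (tx.IsRARA ∧ ∃ X,
        T.Executes v X tx i)) := by
  rcases h with ⟨tx, C, h, hc⟩ | ⟨X, tx, h, hr, hc⟩
  · exact ⟨tx, (Applies.spec hP hT h).2.2.2.2 c hc, Or.inl ⟨C, h⟩⟩
  · exact ⟨tx, Or.inr ⟨X, _, _, hc⟩, Or.inr ⟨hr, X, h⟩⟩

include hP hT in
-- An object determines the transaction that creates it, and each transaction takes effect at most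
-- once at a validator.
theorem CreatesAt.unique {i j : ℕ} {v : V} {c : U × O} (h : T.CreatesAt P v c i)
    (h' : T.CreatesAt P v c j) : i = j := by
  obtain ⟨tx, hc, h⟩ := CreatesAt.spec hP hT h
  obtain ⟨tx', hc', h'⟩ := CreatesAt.spec hP hT h'
  obtain rfl := hP.created_unique tx tx' c hc hc'
  rcases h with ⟨C, h⟩ | ⟨hr, X, h⟩ <;> rcases h' with ⟨C', h'⟩ | ⟨hr', X', h'⟩
  · exact Applies.step_unique hP hT h h'
  · obtain ⟨l, hl⟩ := (Applies.spec hP hT h).2.2.2.1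
    rw [hr'.slot_eq] at hl; simp at hl
  · obtain ⟨l, hl⟩ := (Applies.spec hP hT h').2.2.2.1
    rw [hr.slot_eq] at hl; simp at hl
  · have hX := (executes_spec hP hT h).1
    rw [(executes_spec hP hT h').1] at hX
    cases hX
    exact hT.executes_unique h h'

include hP hT in
theorem CreatesAt.not_before {i j : ℕ} {v : V} {c : U × O} (h : T.CreatesAt P v c j)
    (h' : T.CreatedBefore P v c i) (hij : i ≤ j) : False := by
  rcases h' with h' | ⟨n, hn, h'⟩
  · obtain ⟨tx, hc, -⟩ := CreatesAt.spec hP hT h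
    exact hP.created_new tx c hc h'
  · have := CreatesAt.unique hP hT h h'
    omega

include hT in
theorem owned_succ {i : ℕ} {v : V} {c : U × O} (h : c ∈ ((T.state (i + 1)).val v).owned) :
    c ∈ ((T.state i).val v).owned ∨ T.CreatesAt P v c i := by
  rw [hT.step i] at h
  rcases (userActor_step (hT.enabled i) _).owned_step h with h | ⟨tx, ha, h⟩ | ⟨tx, C, ha, h⟩ |
      ⟨X, tx, ha, hn, hr, h⟩
  · exact Or.inl h
  · exact Or.inr (Or.inl ⟨tx, _, Or.inl ⟨ha, rfl⟩, h⟩)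
  · exact Or.inr (Or.inl ⟨tx, C, Or.inr ha, h⟩)
  · exact Or.inr (Or.inr ⟨X, tx, ⟨ha, hn⟩, hr, h⟩)

include hT in
theorem owned_of_createsAt {i : ℕ} {v : V} {c : U × O} (h : T.CreatesAt P v c i) :
    c ∈ ((T.state (i + 1)).val v).owned := by
  rw [hT.step i]
  rcases h with ⟨tx, C, ⟨ha, rfl⟩ | ha, h⟩ | ⟨X, tx, ⟨ha, hn⟩, hr, h⟩
  · rw [ha]; simp [perform, VState.settle, h]
  · rw [ha]; simp [perform, VState.settle, h]
  · rw [ha]; simp [perform, VState.execute_eq, h, hn, hr]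

include hT in
-- Consumed objects are removed before created ones are added, so an object present after its
-- consumption must have been created by the very same step.
theorem createsAt_of_consumes {i : ℕ} {v : V} {c : U × O} (h : T.Consumes P v c i)
    (h' : c ∈ ((T.state (i + 1)).val v).owned) : T.CreatesAt P v c i := by
  obtain ⟨tx, C, ha, ho, sn, hl⟩ := h
  refine Or.inl ⟨tx, C, ha, ?_⟩
  rw [hT.step i] at h'
  rcases ha with ⟨ha, rfl⟩ | ha
  · rw [ha] at h'
    simp only [perform, State.setVal_val_self, VState.settle, Set.mem_union, Set.mem_sdiff,
      Set.mem_ofPred_eq] at h'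
    exact h'.resolve_left fun h => h.2 ⟨sn, hl, ho⟩
  · rw [ha] at h'
    simp only [perform, State.setVal_val_self, VState.settle, Set.mem_union, Set.mem_sdiff,
      Set.mem_ofPred_eq] at h'
    exact h'.resolve_left fun h => h.2 ⟨sn, hl, ho⟩

include hT in
theorem createdBefore_of_owned {i : ℕ} {v : V} {c : U × O} (h : c ∈ ((T.state i).val v).owned) :
    T.CreatedBefore P v c i := by
  induction i with
  | zero => rw [hT.initial] at h; exact Or.inl h
  | succ i ih =>
    rcases hT.owned_succ h with h | h
    · exact (ih h).mono (Nat.le_succ i)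
    · exact Or.inr ⟨i, Nat.lt_succ_self i, h⟩

include hP hT in
-- A consumed object was owned, hence created before, and a second creation would contradict the
-- uniqueness of objects.
theorem not_owned_of_consumes {i j : ℕ} {v : V} {c : U × O} (h : T.Consumes P v c i)
    (hij : i < j) : c ∉ ((T.state j).val v).owned := by
  have hc : T.CreatedBefore P v c i := by
    obtain ⟨tx, C, ha, ho, sn, hl⟩ := h
    exact hT.createdBefore_of_owned (((Applies.spec hP hT ha).2.2.1 c.1 sn hl).2 c.2 ho)
  induction hij with
  | refl => exact fun ho => CreatesAt.not_before hP hT (hT.createsAt_of_consumes h ho) hc le_rfl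
  | step hn ih =>
    intro ho
    rcases hT.owned_succ ho with ho | ho
    · exact ih ho
    · exact CreatesAt.not_before hP hT ho hc (Nat.le_of_succ_le hn)

include hT in
-- Consumption is the only way to lose an object. Existence at a validator, unlike ownership, is
-- monotone, which is why totality is stated for `CreatedBefore`.
theorem owned_or_consumed {i j : ℕ} {v : V} {c : U × O} (h : T.CreatedBefore P v c i)
    (hij : i ≤ j) : c ∈ ((T.state j).val v).owned ∨ ∃ n, n < j ∧ T.Consumes P v c n := by
  have hstep : ∀ j, c ∈ ((T.state j).val v).owned → c ∈ ((T.state (j + 1)).val v).owned ∨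
      ∃ n, n < j + 1 ∧ T.Consumes P v c n := by
    intro j h
    have := (userActor_step (hT.enabled j) _).owned_persist h
    rw [← hT.step j] at this
    rcases this with h | ⟨tx, ha, ho, hl⟩
    · exact Or.inl h
    · refine Or.inr ⟨j, Nat.lt_succ_self j, tx, ?_⟩
      rcases ha with ha | ⟨C, ha⟩
      · exact ⟨_, Or.inl ⟨ha, rfl⟩, ho, hl⟩
      · exact ⟨C, Or.inr ha, ho, hl⟩
  have hgo : ∀ m n, m ≤ n → c ∈ ((T.state m).val v).owned →
      c ∈ ((T.state n).val v).owned ∨ ∃ n', n' < n ∧ T.Consumes P v c n' := by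
    intro m n hmn hm
    induction hmn with
    | refl => exact Or.inl hm
    | @step n _ ih =>
      rcases ih with h | ⟨n', hn', h⟩
      · exact hstep n h
      · exact Or.inr ⟨n', hn'.trans (Nat.lt_succ_self n), h⟩
  rcases h with h | ⟨n, hn, h⟩
  · exact hgo 0 j (Nat.zero_le j) (by rw [hT.initial]; exact h)
  · exact hgo (n + 1) j (by omega) (hT.owned_of_createsAt h)

/-! Totality of the broadcast primitive -/

include hP hT in
theorem eventually_pending {u v : V} (hu : u ∈ P.honest) (hv : v ∈ P.honest) {i : ℕ}
    {tx : Tx U R O C} (hua : tx.IsUA) (h : tx ∈ ((T.state i).val u).pending) :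
    ∃ j, tx ∈ ((T.state j).val v).pending := by
  obtain ⟨l, hl⟩ := hua.exists_slot
  obtain ⟨-, -, hset, -, hd⟩ := pobDec_spec hP hT (hT.pending_pobDec h hl)
  -- Any decision of `v` for this slot will do: both are settled, hence equal, and a decided
  -- transaction, being signed, has become pending.
  suffices hs : ∃ j, lockOf ((T.state j).val v).pobDec tx ≠ none by
    obtain ⟨j, hj⟩ := hs
    rw [lockOf_of_slot hl] at hj
    obtain ⟨tx', h'⟩ := Option.ne_none_iff_exists'.1 hj
    obtain ⟨h1, -, h2, h3, -⟩ := pobDec_spec hP hT h'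
    rwa [Settled.unique hP hT hl h1 hset h2]
  rcases hd with ⟨hs, hver⟩ | hd
  · obtain ⟨N, hN⟩ := hT.eventually_rcvd hu hv hs
    obtain ⟨j, -, h⟩ := hT.eventually_of_fair (a := Action.pobByProof v u tx) trivial
      (φ := fun j => lockOf ((T.state j).val v).pobDec tx ≠ none) (max i N)
      (fun j hj h' => by
        simp only [max_le_iff] at hj
        exact ⟨hv, hua, hT.rcvd_mono hj.2 hN, hT.verifyPob_mono hj.1 hver, not_not.1 h'⟩)
      (fun j _ _ ha => by
        rw [hT.step j, ha]
        simp [perform, VState.pobDecide, VState.broadcast, lockOf_of_slot hl, hl])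
    exact ⟨j, h⟩
  · obtain ⟨N, d, hN⟩ := (hT.transactionAgreement l).termination (Or.inr ⟨u, hu, i, _, hd⟩) v hv
    obtain rfl := (hT.transactionAgreement l).agreement u hu v hv i N _ _ hd hN
    obtain ⟨j, -, h⟩ := hT.eventually_of_fair (a := Action.pobByTA v tx) trivial
      (φ := fun j => lockOf ((T.state j).val v).pobDec tx ≠ none) N
      (fun j hj h' => ⟨hv, hua, ⟨l, hl, hT.taDec_mono hj hN⟩, not_not.1 h'⟩)
      (fun j _ _ ha => by
        rw [hT.step j, ha]
        simp [perform, VState.pobDecide, lockOf_of_slot hl, hl])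
    exact ⟨j, h⟩

include hP hT in
theorem eventually_done {v : V} (hv : v ∈ P.honest) {tx : Tx U R O C} {l : U × ℕ}
    (hl : tx.slot = some l) {N : ℕ}
    (hr : ∀ j, N ≤ j → l ∉ ((T.state j).val v).done → ((T.state j).val v).Ready tx)
    (h : (tx.IsUA ∧ ∃ i, tx ∈ ((T.state i).val v).pending) ∨
      ∃ i c, (tx, c) ∈ ((T.state i).val v).notices) :
    ∃ j, l ∈ ((T.state j).val v).done := by
  rcases h with ⟨hu, i, h⟩ | ⟨i, c, h⟩
  · by_contra hc
    push Not at hc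
    have hp : ∀ j, i ≤ j → tx ∈ ((T.state j).val v).pending := by
      intro j hj
      induction hj with
      | refl => exact h
      | @step j _ ih =>
        have := (userActor_step (hT.enabled j) _).pending_persist ih
        rw [← hT.step j] at this
        refine this.resolve_right fun ha => hc (j + 1) ?_
        exact (mem_done_iff hP hT).2 ⟨j, Nat.lt_succ_self j, tx, _, Or.inl ⟨ha, rfl⟩, hl⟩
    obtain ⟨j, -, h⟩ := hT.eventually_of_fair (a := Action.execUA v tx) trivial
      (φ := fun j => l ∈ ((T.state j).val v).done) (max i N)
      (fun j hj h' => by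
        simp only [max_le_iff] at hj
        exact ⟨hv, hu, hp j hj.1, hr j hj.2 h'⟩)
      (fun j _ _ ha =>
        (mem_done_iff hP hT).2 ⟨j, Nat.lt_succ_self j, tx, _, Or.inl ⟨ha, rfl⟩, hl⟩)
    exact hc j h
  · obtain ⟨j, -, h⟩ := hT.eventually_of_fair (a := Action.applyNotice v tx c) trivial
      (φ := fun j => l ∈ ((T.state j).val v).done) (max i N)
      (fun j hj h' => by
        simp only [max_le_iff] at hj
        refine ⟨hv, hT.notices_mono hj.1 h, fun l' hl' => ?_, hr j hj.2 h'⟩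
        rw [hl] at hl'
        cases hl'
        exact h')
      (fun j _ _ ha =>
        (mem_done_iff hP hT).2 ⟨j, Nat.lt_succ_self j, tx, _, Or.inr ha, hl⟩)
    exact ⟨j, h⟩

include hT in
theorem active_actors {i : ℕ} {v : V} {X : R} (h : (((T.state i).val v).ra X).active) :
    X ∈ ((T.state i).val v).actors := by
  induction i with
  | zero => rw [hT.initial] at h; simp [Sys.initial] at h
  | succ i ih =>
    refine hT.actors_mono (Nat.le_succ i) ?_
    by_cases ha : (((T.state i).val v).ra X).active
    · exact ih ha
    · have he := hT.enabled i
      have hs := hT.step i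
      rcases control_step he (w := v) (X := X) with
        ⟨c1, -⟩ | ⟨-, -, -, -, -, c1⟩ | ⟨c1, -⟩ | ⟨-, c1, -⟩ | ⟨tx, -, c1, -⟩
      · rw [← hs] at c1; exact absurd (c1.1 h) ha
      · rw [c1] at he; exact he.2.1
      · exact absurd c1 ha
      · exact absurd c1 ha
      · exact absurd c1 ha

/-! Totality -/

/-- What an honest validator has done before step `i` is eventually done at all of them. -/
structure Totality (T : Trace V U R O C S) (P : Sys V U R O C S) (i : ℕ) : Prop where
  actors : ∀ u ∈ P.honest, ∀ v ∈ P.honest, ∀ X ∈ ((T.state i).val u).actors,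
    ∃ j, X ∈ ((T.state j).val v).actors
  notices : ∀ u ∈ P.honest, ∀ v ∈ P.honest, ∀ d ∈ ((T.state i).val u).notices,
    ∃ j, d ∈ ((T.state j).val v).notices
  applies : ∀ u ∈ P.honest, ∀ v ∈ P.honest, ∀ tx c n, n < i → T.Applies P u tx c n →
    ∃ j, T.Applies P v tx c j
  created : ∀ u ∈ P.honest, ∀ v ∈ P.honest, ∀ c, T.CreatedBefore P u c i →
    ∃ j, T.CreatedBefore P v c j

include hP hT in
-- The entity of `u` exists, so its actor is created at all honest validators. It therefore runs all
-- instances at `v`, and the synchrony of the logs applies.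
theorem Totality.executes {i : ℕ} (h : Totality T P i) {u v : V} (hv : v ∈ P.honest)
    {X : R} {tx : Tx U R O C} (hx : T.Executes u X tx i) :
    ∃ j, T.Executes v X tx j ∧
      (((T.state j).val v).ra X).state = (((T.state i).val u).ra X).state ∧
      (((T.state j).val v).ra X).objs = (((T.state i).val u).ra X).objs := by
  have he := hT.enabled i
  rw [hx.1] at he
  obtain ⟨hu, ha, -⟩ := he
  have hp := progresses hP hT (fun w hw => h.actors u hu w hw X (hT.active_actors ha)) hv
  obtain ⟨j, h1, -, h2⟩ := executes_sync hP hT hp hx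
  exact ⟨j, h1, h2⟩

include hP hT in
-- Preconditions seen at `u` hold at `v` from some point on, until the sequence number itself is
-- executed at `v`; without this restriction the claim would fail, because the execution consumes
-- the objects.
theorem Totality.ready {i : ℕ} (h : Totality T P i) {u v : V} (hu : u ∈ P.honest)
    (hv : v ∈ P.honest) {tx : Tx U R O C} {A : U} {sn : ℕ} (hl : tx.slot = some (A, sn))
    (hr : ((T.state i).val u).Ready tx) :
    ∃ N, ∀ j, N ≤ j → (A, sn) ∉ ((T.state j).val v).done → ((T.state j).val v).Ready tx := by
  obtain ⟨hr1, hr2⟩ := hr A sn hl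
  obtain ⟨N₁, hN₁⟩ : ∃ N, ∀ m, m + 1 = sn → (A, m) ∈ ((T.state N).val v).done := by
    rcases sn with _ | m
    · exact ⟨0, fun m hm => by omega⟩
    · obtain ⟨n, hn, tx', c, ha, hl'⟩ := (mem_done_iff hP hT).1 (hr1 m rfl)
      obtain ⟨j, hj⟩ := h.applies u hu v hv tx' c n hn ha
      refine ⟨j + 1, fun m' hm' => ?_⟩
      obtain rfl : m' = m := by omega
      exact (mem_done_iff hP hT).2 ⟨j, Nat.lt_succ_self j, tx', c, hj, hl'⟩
  obtain ⟨N₂, hN₂⟩ := exists_forall_mem_finset (φ := fun o j => T.CreatedBefore P v (A, o) j)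
    tx.objs (fun o a b hab h => h.mono hab)
    (fun o ho => h.created u hu v hv (A, o) (hT.createdBefore_of_owned (hr2 o ho)))
  refine ⟨max N₁ N₂, fun j hj hnd A' sn' hl' => ?_⟩
  rw [hl] at hl'
  cases hl'
  simp only [max_le_iff] at hj
  refine ⟨fun m hm => hT.done_mono hj.1 (hN₁ m hm), fun o ho => ?_⟩
  rcases hT.owned_or_consumed (hN₂ o ho) hj.2 with h | ⟨n, hn, tx', c, ha, ho', sn', hl'⟩
  · exact h
  -- A consumer `tx'` at `v` has a smaller sequence number, as otherwise the number `sn` would be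
  -- executed already. At `u` this smaller number is executed too, by the same transaction, so `u`
  -- had consumed the object and could not own it.
  exfalso
  have hd : (A, sn') ∈ ((T.state j).val v).done := (mem_done_iff hP hT).2 ⟨n, hn, tx', c, ha, hl'⟩
  have hlt : sn' < sn := by
    by_contra hge
    exact hnd (done_of_le hP hT hd (not_lt.1 hge))
  have hd' : (A, sn') ∈ ((T.state i).val u).done :=
    done_of_le hP hT (hr1 (sn - 1) (by omega)) (by omega)
  obtain ⟨n', hn', tx'', c', ha', hl''⟩ := (mem_done_iff hP hT).1 hd'
  obtain rfl := Applies.tx_unique hP hT ha ha' hl' hl''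
  exact not_owned_of_consumes hP hT (c := (A, o)) ⟨tx', c', ha', ho', sn', hl'⟩ hn' (hr2 o ho)

include hP hT in
theorem Totality.applies_step {i : ℕ} (h : Totality T P i) {u v : V} (hv : v ∈ P.honest)
    {tx : Tx U R O C} {c : Finset (U × O)} (ha : T.Applies P u tx c i) :
    ∃ j, T.Applies P v tx c j := by
  obtain ⟨hu, hset, hr, ⟨⟨A, sn⟩, hl⟩, -⟩ := Applies.spec hP hT ha
  obtain ⟨N, hN⟩ := Totality.ready hP hT h hu hv hl hr
  have he := hT.enabled i
  have hn : tx.IsUARA → ∃ j, (tx, c) ∈ ((T.state j).val v).notices := by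
    intro hua
    rcases ha with ⟨ha, rfl⟩ | ha
    · rw [ha] at he
      exact absurd hua (Tx.not_isUARA_of_isUA he.2.1)
    · rw [ha] at he
      exact h.notices u hu v hv _ he.2.1
  have hsrc : (tx.IsUA ∧ ∃ i, tx ∈ ((T.state i).val v).pending) ∨
      ∃ i c, (tx, c) ∈ ((T.state i).val v).notices := by
    rcases ha with ⟨ha, rfl⟩ | ha
    · rw [ha] at he
      exact Or.inl ⟨he.2.1, eventually_pending hP hT hu hv he.2.1 he.2.2.1⟩
    · rw [ha] at he
      obtain ⟨j, hj⟩ := h.notices u hu v hv _ he.2.1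
      exact Or.inr ⟨j, c, hj⟩
  -- The argument only yields that the slot gets executed at `v`; uniqueness of the settled
  -- transaction identifies what was applied, and uniqueness of notices identifies the created
  -- objects.
  obtain ⟨j, hj⟩ := eventually_done hP hT hv hl hN hsrc
  obtain ⟨n, -, tx', c', ha', hl'⟩ := (mem_done_iff hP hT).1 hj
  obtain rfl := Applies.tx_unique hP hT ha ha' hl hl'
  refine ⟨n, ?_⟩
  suffices hc : c = c' by rw [hc]; exact ha'
  rcases ha with ⟨ha, rfl⟩ | ha
  · rw [ha] at he
    exact Applies.created_unique hP hT (Or.inl ⟨ha, rfl⟩) ha'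
      fun h => absurd h (Tx.not_isUARA_of_isUA he.2.1)
  · rw [ha] at he
    have hua := (hT.notice_executes he.2.1).1
    obtain ⟨m, hm⟩ := hn hua
    have he' := hT.enabled n
    rcases ha' with ⟨ha', rfl⟩ | ha'
    · rw [ha'] at he'
      exact absurd hua (Tx.not_isUARA_of_isUA he'.2.1)
    · rw [ha'] at he'
      exact notice_unique hP hT hm he'.2.1

include hP hT in
-- In the induction step, an application or execution at step `i` is replicated using the hypothesis
-- for everything before `i`; its new actors, notices and objects then agree, because the replica
-- starts from the same state and objects.
theorem totality (i : ℕ) : Totality T P i := by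
  induction i with
  | zero =>
    refine ⟨fun u _ v _ X h => ⟨0, ?_⟩, fun u _ v _ d h => ?_, fun u _ v _ tx c n hn => ?_,
      fun u _ v _ c h => ?_⟩
    · rw [hT.initial] at h ⊢; exact h
    · rw [hT.initial] at h; simp [Sys.initial] at h
    · omega
    · rcases h with h | ⟨j, hj, -⟩
      · exact ⟨0, Or.inl h⟩
      · omega
  | succ i ih =>
    have hap : ∀ u ∈ P.honest, ∀ v ∈ P.honest, ∀ tx c n, n < i + 1 → T.Applies P u tx c n →
        ∃ j, T.Applies P v tx c j := by
      intro u hu v hv tx c n hn ha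
      rcases Nat.lt_succ_iff_lt_or_eq.1 hn with hn | rfl
      · exact ih.applies u hu v hv tx c n hn ha
      · exact Totality.applies_step hP hT ih hv ha
    refine ⟨fun u hu v hv Y h => ?_, fun u hu v hv d h => ?_, hap, fun u hu v hv c h => ?_⟩
    · rw [hT.step i] at h
      rcases (userActor_step (hT.enabled i) _).actors_step h with h | ⟨tx, ha, h⟩ | ⟨X, tx, ha,
          hn, h⟩
      · exact ih.actors u hu v hv Y h
      · obtain ⟨j, hj⟩ := hap u hu v hv tx _ i (Nat.lt_succ_self i) (Or.inl ⟨ha, rfl⟩)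
        have he := hT.enabled i
        rw [ha] at he
        rcases hj with ⟨hj, -⟩ | hj
        · refine ⟨j + 1, ?_⟩
          rw [hT.step j, hj]
          simp [perform, h]
        · have he' := hT.enabled j
          rw [hj] at he'
          exact absurd (hT.notice_executes he'.2.1).1 (Tx.not_isUARA_of_isUA he.2.1)
      · obtain ⟨j, ⟨h1, h2⟩, h3, h4⟩ := Totality.executes hP hT ih hv ⟨ha, hn⟩
        refine ⟨j + 1, ?_⟩
        rw [hT.step j, h1]
        rw [← h3, ← h4] at h
        simp [perform, VState.execute_eq, h2, h]
    · obtain ⟨tx, c⟩ := d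
      rw [hT.step i] at h
      rcases (userActor_step (hT.enabled i) _).notices_step h with h | ⟨X, ha, hn, hua, rfl⟩
      · exact ih.notices u hu v hv _ h
      · obtain ⟨j, ⟨h1, h2⟩, h3, h4⟩ := Totality.executes hP hT ih hv ⟨ha, hn⟩
        refine ⟨j + 1, ?_⟩
        rw [hT.step j, h1, ← h3, ← h4]
        simp [perform, VState.execute_eq, h2, hua]
    · rcases h with h | ⟨n, hn, h⟩
      · exact ⟨0, Or.inl h⟩
      rcases Nat.lt_succ_iff_lt_or_eq.1 hn with hn | rfl
      · exact ih.created u hu v hv c (Or.inr ⟨n, hn, h⟩)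
      · rcases h with ⟨tx, C, ha, h⟩ | ⟨X, tx, hx, hr, h⟩
        · obtain ⟨j, hj⟩ := hap u hu v hv tx C n (Nat.lt_succ_self n) ha
          exact ⟨j + 1, Or.inr ⟨j, Nat.lt_succ_self j, Or.inl ⟨tx, C, hj, h⟩⟩⟩
        · obtain ⟨j, h1, h3, h4⟩ := Totality.executes hP hT ih hv hx
          rw [← h3, ← h4] at h
          exact ⟨j + 1, Or.inr ⟨j, Nat.lt_succ_self j, Or.inr ⟨X, tx, h1, hr, h⟩⟩⟩

end Trace.IsExecution

namespace Trace.IsExecution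

variable (hP : P.Valid) (hT : T.IsExecution P)

include hP hT in
theorem actor_progresses {X : R} (h : T.IsActor P X) {v : V} (hv : v ∈ P.honest) :
    Progresses T v X := by
  obtain ⟨u, hu, i, hi⟩ := h
  exact progresses hP hT (fun w hw => (totality hP hT i).actors u hu w hw X hi) hv

include hT in
theorem isActor_of_executes {i : ℕ} {v : V} {X : R} {tx : Tx U R O C} (h : T.Executes v X tx i) :
    T.IsActor P X := by
  have he := hT.enabled i
  rw [h.1] at he
  exact ⟨v, he.1, i, hT.active_actors he.2.1⟩

/-! Instances that start after a transaction has reached all pools -/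

include hP hT in
theorem inst_mono {v : V} {X : R} {i j : ℕ} (hij : i ≤ j) :
    (((T.state i).val v).ra X).inst ≤ (((T.state j).val v).ra X).inst := by
  induction hij with
  | refl => exact le_rfl
  | @step j _ ih =>
    refine ih.trans ?_
    have hs := hT.step j
    rcases control_step (hT.enabled j) (w := v) (X := X) with
      ⟨-, c, -⟩ | ⟨c, -⟩ | ⟨-, -, -, -, c, -⟩ | ⟨-, -, -, -, c, -⟩ | ⟨tx, -, -, -, -, -, -, -, c⟩
    · rw [hs, c]
    -- Creation sets the instance to `0`, where it already was.
    · rw [((processed_log hP hT j v X).1 c).1]; exact Nat.zero_le _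
    · rw [hs, c]; exact Nat.le_succ _
    · rw [hs, c]
    · rw [hs, c]

include hT in
theorem vote_fallback_eq_pool {i : ℕ} {v : V} {X : R} {k : ℕ} {w : Option (Block U R O C)}
    {b : Block U R O C} (h : Msg.vote X k w b ∈ ((T.state i).val v).sent) :
    ∃ j, (((T.state j).val v).ra X).inst = k ∧ b = (((T.state j).val v).ra X).pool := by
  induction i with
  | zero => rw [hT.initial] at h; simp [Sys.initial] at h
  | succ i ih =>
    rw [hT.step i] at h
    rcases (message_step (hT.enabled i) _).vote_step h with h | ⟨-, -, h, hb, -⟩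
    · exact ih h
    · exact ⟨i, h.2.2, hb⟩

include hT in
-- A proposal is taken from the pool while the leader is entering the instance, so the recorded
-- number may still be the preceding one.
theorem proposal_eq_pool {i : ℕ} {v : V} {X : R} {k : ℕ} {B : Block U R O C}
    (h : Msg.proposal X k B ∈ ((T.state i).val v).sent) :
    ∃ j, k ≤ (((T.state j).val v).ra X).inst + 1 ∧ B = (((T.state j).val v).ra X).pool := by
  induction i with
  | zero => rw [hT.initial] at h; simp [Sys.initial] at h
  | succ i ih =>
    rw [hT.step i] at h
    rcases (message_step (hT.enabled i) _).proposal_step h with h | ⟨-, -, hb, ⟨rfl, -⟩ | ⟨k',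
        rfl, -, h, -⟩⟩
    · exact ih h
    · exact ⟨i, Nat.zero_le _, hb⟩
    · exact ⟨i, by rw [h], hb⟩

include hP hT in
/-- A slow-path block contains the transactions that all honest votes contain. -/
theorem mem_slow {X : R} {k : ℕ} {tx : Tx U R O C}
    (hvote : ∀ u ∈ P.honest, ∀ i w b, Msg.vote X k w b ∈ ((T.state i).val u).sent →
      tx ∈ b ∧ ∀ B, w = some B → tx ∈ B) (i : ℕ) (v : V) (B : Block U R O C) :
    ((((T.state i).val v).ra X).slow k = SlowPhase.candidate B →
      tx ∈ B ∧ Fintype.card V - P.f ≤ (((T.state i).val v).voters X k).card) ∧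
    ((((T.state i).val v).ra X).slow k = SlowPhase.fallback B → tx ∈ B) := by
  have hr := hP.resilience
  induction i generalizing B with
  | zero => rw [hT.initial]; simp [Sys.initial]
  | succ i ih =>
    refine ⟨fun h => ?_, fun h => ?_⟩
    · suffices hs : tx ∈ B ∧ Fintype.card V - P.f ≤ (((T.state i).val v).voters X k).card from
        ⟨hs.1, hs.2.trans (Finset.card_le_card (hT.voters_mono (Nat.le_succ i)))⟩
      rw [hT.step i] at h
      rcases (reactiveActor_step (hT.enabled i) _ _).slow_candidate_step h with h | ⟨-, h1, h2⟩
      · exact (ih B).1 h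
      -- A candidate has `n - p - 2f ≥ f + 1` votes, one of them honest. The count of `n - f` voters
      -- is carried along for the case that the candidate fails later.
      · obtain ⟨u, hu, hu'⟩ := hP.exists_honest (Q := ((T.state i).val v).votersFor X k (some B))
          (by omega)
        obtain ⟨b, hb⟩ := hT.votersFor_spec hu' hu
        exact ⟨(hvote u hu i _ b hb).2 B rfl, h1⟩
    · rw [hT.step i] at h
      rcases (reactiveActor_step (hT.enabled i) _ _).slow_fallback_step h with h | ⟨-, hB, h⟩
      · exact (ih B).2 h
      · rw [hB]
        have hvs : Fintype.card V - P.f ≤ (((T.state i).val v).voters X k).card := by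
          rcases h with ⟨h, -⟩ | ⟨B', h, -⟩
          · exact h
          · exact ((ih B').1 h).2
        -- Of the `n - f` validators heard from, `n - 2f` are honest, and all their fallback blocks
        -- contain `tx`; this is exactly the threshold.
        have hsub : ((T.state i).val v).voters X k ∩ P.honest ⊆
            ((T.state i).val v).fallbackVoters X k tx := by
          intro u hu
          simp only [VState.voters, Finset.mem_inter, Finset.mem_filter, Finset.mem_univ,
            true_and] at hu
          obtain ⟨⟨w, b, hw⟩, hu⟩ := hu
          simp only [VState.fallbackVoters, Finset.mem_filter, Finset.mem_univ, true_and]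
          exact ⟨w, b, hw, (hvote u hu i w b (hT.rcvd_sent hw hu)).1⟩
        have h1 := Finset.card_le_card hsub
        have h2 := Finset.card_union_add_card_inter (((T.state i).val v).voters X k) P.honest
        have h3 := Finset.card_le_univ (((T.state i).val v).voters X k ∪ P.honest)
        have h4 := hP.card_honest
        have h5 : Fintype.card V - 2 * P.f ≤
            (((T.state i).val v).fallbackVoters X k tx).card := by omega
        obtain ⟨u, hu⟩ := Finset.card_pos.1
          (show 0 < (((T.state i).val v).fallbackVoters X k tx).card by omega)
        simp only [VState.fallbackVoters, Finset.mem_filter, Finset.mem_univ, true_and] at hu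
        obtain ⟨w, b, hu, hb⟩ := hu
        simp only [VState.fallbackBlock, Finset.mem_filter, Finset.mem_biUnion]
        exact ⟨⟨_, hu, by simpa using hb⟩, h5⟩

include hP hT in
/-- A decided block contains an uncontested transaction that all honest votes contain. -/
theorem mem_of_decides {X : R} {k : ℕ} {tx : Tx U R O C} (hX : tx.recv = some X)
    (hsole : ∀ i v l tx', tx.slot = some l → ((T.state i).val v).spLocked l = some tx' → tx' = tx)
    (hvote : ∀ u ∈ P.honest, ∀ i w b, Msg.vote X k w b ∈ ((T.state i).val u).sent →
      tx ∈ b ∧ ∀ B, w = some B → tx ∈ B)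
    {v : V} (hv : v ∈ P.honest) {B : Block U R O C} {i : ℕ} (h : T.Decides P v X k B i) :
    tx ∈ B := by
  have hr := hP.resilience
  rcases h with ⟨Q, hQ, h⟩ | ⟨B₀, h1, h2, rfl⟩
  · obtain ⟨u, hu, hu'⟩ := hP.exists_honest (Q := Q) (by omega)
    obtain ⟨b, hb⟩ := h u hu' hu
    exact (hvote u hu i _ b hb).2 B rfl
  -- Every honest proposal contains `tx`: a UA-RA transaction passes the SP-lock filter because the
  -- lock of its slot is taken and can only be held by `tx`.
  have hprop : ∀ u ∈ P.honest, ∀ j B', (((T.state j).val u).ra X).qcProp k = some B' →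
      tx ∈ B' := by
    intro u _ j B' h'
    induction j with
    | zero => rw [hT.initial] at h'; simp [Sys.initial] at h'
    | succ j ih =>
      rw [hT.step j] at h'
      rcases (reactiveActor_step (hT.enabled j) _ _).qcProp_step h' with h1 | ⟨h1, -⟩ | ⟨B₁, h1,
          ha, hB⟩
      · exact ih h1
      · exact ((mem_slow hP hT hvote j u B').1 h1).1
      · have ht := (mem_slow hP hT hvote j u B₁).2 h1
        rw [hB]
        refine Finset.mem_filter.2 ⟨ht, (Tx.isRARA_or_isUARA hX).imp_right fun hu => ⟨hu, ?_⟩⟩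
        obtain ⟨tx', ht'⟩ := Option.ne_none_iff_exists'.1 (ha tx ht hu)
        obtain ⟨l, hl, hs⟩ := lockOf_eq_some.1 ht'
        rwa [hsole j u l tx' hl hs] at ht'
  have ht := (hT.quorumConsensus X k).validity_all v hv i B₀ tx h1 hprop
  refine Finset.mem_filter.2 ⟨ht, fun l hl => ?_⟩
  rcases Tx.isRARA_or_isUARA hX with hr | hu
  · rw [hr.slot_eq] at hl; simp at hl
  · obtain ⟨d, hd⟩ := Option.ne_none_iff_exists'.1 (h2 tx ht hu l hl)
    rw [hd, (hT.transactionAgreement l).validity_all v hv i d tx hd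
      fun u _ j y hy => hsole j u l y hl (hT.taProp_spLocked hy)]

include hP hT in
-- An entity that is in instance `k` and also in instance `k + 1` cannot have stayed in the former,
-- and it leaves only by a decision.
theorem exists_decides {v : V} {X : R} (hp : Progresses T v X) (k : ℕ) :
    ∃ i B, v ∈ P.honest ∧ T.Decides P v X k B i := by
  obtain ⟨i, hi⟩ := hp k
  rcases hT.inInst_stays hi with h | ⟨j, -, hv, -, B, h, -⟩
  · obtain ⟨j, -, -, hj⟩ := hp (k + 1)
    rcases le_total i j with hij | hij
    · have := (h j hij).1.2.2
      omega
    · have := inst_mono hP hT hij (v := v) (X := X)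
      rw [hi.2.2] at this
      omega
  · exact ⟨j, B, hv, h⟩

include hT in
theorem executes_of_mem_processed {i : ℕ} {v : V} {X : R} {tx : Tx U R O C}
    (h : tx ∈ T.processed v X i) : ∃ j, T.Executes v X tx j := by
  induction i with
  | zero => simp [Trace.processed] at h
  | succ i ih =>
    by_cases h' : tx ∈ T.processed v X i
    · exact ih h'
    · by_cases he : ∃ tx', T.act i = Action.exec v X tx'
      · obtain ⟨tx', he⟩ := he
        rw [Trace.processed_exec he, List.mem_append, List.mem_singleton] at h
        obtain rfl := h.resolve_left h'
        exact ⟨i, hT.executes_iff.2 ⟨he, h'⟩⟩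
      · push Not at he
        rw [Trace.processed_of_ne he] at h
        exact absurd h h'

include hP hT in
theorem executes_of_mem_log {v : V} {X : R} {tx : Tx U R O C} (hp : Progresses T v X) {k : ℕ}
    (h : tx ∈ T.log P X k) : ∃ j, T.Executes v X tx j := by
  obtain ⟨i, h1, h2, h3⟩ := hp k
  exact hT.executes_of_mem_processed ((log_prefix_processed hP hT h1 h3.ge h2).subset h)

include hP hT in
theorem executes_of_mem_queue {i : ℕ} {v : V} {X : R} {tx : Tx U R O C} (hp : Progresses T v X)
    (h : tx ∈ (((T.state i).val v).ra X).queue) : ∃ j, T.Executes v X tx j := by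
  obtain ⟨h1, h2, h3⟩ := processed_log hP hT i v X
  by_cases ha : (((T.state i).val v).ra X).active
  · by_cases hr : (((T.state i).val v).ra X).running
    · rw [(h2 ha hr).1] at h; simp at h
    · exact executes_of_mem_log hP hT hp (h3 ha hr ▸ List.mem_append_right _ h)
  · rw [(h1 ha).2.2.1] at h; simp at h

include hP hT in
/-- A transaction on the inner link to an entity reaches the pool and stays there until it is
executed. -/
theorem eventually_pool {v : V} (hv : v ∈ P.honest) {X : R} {tx : Tx U R O C}
    (hp : Progresses T v X) (hX : tx.recv = some X) {i : ℕ}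
    (h : tx ∈ ((T.state i).val v).inbox) (hn : ∀ j, ¬ T.Executes v X tx j) :
    ∃ N, ∀ j, N ≤ j → tx ∈ (((T.state j).val v).ra X).pool := by
  have hex : ∀ j, tx ∉ (((T.state j).val v).ra X).executed := by
    intro j hj
    rw [hT.mem_executed] at hj
    obtain ⟨n, hj⟩ := hT.executes_of_mem_processed hj
    exact hn n hj
  have hq : ∀ j, tx ∉ (((T.state j).val v).ra X).queue := by
    intro j hj
    obtain ⟨n, hj⟩ := executes_of_mem_queue hP hT hp hj
    exact hn n hj
  have hadd : ∀ j, T.act j = Action.poolAdd v X tx →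
      tx ∈ (((T.state (j + 1)).val v).ra X).pool := by
    intro j ha
    rw [hT.step j, ha, perform_poolAdd]
    simp [hex j, hq j]
  suffices hs : ∃ N, tx ∈ (((T.state N).val v).ra X).pool by
    obtain ⟨N, hN⟩ := hs
    refine ⟨N, fun j hj => ?_⟩
    induction hj with
    | refl => exact hN
    | @step j _ ih =>
      have := (reactiveActor_step (hT.enabled j) _ _).pool_persist ih
      rw [← hT.step j] at this
      -- The pool loses only transactions of a decided block. Such a transaction would be in the
      -- queue, and whatever is queued is in the log and gets executed.
      refine this.resolve_right fun ⟨_, B, hB, ht⟩ => hq (j + 1) ?_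
      rw [hB, hP.order_mem]
      exact ht
  by_contra hc
  push Not at hc
  have hin : ∀ j, i ≤ j → tx ∈ ((T.state j).val v).inbox := by
    intro j hj
    induction hj with
    | refl => exact h
    | @step j _ ih =>
      have := (userActor_step (hT.enabled j) _).inbox_persist ih
      rw [← hT.step j] at this
      refine this.resolve_right fun ⟨Y, ha, hY⟩ => ?_
      rw [hX] at hY
      cases hY
      exact hc _ (hadd j ha)
  obtain ⟨n, hn, -⟩ := hp 0
  obtain ⟨j, -, hj⟩ := hT.eventually_of_fair (a := Action.poolAdd v X tx) trivial
    (φ := fun j => tx ∈ (((T.state j).val v).ra X).pool) (max i n)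
    (fun j hj _ => by
      simp only [max_le_iff] at hj
      exact ⟨hv, hT.active_mono hj.2 hn, hin j hj.1, hX⟩)
    (fun j _ _ ha => hadd j ha)
  exact hc j hj

include hP hT in
/-- An uncontested transaction that reaches all entities for `X` is executed by all of them. -/
theorem eventually_executes {X : R} {tx : Tx U R O C} (hX : tx.recv = some X)
    (hp : ∀ v ∈ P.honest, Progresses T v X)
    (hsole : ∀ i v l tx', tx.slot = some l → ((T.state i).val v).spLocked l = some tx' → tx' = tx)
    (h : ∀ v ∈ P.honest, (∃ i, tx ∈ ((T.state i).val v).inbox) ∨ ∃ j, T.Executes v X tx j)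
    {v : V} (hv : v ∈ P.honest) : ∃ j, T.Executes v X tx j := by
  by_contra hc
  -- An execution at any honest validator would be replicated at `v`, so under the contrary
  -- assumption nobody executes `tx`, and it stays in all pools.
  have hn : ∀ u ∈ P.honest, ∀ j, ¬ T.Executes u X tx j := by
    intro u _ j hj
    obtain ⟨n, hj, -⟩ := executes_sync hP hT (hp v hv) hj
    exact hc ⟨n, hj⟩
  obtain ⟨N, hN⟩ := exists_forall_mem_finset
    (φ := fun u N => ∀ j, N ≤ j → tx ∈ (((T.state j).val u).ra X).pool) P.honest
    (fun u a b hab h j hj => h j (hab.trans hj))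
    (fun u hu => by
      obtain ⟨i, hi⟩ := (h u hu).resolve_right fun ⟨j, hj⟩ => hn u hu j hj
      exact eventually_pool hP hT hu (hp u hu) hX hi (hn u hu))
  -- The instance must be so late that even its proposal is formed after `N`. The leader may then
  -- still be recorded in instance `k - 1`, hence the margin of two.
  obtain ⟨k, hk, hl⟩ := hP.leader_honest
    ((P.honest.sup fun u => (((T.state N).val u).ra X).inst) + 2)
  have hin : ∀ u ∈ P.honest, ∀ j, k ≤ (((T.state j).val u).ra X).inst + 1 →
      tx ∈ (((T.state j).val u).ra X).pool := by
    intro u hu j hj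
    refine hN u hu j ?_
    by_contra hjN
    have h1 := inst_mono hP hT (not_le.1 hjN).le (v := u) (X := X)
    have h2 : (((T.state N).val u).ra X).inst ≤ _ :=
      Finset.le_sup (f := fun u => (((T.state N).val u).ra X).inst) hu
    omega
  have hvote : ∀ u ∈ P.honest, ∀ i w b, Msg.vote X k w b ∈ ((T.state i).val u).sent →
      tx ∈ b ∧ ∀ B, w = some B → tx ∈ B := by
    intro u hu i w b hb
    constructor
    · obtain ⟨j, hj, rfl⟩ := hT.vote_fallback_eq_pool hb
      exact hin u hu j (by omega)
    · rintro B rfl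
      obtain ⟨j, hj, rfl⟩ := hT.proposal_eq_pool (hT.block_sent (hT.vote_block_eq hb).1 hl)
      exact hin _ hl j hj
  obtain ⟨i, B, -, hB⟩ := exists_decides hP hT (hp v hv) k
  refine hc (executes_of_mem_log hP hT (hp v hv) (k := k + 1) ?_)
  rw [Trace.log_succ, List.mem_append, hP.order_mem, decided_eq hP hT hv hB]
  exact Or.inr (mem_of_decides hP hT hX hsole hvote hv hB)

/-! Transactions issued by reactive actors -/

include hP hT in
-- The execution that issues `tx` is replicated from the same state and objects, so `tx` is put on
-- the inner link at every honest validator. Having no slot, it cannot be contested.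
theorem produces_executes {u : V} {X Y : R} {tx : Tx U R O C} (hY : tx.recv = some Y) {i : ℕ}
    (h : T.Produces P u X tx i) (ha : T.IsActor P Y) {v : V} (hv : v ∈ P.honest) :
    ∃ j, T.Executes v Y tx j := by
  obtain ⟨tx', hx, h⟩ := h
  refine eventually_executes hP hT hY (fun w hw => actor_progresses hP hT ha hw)
    (fun i v l tx' hl => ?_) (fun w hw => Or.inl ?_) hv
  · rw [(outgoing_isRARA h).slot_eq] at hl; simp at hl
  · obtain ⟨j, ⟨h1, h2⟩, h3, h4⟩ := Totality.executes hP hT (totality hP hT i) hw hx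
    have ho : ((T.state j).val w).outgoing P X tx' = ((T.state i).val u).outgoing P X tx' := by
      simp only [VState.outgoing, h3, h4]
    refine ⟨j + 1, ?_⟩
    rw [hT.step j, h1]
    simp [perform, VState.execute_eq, h2, ho, h]

/-! Transactions of honest users -/

/-- What holds of the transactions signed by an honest user. -/
structure UserInvariant (s : State V U R O C S) (A : U) : Prop where
  lt_sns : ∀ tx ∈ s.signed, ∀ sn, tx.slot = some (A, sn) → sn < s.sns A
  spent : ∀ tx ∈ s.signed, ∀ sn, tx.slot = some (A, sn) → ∀ o ∈ tx.objs, (A, o) ∈ s.spent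
  unique : ∀ tx ∈ s.signed, ∀ tx' ∈ s.signed, ∀ sn, tx.slot = some (A, sn) →
    tx'.slot = some (A, sn) → tx = tx'
  disjoint : ∀ tx ∈ s.signed, ∀ tx' ∈ s.signed, ∀ sn sn' o, tx.slot = some (A, sn) →
    tx'.slot = some (A, sn') → o ∈ tx.objs → o ∈ tx'.objs → tx = tx'

include hT in
-- Only the user itself signs for an honest user actor, always with the next sequence number and
-- with unspent objects; the first two fields are what makes uniqueness and disjointness inductive.
theorem userInvariant {A : U} (hA : A ∈ P.honestUsers) (i : ℕ) : UserInvariant (T.state i) A := by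
  induction i with
  | zero => rw [hT.initial]; constructor <;> simp [Sys.initial]
  | succ i ih =>
    have he := hT.enabled i
    rw [hT.step i]
    by_cases hi : ∃ tx, T.act i = Action.issue tx
    · obtain ⟨tx, hi⟩ := hi
      rw [hi] at he ⊢
      obtain ⟨A', hA', hl, -, ho⟩ := he
      obtain ⟨h1, h2, h3, h4⟩ := ih
      by_cases hAA : A' = A
      · subst hAA
        have hx : ∀ t ∈ (T.state i).signed, t.slot ≠ tx.slot := by
          intro t ht hs
          exact lt_irrefl _ (h1 t ht _ (hs.trans hl))
        constructor <;> simp only [perform, Set.mem_union, Set.mem_singleton_iff, hl, if_true,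
          Set.mem_ofPred_eq]
        · rintro t (ht | rfl) sn hs
          · exact (h1 t ht sn hs).trans (Nat.lt_succ_self _)
          · rw [hl] at hs; cases hs; exact Nat.lt_succ_self _
        · rintro t (ht | rfl) sn hs o hto
          · exact Or.inl (h2 t ht sn hs o hto)
          · exact Or.inr ⟨trivial, hto⟩
        · rintro t (ht | rfl) t' (ht' | rfl) sn hs hs'
          · exact h3 t ht t' ht' sn hs hs'
          · exact absurd (hs.trans hs'.symm) (hx t ht)
          · exact absurd (hs'.trans hs.symm) (hx t' ht')
          · rfl
        · rintro t (ht | rfl) t' (ht' | rfl) sn sn' o hs hs' hto hto'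
          · exact h4 t ht t' ht' sn sn' o hs hs' hto hto'
          · exact absurd (h2 t ht sn hs o hto) (ho o hto').1
          · exact absurd (h2 t' ht' sn' hs' o hto') (ho o hto).1
          · rfl
      · have hne : ∀ sn, tx.slot ≠ some (A, sn) := by
          intro sn h
          rw [hl] at h
          exact hAA (congrArg Prod.fst (Option.some.inj h))
        constructor <;> simp only [perform, Set.mem_union, Set.mem_singleton_iff, hne, if_false,
          Set.mem_ofPred_eq, false_and, or_false]
        · rintro t (ht | rfl) sn hs
          · exact h1 t ht sn hs
          · exact absurd hs (hne sn)
        · rintro t (ht | rfl) sn hs o hto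
          · exact h2 t ht sn hs o hto
          · exact absurd hs (hne sn)
        · rintro t (ht | rfl) t' (ht' | rfl) sn hs hs'
          · exact h3 t ht t' ht' sn hs hs'
          · exact absurd hs' (hne sn)
          · exact absurd hs (hne sn)
          · rfl
        · rintro t (ht | rfl) t' (ht' | rfl) sn sn' o hs hs' hto hto'
          · exact h4 t ht t' ht' sn sn' o hs hs' hto hto'
          · exact absurd hs' (hne sn')
          · exact absurd hs (hne sn)
          · rfl
    · push Not at hi
      have hf : (perform P (T.time i) (T.state i) (T.act i)).sns = (T.state i).sns ∧
          (perform P (T.time i) (T.state i) (T.act i)).spent = (T.state i).spent := by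
        generalize T.act i = a at hi
        cases a <;> simp only [perform, State.setVal] <;> (try split_ifs) <;>
          first | exact ⟨rfl, rfl⟩ | exact ⟨trivial, trivial⟩ | exact absurd rfl (hi _)
      have hs : ∀ tx ∈ (perform P (T.time i) (T.state i) (T.act i)).signed, ∀ sn,
          tx.slot = some (A, sn) → tx ∈ (T.state i).signed := by
        intro tx h sn hl
        rcases signed_step h with h | h | h
        · exact h
        · exact absurd h (hi tx)
        · rw [h] at he
          obtain ⟨-, A', sn', hA', hl'⟩ := he
          rw [hl] at hl'
          cases hl'
          exact absurd hA hA'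
      obtain ⟨h1, h2, h3, h4⟩ := ih
      constructor <;> try simp only [hf.1, hf.2]
      · exact fun t ht sn hl => h1 t (hs t ht sn hl) sn hl
      · exact fun t ht sn hl => h2 t (hs t ht sn hl) sn hl
      · exact fun t ht t' ht' sn hl hl' => h3 t (hs t ht sn hl) t' (hs t' ht' sn hl') sn hl hl'
      · exact fun t ht t' ht' sn sn' o hl hl' =>
          h4 t (hs t ht sn hl) t' (hs t' ht' sn' hl') sn sn' o hl hl'

include hT in
theorem signed_unique {A : U} (hA : A ∈ P.honestUsers) {i j : ℕ} {tx tx' : Tx U R O C} {sn : ℕ}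
    (h : tx ∈ (T.state i).signed) (h' : tx' ∈ (T.state j).signed) (hl : tx.slot = some (A, sn))
    (hl' : tx'.slot = some (A, sn)) : tx = tx' :=
  (hT.userInvariant hA (max i j)).unique tx (hT.signed_mono (le_max_left i j) h) tx'
    (hT.signed_mono (le_max_right i j) h') sn hl hl'

include hP hT in
/-- The preconditions of a transaction of an honest user are eventually satisfied at every honest
validator, until the transaction is executed. -/
theorem eventually_ready {A : U} (hA : A ∈ P.honestUsers) {tx : Tx U R O C} {i : ℕ}
    (hi : T.act i = Action.issue tx) {sn : ℕ} (hl : tx.slot = some (A, sn)) {v : V}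
    (hv : v ∈ P.honest) :
    ∃ N, ∀ j, N ≤ j → (∀ n c, ¬ T.Applies P v tx c n) → ((T.state j).val v).Ready tx := by
  have he := hT.enabled i
  rw [hi] at he
  obtain ⟨A', -, hl', hd, ho⟩ := he
  rw [hl] at hl'
  cases hl'
  have hsg : tx ∈ (T.state (i + 1)).signed := by rw [hT.step i, hi]; exact Or.inr rfl
  have htot := totality hP hT i
  obtain ⟨N₁, hN₁⟩ : ∃ N, ∀ m, m + 1 = (T.state i).sns A → (A, m) ∈ ((T.state N).val v).done := by
    rcases hsn : (T.state i).sns A with _ | m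
    · exact ⟨0, fun m hm => by omega⟩
    · obtain ⟨Q, hQ, hd⟩ := hd m hsn.symm
      obtain ⟨u, hu, hu'⟩ := hP.exists_honest hQ
      obtain ⟨n, hn, tx', c, ha, hl'⟩ := (mem_done_iff hP hT).1 (hd u hu' hu)
      obtain ⟨j, hj⟩ := htot.applies u hu v hv tx' c n hn ha
      refine ⟨j + 1, fun m' hm' => ?_⟩
      obtain rfl : m' = m := by omega
      exact (mem_done_iff hP hT).2 ⟨j, Nat.lt_succ_self j, tx', c, hj, hl'⟩
  obtain ⟨N₂, hN₂⟩ := exists_forall_mem_finset (φ := fun o j => T.CreatedBefore P v (A, o) j)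
    tx.objs (fun o a b hab h => h.mono hab)
    (fun o hto => by
      obtain ⟨Q, hQ, h⟩ := (ho o hto).2
      obtain ⟨u, hu, hu'⟩ := hP.exists_honest hQ
      exact htot.created u hu v hv (A, o) (hT.createdBefore_of_owned (h u hu' hu)))
  refine ⟨max N₁ N₂, fun j hj hna A' sn' hl' => ?_⟩
  rw [hl] at hl'
  cases hl'
  simp only [max_le_iff] at hj
  refine ⟨fun m hm => hT.done_mono hj.1 (hN₁ m hm), fun o hto => ?_⟩
  -- A consumer of the object is settled, hence signed by the same honest user, who never spends an
  -- object twice; so it is `tx`, which is assumed not to be applied.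
  refine (hT.owned_or_consumed (hN₂ o hto) hj.2).resolve_right ?_
  rintro ⟨n, -, tx', c, ha, ho', sn', hl'⟩
  have hsg' := Settled.signed hP hT (Applies.spec hP hT ha).2.1
  obtain rfl := (hT.userInvariant hA (max (i + 1) n)).disjoint tx
    (hT.signed_mono (le_max_left _ _) hsg) tx' (hT.signed_mono (le_max_right _ _) hsg') _ sn' o
    hl hl' hto ho'
  exact hna n c ha

include hT in
theorem exists_recvTx {i : ℕ} {v : V} {tx : Tx U R O C} (h : tx ∈ ((T.state i).val v).rcvdTx) :
    ∃ j, T.act j = Action.recvTx v tx := by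
  induction i with
  | zero => rw [hT.initial] at h; simp [Sys.initial] at h
  | succ i ih =>
    rw [hT.step i] at h
    rcases (message_step (hT.enabled i) _).rcvdTx_step h with h | h
    · exact ih h
    · exact ⟨i, h⟩

include hP hT in
/-- A transaction of an honest user reaches its recipient. -/
theorem issue_inbox {A : U} (hA : A ∈ P.honestUsers) {tx : Tx U R O C} (hu : tx.IsUARA) {i : ℕ}
    (hi : T.act i = Action.issue tx) {sn : ℕ} (hl : tx.slot = some (A, sn)) {v : V}
    (hv : v ∈ P.honest) :
    -- The second alternative is needed: a block may bring `tx` to execution before `v` forwards it,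
    -- and then its preconditions may never hold again.
    (∃ j, tx ∈ ((T.state j).val v).inbox) ∨ ∃ n c, T.Applies P v tx c n := by
  refine or_iff_not_imp_right.2 fun hna => ?_
  push Not at hna
  have hsg : tx ∈ (T.state (i + 1)).signed := by rw [hT.step i, hi]; exact Or.inr rfl
  obtain ⟨N, hN⟩ := eventually_ready hP hT hA hi hl hv
  obtain ⟨j, -, hj⟩ := hT.delivery_user i v hv tx A sn hsg hl hA
  obtain ⟨n, hn⟩ := hT.exists_recvTx hj
  -- FP-locks are given to signed transactions only, and the honest user has signed no other
  -- transaction for this slot.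
  have hfree : lockOf ((T.state n).val v).fpLocked tx = none ∨
      lockOf ((T.state n).val v).fpLocked tx = some tx := by
    rw [lockOf_of_slot hl]
    refine or_iff_not_imp_left.2 fun h => ?_
    obtain ⟨tx', h⟩ := Option.ne_none_iff_exists'.1 h
    obtain ⟨h1, h2⟩ := hT.fpLocked_spec h
    rw [h, hT.signed_unique hA hsg h1 hl h2]
  have haw : tx ∈ ((T.state (n + 1)).val v).awaiting := by
    rw [hT.step n, hn]
    simp [perform, VState.receiveTx, hu, hfree]
  by_contra hc
  push Not at hc
  have hfw : ∀ j, T.act j = Action.forward v tx → tx ∈ ((T.state (j + 1)).val v).inbox := by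
    intro j ha
    rw [hT.step j, ha]
    simp [perform]
  have hst : ∀ j, n + 1 ≤ j → tx ∈ ((T.state j).val v).awaiting := by
    intro j hj
    induction hj with
    | refl => exact haw
    | @step j _ ih =>
      have := (userActor_step (hT.enabled j) _).awaiting_persist ih
      rw [← hT.step j] at this
      exact this.resolve_right fun ha => hc _ (hfw j ha)
  obtain ⟨j, -, hj⟩ := hT.eventually_of_fair (a := Action.forward v tx) trivial
    (φ := fun j => tx ∈ ((T.state j).val v).inbox) (max (n + 1) N)
    (fun j hj _ => by
      simp only [max_le_iff] at hj
      exact ⟨hv, hst j hj.1, hN j hj.2 hna⟩)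
    (fun j _ _ ha => hfw j ha)
  exact hc j hj

include hT in
theorem executes_of_applies {i : ℕ} {v : V} {tx : Tx U R O C} {c : Finset (U × O)}
    (hu : tx.IsUARA) (h : T.Applies P v tx c i) : ∃ X j, T.Executes v X tx j := by
  have he := hT.enabled i
  rcases h with ⟨h, -⟩ | h <;> rw [h] at he
  · exact absurd hu (Tx.not_isUARA_of_isUA he.2.1)
  · obtain ⟨-, X, j, -, hj, -⟩ := hT.notice_executes he.2.1
    exact ⟨X, j, hj⟩

include hP hT in
-- The absence of rivals comes from honest signing: an SP-locked transaction was FP-locked by some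
-- honest validator, hence signed, and the slot has only one signed transaction.
theorem issue_executes {A : U} (hA : A ∈ P.honestUsers) {tx : Tx U R O C} (hu : tx.IsUARA) {X : R}
    (hX : tx.recv = some X) {i : ℕ} (hi : T.act i = Action.issue tx) {sn : ℕ}
    (hl : tx.slot = some (A, sn)) (ha : T.IsActor P X) {v : V} (hv : v ∈ P.honest) :
    ∃ j, i < j ∧ T.Executes v X tx j := by
  have hr := hP.resilience
  have hsg : tx ∈ (T.state (i + 1)).signed := by rw [hT.step i, hi]; exact Or.inr rfl
  obtain ⟨j, hj⟩ := eventually_executes hP hT hX (fun w hw => actor_progresses hP hT ha hw)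
    (fun n w l tx' hl' h => by
      rw [hl] at hl'
      cases hl'
      obtain ⟨u, -, hlk⟩ := hT.exists_locked hP (by omega) (hT.spLocked_lockedBy hP h)
      exact hT.signed_unique hA (hT.locked_signed hlk) hsg (hT.spLocked_slot h) hl)
    (fun w hw => (issue_inbox hP hT hA hu hi hl hw).imp_right fun ⟨n, c, h⟩ => by
      obtain ⟨Y, j, hj⟩ := hT.executes_of_applies hu h
      have hY := (executes_spec hP hT hj).1
      rw [hX] at hY
      cases hY
      exact ⟨j, hj⟩) hv
  refine ⟨j, ?_, hj⟩
  -- An execution not after the issue would need `tx` to be signed already, but all earlier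
  -- signatures of the user have smaller sequence numbers.
  by_contra hij
  have hs := hT.signed_mono (not_lt.1 hij)
    (Settled.signed hP hT ((executes_spec hP hT hj).2.2 hu))
  have he := hT.enabled i
  rw [hi] at he
  obtain ⟨A', -, hl', -⟩ := he
  rw [hl] at hl'
  cases hl'
  exact lt_irrefl _ ((hT.userInvariant hA i).lt_sns tx hs _ hl)

end Trace.IsExecution

end Mangrove

/-! ### The main theorem. -/

theorem mainTheorem6 {V U R O C S : Type*} [Fintype V]
    (P : Mangrove.Sys V U R O C S) (hP : P.Valid)
    (T : Mangrove.Trace V U R O C S) (hT : T.IsExecution P) :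
    -- Agreement
    (∀ v₁ ∈ P.honest, ∀ v₂ ∈ P.honest, ∀ X tx,
      (∃ i, T.Executes v₁ X tx i) → ∃ j, T.Executes v₂ X tx j) ∧
    -- Validity, UA-RA transactions of honest users
    (∀ A ∈ P.honestUsers, ∀ sn X objs pre call post i,
      T.act i = Mangrove.Action.issue (.uara A sn X objs pre call post) → T.IsActor P X →
      ∀ v ∈ P.honest, ∃ j, i < j ∧ T.Executes v X (.uara A sn X objs pre call post) j) ∧
    -- Validity, RA-RA transactions emitted at honest validators
    (∀ v₁ ∈ P.honest, ∀ X Y objs pre call post i,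
      T.Produces P v₁ X (.rara X Y objs pre call post) i → T.IsActor P Y →
      ∀ v ∈ P.honest, ∃ j, T.Executes v Y (.rara X Y objs pre call post) j) ∧
    -- Total Order
    (∀ v₁ ∈ P.honest, ∀ v₂ ∈ P.honest, ∀ X tx₁ tx₂,
      (∃ i₁ i₂, i₁ < i₂ ∧ T.Executes v₁ X tx₁ i₁ ∧ T.Executes v₁ X tx₂ i₂) →
      ∃ j₁ j₂, j₁ < j₂ ∧ T.Executes v₂ X tx₁ j₁ ∧ T.Executes v₂ X tx₂ j₂) ∧
    -- Integrity, at most once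
    (∀ v ∈ P.honest, ∀ X tx i j, T.Executes v X tx i → T.Executes v X tx j → i = j) ∧
    -- Integrity, only if emitted
    (∀ v ∈ P.honest, ∀ X tx i, T.Executes v X tx i → ∃ j, j < i ∧ T.Emitted P tx j) := by
  -- A single execution shows that the reactive actor exists, so its entities run all instances at
  -- every honest validator; Agreement and Total Order need no separate assumption on this.
  have hact : ∀ {v w X tx i}, w ∈ P.honest → T.Executes v X tx i →
      Mangrove.Trace.IsExecution.Progresses T w X := fun hw h =>
    Mangrove.Trace.IsExecution.actor_progresses hP hT (hT.isActor_of_executes h) hw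
  refine ⟨fun v₁ _ v₂ hv₂ X tx ⟨i, h⟩ => ?_, fun A hA sn X objs pre call post i hi ha v hv => ?_,
    fun v₁ _ X Y objs pre call post i h ha v hv => ?_,
    fun v₁ _ v₂ hv₂ X tx₁ tx₂ ⟨i₁, i₂, hi, h₁, h₂⟩ => ?_,
    fun v _ X tx i j h h' => hT.executes_unique h h', fun v _ X tx i h => ?_⟩
  · obtain ⟨j, hj, -⟩ := Mangrove.Trace.IsExecution.executes_sync hP hT (hact hv₂ h) h
    exact ⟨j, hj⟩
  · exact Mangrove.Trace.IsExecution.issue_executes hP hT hA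
      (tx := .uara A sn X objs pre call post) trivial rfl hi rfl ha hv
  · exact Mangrove.Trace.IsExecution.produces_executes hP hT rfl h ha hv
  · exact Mangrove.Trace.IsExecution.total_order hP hT (hact hv₂ h₁) hi h₁ h₂
  · exact (Mangrove.Trace.IsExecution.executes_spec hP hT h).2.1
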